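/- **Conventions.** "Smooth" means of class $C^2$ (so every $C^r$ manifold or function with $r\ge 2$, or $r=\infty$, is allowed). A *Morse function* on a closed smooth 3-manifold $M$ is a $C^2$ function $\varphi:M\to\mathbb R$ whose Hessian is nondegenerate at every critical point; the *index* at a critical point is the maximal dimension of a subspace on which the Hessian is negative definite. It is *climbing*, with *chain of critical points* $(p_0,\dots,p_k)$, if its critical points are exactly $p_0,\dots,p_k$ and $\varphi(p_0)<\dots<\varphi(p_k)$. **Canonical charts.** Let $p$ be a critical point of $\varphi$ of index $n$ and let $\delta>0$. A canonical chart with respect to $M,\varphi,p,\delta$ is a pair $(U,h)$, where $U\subset M$ is compact and $h$ is the restriction to $U$ of a chart of $M$ defined on an open neighbourhood of $U$, such that $p\in\operatorname{int}U$, $h(p)=0$; $\frac1\delta\bigl(\varphi(h^{-1}(x))-\varphi(p)\bigr)=\sum_{i=1}^3\varepsilon_ix_i^2$ for all $x\in V=h(U)$, with $\varepsilon_i=1$ for $i\le 3-n$ and $\varepsilon_i=-1$ otherwise; and $V$ is the following set. - If $n\in\{0,3\}$, $V$ is the closed unit ball of $\mathbb R^3$. - If $n=1$, put $\psi(x)=x_1^2+x_2^2-x_3^2$,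 $H^\pm=\{\psi=-1,\ 0\le\pm x_3\le2\}$, $L=\{\psi=1\}$; let $R^\pm$ be the union of the images of all solutions $c:[0,\mu]\to\mathbb R^3$, $\mu>0$, of $c'=(\operatorname{grad}\psi)(c)$ with $c(0)\in\partial H^\pm$ and $c(\mu)\in L$; let $Q$ be the closure of the bounded component of $L\setminus(R^+\cup R^-)$. Then $V$ is the closure of the bounded component of $\mathbb R^3\setminus(H^+\cup H^-\cup R^+\cup R^-\cup Q)$. - If $n=2$, $V$ is obtained from the set $V$ of the case $n=1$ by a rotation by $\frac\pi2$ around the $x_2$-axis. **Stratifications.** If $\ell:S\to F\times[0,1]$ is a homeomorphism, write $U(S,\ell)=\ell^{-1}(F\times\{1\})$ and $L(S,\ell)=\ell^{-1}(F\times\{0\})$. A *stratification* of a compact subset $N\subset M$ is a finite sequence $S_1,\dots,S_r$ of 3-dimensional (locally flat) submanifolds with boundary of $M$ with $N=S_1\cup\dots\cup S_r$, together with homeomorphisms $\ell_i:S_i\to F_i\times[0,1]$, where the $F_i$ are compact orientable 2-manifolds (possibly with boundary, possibly disconnected), such that $$S_i\cap S_{i+1}=U(S_i,\ell_i)\cap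 L(S_{i+1},\ell_{i+1})\quad\text{for } 1\le i<r,\qquad S_i\cap S_j=\emptyset\quad\text{if }|i-j|\ge2 .$$ **Proposition.** Let $M$ be a compact orientable smooth 3-manifold without boundary, $\varphi:M\to\mathbb R$ a climbing Morse function and $(p_0,\dots,p_k)$ its chain of critical points. Let $\delta_0,\dots,\delta_k$ be positive numbers with $\varphi(p_i)+\delta_i<\varphi(p_{i+1})-\delta_{i+1}$ for $0\le i<k$, and let $(U_i,h_i)$ be canonical charts with respect to $M,\varphi,p_i,\delta_i$, $0\le i\le k$. Then $N=\operatorname{cl}\bigl(M\setminus(U_0\cup\dots\cup U_k)\bigr)$ is a 3-dimensional (locally flat, topological) submanifold with boundary of $M$, and there exists a stratification of $N$. -/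

import Mathlib

open Set Topology Manifold

universe u

noncomputable section


/-- Euclidean `3`-space. -/
abbrev E3 : Type := EuclideanSpace ℝ (Fin 3)

/-! ### Orientability -/

/-- A manifold (possibly with boundary, of dimension at least `2`) is orientable if it is covered
by charts of its `C¹` structure whose transition maps all have positive Jacobian determinant. -/
def IsOrientable {E H : Type*} [NormedAddCommGroup E] [NormedSpace ℝ E] [TopologicalSpace H]
    (I : ModelWithCorners ℝ E H) (X : Type*) [TopologicalSpace X] [ChartedSpace H X] : Prop :=
  ∃ A : Set (OpenPartialHomeomorph X H),
    A ⊆ IsManifold.maximalAtlas I 1 X ∧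
    (∀ x : X, ∃ e ∈ A, x ∈ e.source) ∧
    ∀ e ∈ A, ∀ e' ∈ A, ∀ x ∈ e.source ∩ e'.source,
      0 < (fderivWithin ℝ (fun y : E => I (e' (e.symm (I.symm y)))) (range I) (I (e x))).det

/-! ### Morse functions on closed `3`-manifolds -/

section Morse

variable {M : Type*} [TopologicalSpace M] [ChartedSpace E3 M]

/-- `p` is a critical point of `φ`: the differential of `φ` vanishes at `p`. -/
def IsCritical (φ : M → ℝ) (p : M) : Prop :=
  mfderiv (𝓡 3) 𝓘(ℝ) φ p = 0

/-- The second derivative of `φ` at `p`, in the preferred chart at `p`. -/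
def hessian (φ : M → ℝ) (p : M) : E3 →L[ℝ] E3 →L[ℝ] ℝ :=
  fderiv ℝ (fderiv ℝ (φ ∘ (extChartAt (𝓡 3) p).symm)) (extChartAt (𝓡 3) p p)

/-- A Morse function: of class `C²`, with nondegenerate Hessian at every critical point. -/
def IsMorse (φ : M → ℝ) : Prop :=
  ContMDiff (𝓡 3) 𝓘(ℝ) 2 φ ∧
    ∀ p, IsCritical φ p → ∀ v, (∀ w, hessian φ p v w = 0) → v = 0

/-- The index of `φ` at a critical point `p`: the largest dimension of a subspace on which the
Hessian is negative definite. -/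
def morseIndex (φ : M → ℝ) (p : M) : ℕ :=
  sSup {d | ∃ W : Submodule ℝ E3, Module.finrank ℝ W = d ∧
    ∀ v ∈ W, v ≠ 0 → hessian φ p v v < 0}

/-- `φ` is a climbing Morse function with chain of critical points `p 0, …, p k`. -/
def IsClimbing (φ : M → ℝ) {k : ℕ} (p : Fin (k + 1) → M) : Prop :=
  IsMorse φ ∧ StrictMono (φ ∘ p) ∧ range p = {x | IsCritical φ x}

end Morse

/-! ### Canonical charts -/

/-- The standard quadratic form `∑ εᵢ xᵢ²` (`i = 1, 2, 3`) of index `n`: `εᵢ = 1` if `i ≤ 3 - n`,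
and `εᵢ = -1` otherwise. The coordinate `x_i` is `x (i - 1)` here. -/
def stdForm (n : ℕ) (x : E3) : ℝ :=
  ∑ i : Fin 3, (if (i : ℕ) + 1 + n ≤ 3 then (1 : ℝ) else -1) * x i ^ 2

/-- The union of the bounded connected components of a set. -/
def boundedPart (A : Set E3) : Set E3 :=
  {x | x ∈ A ∧ Bornology.IsBounded (connectedComponentIn A x)}

/-- The disc `H⁺` (for `s = 1`), or `H⁻` (for `s = -1`). -/
def bay (s : ℝ) : Set E3 := {x | stdForm 1 x = -1 ∧ 0 ≤ s * x 2 ∧ s * x 2 ≤ 2}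

/-- The boundary circle of the disc `H⁺` or `H⁻`. -/
def bayRim (s : ℝ) : Set E3 := {x ∈ bay s | s * x 2 = 2}

/-- The cylindrical surface `L = {ψ = 1}`. -/
def cylL : Set E3 := {x | stdForm 1 x = 1}

/-- The ring `R⁺` or `R⁻`, swept out by the gradient trajectories of `ψ` that start on the
boundary of `H⁺` or `H⁻` and end on `L`. -/
def ring3 (s : ℝ) : Set E3 :=
  {x | ∃ μ : ℝ, 0 < μ ∧ ∃ c : ℝ → E3,
    (∀ t ∈ Icc 0 μ, HasDerivWithinAt c (gradient (stdForm 1) (c t)) (Icc 0 μ) t) ∧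
    c 0 ∈ bayRim s ∧ c μ ∈ cylL ∧ x ∈ c '' Icc 0 μ}

/-- The cloak `Q`: the closure of the bounded component of `L ∖ (R⁺ ∪ R⁻)`. -/
def cloak : Set E3 := closure (boundedPart (cylL \ (ring3 1 ∪ ring3 (-1))))

/-- The `2`-sphere `H⁺ ∪ H⁻ ∪ R⁺ ∪ R⁻ ∪ Q`. -/
def canonicalSphere : Set E3 := bay 1 ∪ bay (-1) ∪ ring3 1 ∪ ring3 (-1) ∪ cloak

/-- The `3`-disc bounded by `canonicalSphere`: the closure of the bounded component of its
complement. -/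
def canonicalBall : Set E3 := closure (boundedPart canonicalSphereᶜ)

/-- The rotation about the second coordinate axis by a right angle. -/
def rotY (x : E3) : E3 := !₂[x 2, x 1, -x 0]

/-- The image `V` of a canonical chart at a critical point of index `n` (where `n ≤ 3`). -/
def canonicalDomain (n : ℕ) : Set E3 :=
  if n = 1 then canonicalBall
  else if n = 2 then rotY '' canonicalBall
  else Metric.closedBall 0 1

/-- `(U, h)`, where `h` is the restriction of the chart `e` to the compact set `U`, is a canonical
chart with respect to `M`, `φ`, `p` and `δ`. -/
structure IsCanonicalChart {M : Type*} [TopologicalSpace M] [ChartedSpace E3 M]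
    (φ : M → ℝ) (p : M) (δ : ℝ) (e : OpenPartialHomeomorph M E3) (U : Set M) : Prop where
  isChart : e ∈ IsManifold.maximalAtlas (𝓡 3) 2 M
  isCompact : IsCompact U
  subset_source : U ⊆ e.source
  mem_interior : p ∈ interior U
  map_center : e p = 0
  normal_form : ∀ x ∈ e '' U, (1 / δ) * (φ (e.symm x) - φ p) = stdForm (morseIndex φ p) x
  image_eq : e '' U = canonicalDomain (morseIndex φ p)

/-! ### Stratifications -/

/-- A compact orientable `2`-manifold, with or without boundary, not necessarily connected. -/
structure CompactOrientableSurface where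
  carrier : Type u
  [top : TopologicalSpace carrier]
  [t2 : T2Space carrier]
  [compact : CompactSpace carrier]
  [charted : ChartedSpace (EuclideanHalfSpace 2) carrier]
  [manifold : IsManifold (𝓡∂ 2) 1 carrier]
  orientable : IsOrientable (𝓡∂ 2) carrier

attribute [instance] CompactOrientableSurface.top CompactOrientableSurface.t2
  CompactOrientableSurface.compact CompactOrientableSurface.charted
  CompactOrientableSurface.manifold

section Stratification

variable {M : Type u} [TopologicalSpace M]

/-- `S` is a (locally flat, topological) `3`-dimensional submanifold with boundary of the
`3`-manifold `M`: around each point of `S` there are local coordinates of `M` in which `S` is given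
by the inequality `0 ≤ y₁`. Points of `S` with `0 < y₁` are interior points of `S`. -/
def IsSubmanifold3 (S : Set M) : Prop :=
  ∀ x ∈ S, ∃ e : OpenPartialHomeomorph M E3, x ∈ e.source ∧ e.IsImage S {y : E3 | 0 ≤ y 0}

/-- The upper boundary `U(S, ℓ) = ℓ⁻¹(F × {1})`. -/
def upperBoundary {S : Set M} {F : Type u} [TopologicalSpace F]
    (ℓ : S ≃ₜ F × unitInterval) : Set M := (↑) '' {x : S | (ℓ x).2 = 1}

/-- The lower boundary `L(S, ℓ) = ℓ⁻¹(F × {0})`. -/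
def lowerBoundary {S : Set M} {F : Type u} [TopologicalSpace F]
    (ℓ : S ≃ₜ F × unitInterval) : Set M := (↑) '' {x : S | (ℓ x).2 = 0}

/-- The sequence `S` is a stratification of the subset `N` of the `3`-manifold `M`. -/
def IsStratification (N : Set M) {r : ℕ} (S : Fin r → Set M) : Prop :=
  (∀ i, IsSubmanifold3 (S i)) ∧ N = ⋃ i, S i ∧
  ∃ (F : Fin r → CompactOrientableSurface.{u}) (ℓ : ∀ i, S i ≃ₜ (F i).carrier × unitInterval),
    (∀ i j : Fin r, (j : ℕ) = i + 1 → S i ∩ S j = upperBoundary (ℓ i) ∩ lowerBoundary (ℓ j)) ∧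
    ∀ i j : Fin r, (i : ℕ) + 2 ≤ j → S i ∩ S j = ∅

end Stratification

end

/-!
The manifold `N`, the closed complement of the canonical neighbourhoods `U i`, is cut along levels
of `φ` into thin slabs, each of which is the product of a level surface with an interval. This is
Morse theory on a manifold with corners, in which the part of `∂ N` on which `φ` is not locally
constant is treated as a second coordinate.

*Blocks.* An adapted chart has `φ` as its first coordinate, and it describes a set `B` by the
inequalities `a ≤ φ ≤ b` and `0 ≤ y₁` (`IsAdaptedChart`); a block is a closed set covered by adapted
charts (`IsBlock`). Away from the `U i` an adapted chart comes from the inverse function theorem at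
a regular point. At a point `x ∈ U i` on the boundary, the canonical domain has to be known. It is
`{|ψ| ≤ 1, g ≤ 12}`, where `ψ` is the standard quadratic form and, in index `1`,
`g = (x₁² + x₂²) x₃²` is constant along the trajectories of `grad ψ` (`ring3_subset`,
`canonicalBall_eq`, `exists_isModel`). On the wall `g = 12` the functions `φ`, `g` and a suitable
linear form are coordinates, because `φ` has the differential of its normal form up to the boundary
(`IsModel.fderiv_eq`). The rest of the boundary lies on the levels `φ (p i) ± δ i`, and there the
normal form says nothing about `φ` outside `U i`; but the radial derivative of `φ` points out of
the interval of values, so that the slab between the two levels does not reach these points except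
along the wall (`IsModel.eventually_notMem_Icc`). Hence the part of `N` between the two levels of
`p i` is a block (`IsModel.isBlock`), and so is the full slab between consecutive critical slabs
(`isBlock_preimage_Icc`).

*Thin slabs of blocks are products.* Instead of the flow of a gradient-like vector field tangent to
the wall, finitely many vertical pushes are used, each inside one adapted chart. For a function
`f : X → [0, 1]` on a slab `X` let `E f` be the space of pairs `(y, t)` with
`φ y = c + (t - c) f y`. Then `E 0` is the product of the level `c` with an interval, and `E 1` is
the slab. If `f` and `f'` differ only inside a chart and have small slope along its vertical lines,
moving along these lines is a homeomorphism of `E f` and `E f'` over the interval. Going from `0` to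
`1` through the maxima of finitely many bump functions proves the claim
(`exists_homeomorph_level_prod`, `IsBlock.exists_homeomorph_thin_slab`). The vertical lines respect
the inequality `0 ≤ y₁`, so the wall needs no separate treatment.

*Surfaces and submanifolds.* The last two coordinates of the positively oriented adapted charts form
an oriented atlas of a level of a block (`IsBlock.exists_surface`). A slab of a block has corners,
which a piecewise linear homeomorphism straightens (`IsBlock.isSubmanifold3_slab`). By a Lebesgue
number argument, a block is a stack of thin slabs (`IsStack.append_block`), and stacking the blocks
in the order of their levels exhausts `N` (`isStack_closure_compl_iUnion`).

*Local flatness of `N`.* A canonical domain is the unit ball of the gauge `max |ψ| √(g / 12)`, which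
is homogeneous of degree `2`, continuous, and positive off the origin. Polar coordinates with
respect to this gauge flatten its boundary (`isSubmanifold3_closure_compl_iUnion`).
-/


noncomputable section

/-! ### Straightening a function by vertical pushes -/

section Push

set_option linter.unusedSectionVars false

variable {X : Type*} [TopologicalSpace X]

/-- A motion along the vertical lines of a box `W` on which `φ` is the height: `m u y` is the point
of height `u` on the vertical line through `y`, for all heights `u ∈ J`. -/
structure IsVerticalMove (φ : X → ℝ) (J : Set ℝ) (W : Set X) (m : ℝ → X → X) : Prop where
  isOpen : IsOpen W
  mem : ∀ u ∈ J, ∀ y ∈ W, m u y ∈ W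
  level : ∀ u ∈ J, ∀ y ∈ W, φ (m u y) = u
  self : ∀ y ∈ W, m (φ y) y = y
  comp : ∀ u ∈ J, ∀ v ∈ J, ∀ y ∈ W, m u (m v y) = m u y
  cont : ContinuousOn (fun z : ℝ × X => m z.1 z.2) (J ×ˢ W)

/-- The space of pairs `(y, t)` for which `y` lies on the hypersurface `φ = c + (t - c) f`. It
interpolates between `{φ = c} × [α, β]` for `f = 0` and the graph of `φ` for `f = 1`. -/
def movingLevel (φ : X → ℝ) (c α β : ℝ) (f : X → ℝ) : Set (X × Icc α β) :=
  {z | φ z.1 = c + (z.2 - c) * f z.1}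

/-- `f` has slope at most `K` along the vertical lines of `W`. -/
def SlopeLE (α β : ℝ) (W : Set X) (m : ℝ → X → X) (K : ℝ) (f : X → ℝ) : Prop :=
  ∀ y ∈ W, ∀ u ∈ Icc α β, ∀ v ∈ Icc α β, |f (m u y) - f (m v y)| ≤ K * |u - v|

/-- The height at which the vertical line through `y` meets the hypersurface
`φ = c + (t - c) f`. -/
def hitHeight (c α β : ℝ) (m : ℝ → X → X) (f : X → ℝ) (t : ℝ) (y : X) : ℝ :=
  open Classical in
  if h : ∃ u ∈ Icc α β, u = c + (t - c) * f (m u y) then h.choose else 0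

variable {φ : X → ℝ} {c α β K : ℝ} {W Z : Set X} {m : ℝ → X → X} {f f' : X → ℝ}

theorem SlopeLE.max (h : SlopeLE α β W m K f) (h' : SlopeLE α β W m K f') :
    SlopeLE α β W m K (fun x => max (f x) (f' x)) := fun y hy u hu v hv =>
  (abs_max_sub_max_le_max _ _ _ _).trans (max_le (h y hy u hu v hv) (h' y hy u hu v hv))

theorem add_mul_mem_Icc {t s : ℝ} (hc : c ∈ Icc α β) (ht : t ∈ Icc α β) (h0 : 0 ≤ s) (h1 : s ≤ 1) :
    c + (t - c) * s ∈ Icc α β := by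
  have := (convex_Icc α β).add_smul_sub_mem hc ht ⟨h0, h1⟩
  simpa [mul_comm] using this

theorem SlopeLE.abs_sub_le (hf : SlopeLE α β W m K f) (hc : c ∈ Icc α β) {t : ℝ}
    (ht : t ∈ Icc α β) {y : X} (hy : y ∈ W) {u v : ℝ} (hu : u ∈ Icc α β) (hv : v ∈ Icc α β) :
    |(t - c) * f (m u y) - (t - c) * f (m v y)| ≤ K * (β - α) * |u - v| := by
  rw [← mul_sub, abs_mul]
  have h1 : |t - c| ≤ β - α := abs_le.2 ⟨by linarith [hc.2, ht.1], by linarith [hc.1, ht.2]⟩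
  calc |t - c| * |f (m u y) - f (m v y)| ≤ (β - α) * (K * |u - v|) :=
        mul_le_mul h1 (hf y hy u hu v hv) (abs_nonneg _) ((abs_nonneg _).trans h1)
    _ = _ := by ring

/-- The vertical line through `y` meets the hypersurface `φ = c + (t - c) f`, by the intermediate value
theorem. -/
theorem exists_hit (hc : c ∈ Icc α β) (hf : SlopeLE α β W m K f) (h01 : ∀ x, f x ∈ Icc (0 : ℝ) 1)
    {t : ℝ} (ht : t ∈ Icc α β) {y : X} (hy : y ∈ W) :
    ∃ u ∈ Icc α β, u = c + (t - c) * f (m u y) := by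
  have hab : α ≤ β := hc.1.trans hc.2
  have hcont : ContinuousOn (fun u => u - (c + (t - c) * f (m u y))) (Icc α β) := by
    have : ContinuousOn (fun u => f (m u y)) (Icc α β) := by
      refine (LipschitzOnWith.of_dist_le_mul (K := K.toNNReal) fun u hu v hv => ?_).continuousOn
      rw [Real.dist_eq, Real.dist_eq]
      exact (hf y hy u hu v hv).trans
        (mul_le_mul_of_nonneg_right (Real.le_coe_toNNReal K) (abs_nonneg _))
    exact continuousOn_id.sub (continuousOn_const.add (continuousOn_const.mul this))
  have key := fun u => add_mul_mem_Icc hc ht (h01 (m u y)).1 (h01 (m u y)).2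
  obtain ⟨u, hu, h0⟩ := intermediate_value_Icc hab hcont
    (show (0 : ℝ) ∈ _ from ⟨by linarith [(key α).1], by linarith [(key β).2]⟩)
  exact ⟨u, hu, by simpa [sub_eq_zero] using h0⟩

/-- The vertical line through `y` meets the hypersurface `φ = c + (t - c) f` only once, because
`(t - c) f` is a contraction along it. -/
theorem hit_unique (hc : c ∈ Icc α β) (hf : SlopeLE α β W m K f) (hK : K * (β - α) < 1)
    {t : ℝ} (ht : t ∈ Icc α β) {y : X} (hy : y ∈ W) {u v : ℝ} (hu : u ∈ Icc α β)
    (hv : v ∈ Icc α β) (hu' : u = c + (t - c) * f (m u y)) (hv' : v = c + (t - c) * f (m v y)) :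
    u = v := by
  have h := hf.abs_sub_le hc ht hy hu hv
  have h2 : (t - c) * f (m u y) - (t - c) * f (m v y) = u - v := by linarith
  rw [h2] at h
  by_contra hne
  have : 0 < |u - v| := abs_pos.2 (sub_ne_zero.2 hne)
  nlinarith

theorem hitHeight_spec (hc : c ∈ Icc α β) (hf : SlopeLE α β W m K f)
    (h01 : ∀ x, f x ∈ Icc (0 : ℝ) 1) {t : ℝ} (ht : t ∈ Icc α β) {y : X} (hy : y ∈ W) :
    hitHeight c α β m f t y ∈ Icc α β ∧
      hitHeight c α β m f t y = c + (t - c) * f (m (hitHeight c α β m f t y) y) := by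
  have h := exists_hit hc hf h01 ht hy
  rw [hitHeight, dif_pos h]
  exact h.choose_spec

theorem hitHeight_eq (hc : c ∈ Icc α β) (hf : SlopeLE α β W m K f) (hK : K * (β - α) < 1)
    (h01 : ∀ x, f x ∈ Icc (0 : ℝ) 1) {t : ℝ} (ht : t ∈ Icc α β) {y : X} (hy : y ∈ W) {u : ℝ}
    (hu : u ∈ Icc α β) (hu' : u = c + (t - c) * f (m u y)) : hitHeight c α β m f t y = u :=
  hit_unique hc hf hK ht hy (hitHeight_spec hc hf h01 ht hy).1 hu
    (hitHeight_spec hc hf h01 ht hy).2 hu'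

theorem continuousOn_hitHeight (hc : c ∈ Icc α β) (hm : IsVerticalMove φ (Icc α β) W m)
    (hf : SlopeLE α β W m K f) (hK : K * (β - α) < 1) (h01 : ∀ x, f x ∈ Icc (0 : ℝ) 1)
    (hfc : Continuous f) :
    ContinuousOn (fun z : X × Icc α β => hitHeight c α β m f z.2 z.1) {z | z.1 ∈ W} := by
  rintro ⟨y₀, t₀⟩ (hy₀ : y₀ ∈ W)
  set u₀ := hitHeight c α β m f t₀ y₀ with hu₀
  obtain ⟨hu₀m, hu₀e⟩ := hitHeight_spec hc hf h01 t₀.2 hy₀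
  rw [← hu₀] at hu₀m hu₀e
  -- the error made by freezing the height at `u₀`
  set g : X × Icc α β → ℝ := fun z =>
    |(z.2 - c) * f (m u₀ z.1) - (t₀ - c) * f (m u₀ y₀)| / (1 - K * (β - α)) with hg
  have hgc : ContinuousWithinAt g {z | z.1 ∈ W} (y₀, t₀) := by
    have h1 : ContinuousWithinAt (fun z : X × Icc α β => m u₀ z.1) {z | z.1 ∈ W} (y₀, t₀) :=
      (hm.cont.comp (f := fun z : X × Icc α β => (u₀, z.1)) (s := {z | z.1 ∈ W})
        (Continuous.continuousOn (by fun_prop)) fun z hz => ⟨hu₀m, hz⟩) (y₀, t₀) hy₀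
    have h2 : ContinuousWithinAt (fun z : X × Icc α β => f (m u₀ z.1)) {z | z.1 ∈ W} (y₀, t₀) :=
      hfc.continuousAt.comp_continuousWithinAt h1
    have h3 : ContinuousWithinAt (fun z : X × Icc α β => ((z.2 : ℝ) - c)) {z | z.1 ∈ W} (y₀, t₀) :=
      Continuous.continuousWithinAt (by fun_prop)
    exact (((h3.mul h2).sub continuousWithinAt_const).abs).div_const _
  have hg0 : g (y₀, t₀) = 0 := by simp [hg]
  rw [ContinuousWithinAt, hg0] at hgc
  rw [ContinuousWithinAt, tendsto_iff_dist_tendsto_zero]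
  refine squeeze_zero' (Filter.Eventually.of_forall fun _ => dist_nonneg) ?_ hgc
  filter_upwards [self_mem_nhdsWithin] with z hz
  obtain ⟨hum, hue⟩ := hitHeight_spec hc hf h01 z.2.2 hz
  set u := hitHeight c α β m f z.2 z.1
  rw [Real.dist_eq, hg]
  simp only
  rw [← hu₀, le_div_iff₀ (by linarith)]
  have h1 := hf.abs_sub_le hc z.2.2 hz hum hu₀m
  have h2 := abs_add_le ((z.2 - c) * f (m u z.1) - (z.2 - c) * f (m u₀ z.1))
    ((z.2 - c) * f (m u₀ z.1) - (t₀ - c) * f (m u₀ y₀))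
  have h3 : ((z.2 : ℝ) - c) * f (m u z.1) - (z.2 - c) * f (m u₀ z.1) +
    ((z.2 - c) * f (m u₀ z.1) - (t₀ - c) * f (m u₀ y₀)) = u - u₀ := by linarith
  rw [h3] at h2
  nlinarith

/-- The vertical push onto the hypersurfaces `φ = c + (t - c) f`. -/
def push (c α β : ℝ) (W : Set X) (m : ℝ → X → X) (f : X → ℝ) (z : X × Icc α β) : X × Icc α β :=
  open Classical in
  if z.1 ∈ W then (m (hitHeight c α β m f z.2 z.1) z.1, z.2) else z

theorem push_snd (z : X × Icc α β) : (push c α β W m f z).2 = z.2 := by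
  unfold push; split_ifs <;> rfl

/-- The hypersurfaces `φ = c + (t - c) f` stay between the levels `α` and `β`. -/
theorem height_mem (hc : c ∈ Icc α β) (h01 : ∀ x, f x ∈ Icc (0 : ℝ) 1)
    {z : X × Icc α β} (hz : z ∈ movingLevel φ c α β f) : φ z.1 ∈ Icc α β := by
  rw [show φ z.1 = _ from hz]
  exact add_mul_mem_Icc hc z.2.2 (h01 _).1 (h01 _).2

theorem push_mem (hc : c ∈ Icc α β) (hm : IsVerticalMove φ (Icc α β) W m)
    (hf' : SlopeLE α β W m K f') (h01' : ∀ x, f' x ∈ Icc (0 : ℝ) 1) (hZ : Z ⊆ W)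
    (hff : ∀ x ∉ Z, f x = f' x) {z : X × Icc α β} (hz : z ∈ movingLevel φ c α β f) :
    push c α β W m f' z ∈ movingLevel φ c α β f' := by
  unfold push
  split_ifs with hW
  · obtain ⟨h1, h2⟩ := hitHeight_spec hc hf' h01' z.2.2 hW
    show φ _ = _
    rw [hm.level _ h1 _ hW]
    exact h2
  · show φ z.1 = _
    rw [← hff _ fun h => hW (hZ h)]
    exact hz

/-- The pushes onto the hypersurfaces of `f` and of `f'` are inverse to each other. -/
theorem push_push (hc : c ∈ Icc α β) (hm : IsVerticalMove φ (Icc α β) W m)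
    (hf : SlopeLE α β W m K f) (hf' : SlopeLE α β W m K f') (hK : K * (β - α) < 1)
    (h01 : ∀ x, f x ∈ Icc (0 : ℝ) 1) (h01' : ∀ x, f' x ∈ Icc (0 : ℝ) 1)
    {z : X × Icc α β} (hz : z ∈ movingLevel φ c α β f) :
    push c α β W m f (push c α β W m f' z) = z := by
  by_cases hW : z.1 ∈ W
  · obtain ⟨h1, h2⟩ := hitHeight_spec hc hf' h01' z.2.2 hW
    have hφ := height_mem hc h01 hz
    have e1 : push c α β W m f' z = (m (hitHeight c α β m f' z.2 z.1) z.1, z.2) := by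
      simp [push, hW]
    have e2 : hitHeight c α β m f z.2 (m (hitHeight c α β m f' z.2 z.1) z.1) = φ z.1 := by
      refine hitHeight_eq hc hf hK h01 z.2.2 (hm.mem _ h1 _ hW) hφ ?_
      rw [hm.comp _ hφ _ h1 _ hW, hm.self _ hW]
      exact hz
    rw [e1, push, if_pos (hm.mem _ h1 _ hW)]
    simp only [e2]
    rw [hm.comp _ hφ _ h1 _ hW, hm.self _ hW]
  · simp [push, hW]

/-- The push is continuous: near the points outside `Z`, where `f` and `f'` agree, it is the identity. -/
theorem continuousOn_push (hc : c ∈ Icc α β) (hm : IsVerticalMove φ (Icc α β) W m)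
    (hf' : SlopeLE α β W m K f') (hK : K * (β - α) < 1)
    (h01 : ∀ x, f x ∈ Icc (0 : ℝ) 1) (h01' : ∀ x, f' x ∈ Icc (0 : ℝ) 1) (hfc' : Continuous f')
    (hZc : IsClosed Z) (hZ : Z ⊆ W) (hff : ∀ x ∉ Z, f x = f' x) :
    ContinuousOn (push c α β W m f') (movingLevel φ c α β f) := by
  intro z hz
  by_cases hW : z.1 ∈ W
  · have hO : {z : X × Icc α β | z.1 ∈ W} ∈ 𝓝 z :=
      (hm.isOpen.preimage continuous_fst).mem_nhds hW
    have h1 : ContinuousOn (fun z : X × Icc α β => (m (hitHeight c α β m f' z.2 z.1) z.1, z.2))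
        {z | z.1 ∈ W} := by
      refine ContinuousOn.prodMk ?_ continuousOn_snd
      exact hm.cont.comp ((continuousOn_hitHeight hc hm hf' hK h01' hfc').prodMk continuousOn_fst)
        fun z hz => ⟨(hitHeight_spec hc hf' h01' z.2.2 hz).1, hz⟩
    refine ((h1.continuousAt hO).congr ?_).continuousWithinAt
    filter_upwards [hO] with z hz
    exact (if_pos hz).symm
  · have hO : {z : X × Icc α β | z.1 ∈ Zᶜ} ∈ 𝓝 z :=
      (hZc.isOpen_compl.preimage continuous_fst).mem_nhds fun h => hW (hZ h)
    have key : ∀ z ∈ movingLevel φ c α β f, z.1 ∈ Zᶜ → push c α β W m f' z = z := by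
      intro z hz hzZ
      by_cases hzW : z.1 ∈ W
      · have e : hitHeight c α β m f' z.2 z.1 = φ z.1 := by
          refine hitHeight_eq hc hf' hK h01' z.2.2 hzW (height_mem hc h01 hz) ?_
          rw [hm.self _ hzW, ← hff _ hzZ]
          exact hz
        rw [push, if_pos hzW, e, hm.self _ hzW]
      · exact if_neg hzW
    refine (continuousWithinAt_id (s := movingLevel φ c α β f)).congr_of_eventuallyEq ?_
      (key z hz fun h => hW (hZ h))
    filter_upwards [self_mem_nhdsWithin, mem_nhdsWithin_of_mem_nhds hO] with z h1 h2
    exact key z h1 h2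

/-- Changing `f` inside one box does not change the space of moving levels. -/
theorem exists_homeomorph_movingLevel (hc : c ∈ Icc α β) (hm : IsVerticalMove φ (Icc α β) W m)
    (hf : SlopeLE α β W m K f) (hf' : SlopeLE α β W m K f') (hK : K * (β - α) < 1)
    (h01 : ∀ x, f x ∈ Icc (0 : ℝ) 1) (h01' : ∀ x, f' x ∈ Icc (0 : ℝ) 1)
    (hfc : Continuous f) (hfc' : Continuous f')
    (hZc : IsClosed Z) (hZ : Z ⊆ W) (hff : ∀ x ∉ Z, f x = f' x) :
    ∃ h : movingLevel φ c α β f ≃ₜ movingLevel φ c α β f', ∀ z, (h z).1.2 = z.1.2 :=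
  ⟨{ toFun := fun z => ⟨push c α β W m f' z, push_mem hc hm hf' h01' hZ hff z.2⟩
     invFun := fun z => ⟨push c α β W m f z,
       push_mem hc hm hf h01 hZ (fun x hx => (hff x hx).symm) z.2⟩
     left_inv := fun z => Subtype.ext (push_push hc hm hf hf' hK h01 h01' z.2)
     right_inv := fun z => Subtype.ext (push_push hc hm hf' hf hK h01' h01 z.2)
     continuous_toFun := (continuousOn_iff_continuous_domRestrict.1
       (continuousOn_push hc hm hf' hK h01 h01' hfc' hZc hZ hff)).subtype_mk _
     continuous_invFun := (continuousOn_iff_continuous_domRestrict.1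
       (continuousOn_push hc hm hf hK h01' h01 hfc hZc hZ
         fun x hx => (hff x hx).symm)).subtype_mk _ },
   fun _ => push_snd _⟩

/-- If finitely many bump functions, each supported in a box and of small slope along the vertical
lines of every box, take the value `1` everywhere, then `φ` is a product projection. -/
theorem exists_homeomorph_level_prod {ι : Type*} [Finite ι] (hc : c ∈ Icc α β) (hφ : Continuous φ)
    (hφm : ∀ x, φ x ∈ Icc α β) (hK0 : 0 ≤ K) (hK : K * (β - α) < 1)
    (W : ι → Set X) (m : ι → ℝ → X → X) (hm : ∀ i, IsVerticalMove φ (Icc α β) (W i) (m i))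
    (b : ι → X → ℝ) (hb : ∀ i, Continuous (b i)) (hb01 : ∀ i x, b i x ∈ Icc (0 : ℝ) 1)
    (hbW : ∀ i, ∃ Z, IsClosed Z ∧ Z ⊆ W i ∧ ∀ x ∉ Z, b i x = 0)
    (hbK : ∀ i j, SlopeLE α β (W j) (m j) K (b i)) (hb1 : ∀ x, ∃ i, b i x = 1) :
    ∃ h : X ≃ₜ {x // φ x = c} × Icc α β, ∀ x, ((h x).2 : ℝ) = φ x := by
  have step : ∀ s : Finset ι, ∃ f : X → ℝ, Continuous f ∧ (∀ x, f x ∈ Icc (0 : ℝ) 1) ∧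
      (∀ i ∈ s, ∀ x, b i x ≤ f x) ∧ (∀ j, SlopeLE α β (W j) (m j) K f) ∧
      ∃ h : movingLevel φ c α β (fun _ => 0) ≃ₜ movingLevel φ c α β f,
        ∀ z, (h z).1.2 = z.1.2 := by
    classical
    intro s
    induction s using Finset.induction_on with
    | empty =>
      refine ⟨fun _ => 0, continuous_const, fun _ => by simp, by simp, ?_, .refl _, fun _ => rfl⟩
      intro j y _ u _ v _
      simpa using mul_nonneg hK0 (abs_nonneg _)
    | insert i s _ ih =>
      obtain ⟨f, hfc, hf01, hfb, hfK, h, hh⟩ := ih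
      obtain ⟨Z, hZc, hZ, hbZ⟩ := hbW i
      have hfc' : Continuous fun x => max (f x) (b i x) := hfc.max (hb i)
      have h01' : ∀ x, max (f x) (b i x) ∈ Icc (0 : ℝ) 1 := fun x =>
        ⟨(hf01 x).1.trans (le_max_left _ _), max_le (hf01 x).2 (hb01 i x).2⟩
      have hK' : ∀ j, SlopeLE α β (W j) (m j) K fun x => max (f x) (b i x) := fun j =>
        (hfK j).max (hbK i j)
      obtain ⟨h', hh'⟩ := exists_homeomorph_movingLevel hc (hm i) (hfK i) (hK' i) hK hf01 h01'
        hfc hfc' hZc hZ fun x hx => by rw [hbZ x hx, max_eq_left (hf01 x).1]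
      refine ⟨_, hfc', h01', fun j hj x => ?_, hK', h.trans h', fun z => ?_⟩
      · rcases Finset.mem_insert.1 hj with rfl | hj
        · exact le_max_right _ _
        · exact (hfb j hj x).trans (le_max_left _ _)
      · rw [Homeomorph.trans_apply, hh', hh]
  cases nonempty_fintype ι
  obtain ⟨f, -, hf01, hfb, -, h, hh⟩ := step Finset.univ
  have hf1 : ∀ x, f x = 1 := fun x => by
    obtain ⟨i, hi⟩ := hb1 x
    exact le_antisymm (hf01 x).2 (hi ▸ hfb i (Finset.mem_univ i) x)
  let h0 : {x // φ x = c} × Icc α β ≃ₜ movingLevel φ c α β (fun _ => 0) :=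
    { toFun := fun z => ⟨(z.1, z.2), by simpa [movingLevel] using z.1.2⟩
      invFun := fun z => (⟨z.1.1, by simpa [movingLevel] using z.2⟩, z.1.2)
      left_inv := fun z => rfl
      right_inv := fun z => rfl
      continuous_toFun := by fun_prop
      continuous_invFun := by fun_prop }
  let h1 : X ≃ₜ movingLevel φ c α β f :=
    { toFun := fun x => ⟨(x, ⟨φ x, hφm x⟩), by simp [movingLevel, hf1]⟩
      invFun := fun z => z.1.1
      left_inv := fun z => rfl
      right_inv := fun z => by
        have : φ z.1.1 = z.1.2 := by
          rw [show φ z.1.1 = _ from z.2, hf1]; ring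
        exact Subtype.ext (Prod.ext rfl (Subtype.ext this))
      continuous_toFun := by fun_prop
      continuous_invFun := by fun_prop }
  refine ⟨h1.trans (h.symm.trans h0.symm), fun x => ?_⟩
  have := hh (h.symm (h1 x))
  rw [h.apply_symm_apply] at this
  show ((h.symm (h1 x)).1.2 : ℝ) = φ x
  rw [← this]
  rfl

end Push

/-! ### Charts with prescribed coordinates -/

section AdaptedCharts

variable {M : Type*} [TopologicalSpace M] [ChartedSpace E3 M]

/-- The inverse function theorem on a manifold: three `C¹` functions with independent differentials
are the coordinates of a chart. -/
theorem exists_chart_of_coords [IsManifold (𝓡 3) 1 M] {e₀ : OpenPartialHomeomorph M E3}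
    (he₀ : e₀ ∈ IsManifold.maximalAtlas (𝓡 3) 1 M) {x : M} (hx : x ∈ e₀.source)
    (f : Fin 3 → E3 → ℝ) (hf : ∀ i, ContDiffAt ℝ 1 (f i) (e₀ x))
    (hinj : ∀ v, (∀ i, fderiv ℝ (f i) (e₀ x) v = 0) → v = 0) :
    ∃ e ∈ IsManifold.maximalAtlas (𝓡 3) 1 M, x ∈ e.source ∧ e.source ⊆ e₀.source ∧
      ∀ x' ∈ e.source, ∀ i, e x' i = f i (e₀ x') := by
  set F : E3 → E3 := fun y => WithLp.toLp 2 fun i => f i y with hF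
  have hFc : ContDiffAt ℝ 1 F (e₀ x) := contDiffAt_euclidean.2 hf
  have hdF : ∀ v i, fderiv ℝ F (e₀ x) v i = fderiv ℝ (f i) (e₀ x) v := by
    intro v i
    have h1 := (hFc.differentiableAt one_ne_zero).hasFDerivAt
    have h2 := (EuclideanSpace.proj i : E3 →L[ℝ] ℝ).hasFDerivAt.comp _ h1
    rw [show f i = (EuclideanSpace.proj i : E3 →L[ℝ] ℝ) ∘ F from rfl, h2.fderiv]
    rfl
  have hker : LinearMap.ker (fderiv ℝ F (e₀ x)).toLinearMap = ⊥ := by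
    rw [LinearMap.ker_eq_bot']
    intro v hv
    refine hinj v fun i => ?_
    rw [← hdF]
    have : fderiv ℝ F (e₀ x) v = 0 := hv
    rw [this]; rfl
  let A : E3 ≃L[ℝ] E3 :=
    (LinearEquiv.ofInjectiveEndo _ (LinearMap.ker_eq_bot.1 hker)).toContinuousLinearEquiv
  have hA : (A : E3 →L[ℝ] E3) = fderiv ℝ F (e₀ x) := by ext v; rfl
  have hFd : HasFDerivAt F (A : E3 →L[ℝ] E3) (e₀ x) := by
    rw [hA]; exact (hFc.differentiableAt one_ne_zero).hasFDerivAt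
  -- a neighbourhood on which `F` is `C¹` with invertible differential
  have hev : ∀ᶠ y in 𝓝 (e₀ x), ContDiffAt ℝ 1 F y ∧
      fderiv ℝ F y ∈ range ((↑) : (E3 ≃L[ℝ] E3) → E3 →L[ℝ] E3) := by
    refine (hFc.eventually (by simp)).and ?_
    have hcont : ContinuousAt (fderiv ℝ F) (e₀ x) :=
      (hFc.fderiv_right (m := 0) (by simp)).continuousAt
    exact hcont.preimage_mem_nhds (hA ▸ ContinuousLinearEquiv.nhds A)
  obtain ⟨O, hO, hOo, hxO⟩ := eventually_nhds_iff.1 hev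
  set g := (hFc.toOpenPartialHomeomorph F hFd one_ne_zero).restrOpen O hOo with hg
  have hgs : g.source ⊆ O := by
    rw [hg, OpenPartialHomeomorph.restrOpen_source]; exact inter_subset_right
  have hgF : ∀ y, g y = F y := fun y => rfl
  have hg1 : ContDiffOn ℝ 1 g g.source := fun y hy => (hO y (hgs hy)).1.contDiffWithinAt
  have hg2 : ContDiffOn ℝ 1 g.symm g.target := by
    intro y hy
    have hy' := hgs (g.map_target hy)
    obtain ⟨h1, A', hA'⟩ := hO _ hy'
    refine (g.contDiffAt_symm hy (f₀' := A') ?_ h1).contDiffWithinAt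
    rw [hA']
    exact (h1.differentiableAt one_ne_zero).hasFDerivAt
  have hxg : e₀ x ∈ g.source := by
    rw [hg, OpenPartialHomeomorph.restrOpen_source]
    exact ⟨hFc.mem_toOpenPartialHomeomorph_source hFd one_ne_zero, hxO⟩
  refine ⟨e₀ ≫ₕ g, ?_, ?_, ?_, ?_⟩
  · refine OpenPartialHomeomorph.mem_maximalAtlas_of_contMDiffOn _ ?_ ?_
    · exact hg1.contMDiffOn.comp ((contMDiffOn_of_mem_maximalAtlas he₀).mono (by simp))
        (by intro y hy; simpa using hy.2)
    · exact (contMDiffOn_symm_of_mem_maximalAtlas he₀).comp (hg2.contMDiffOn.mono (by simp))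
        (by intro y hy; simpa using hy.2)
  · simpa using ⟨hx, hxg⟩
  · simp
  · intro x' _ i
    rfl

theorem restrOpen_mem_maximalAtlas {e : OpenPartialHomeomorph M E3}
    (he : e ∈ IsManifold.maximalAtlas (𝓡 3) 1 M) {O : Set M} (hO : IsOpen O) :
    e.restrOpen O hO ∈ IsManifold.maximalAtlas (𝓡 3) 1 M := by
  have h : e.restr O = e.restrOpen O hO := by simp [OpenPartialHomeomorph.restr, hO.interior_eq]
  rw [← h]
  exact restr_mem_maximalAtlas (contDiffGroupoid 1 (𝓡 3)) he hO

/-- A chart of `M` adapted to the height function `φ` and to a set `B` lying between the levels `a`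
and `b`: its first coordinate is `φ`, and `B` is given by `a ≤ y₀ ≤ b` and `0 ≤ y₁`. -/
structure IsAdaptedChart (φ : M → ℝ) (a b : ℝ) (B : Set M) (e : OpenPartialHomeomorph M E3) :
    Prop where
  mem_atlas : e ∈ IsManifold.maximalAtlas (𝓡 3) 1 M
  height : ∀ x ∈ e.source, e x 0 = φ x
  mem_iff : ∀ x ∈ e.source, x ∈ B ↔ a ≤ φ x ∧ φ x ≤ b ∧ 0 ≤ e x 1

/-- A closed set that is covered by adapted charts: a manifold with corners whose boundary consists
of an upper and a lower part, on which `φ` is constant, and of a vertical part. -/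
structure IsBlock (φ : M → ℝ) (a b : ℝ) (B : Set M) : Prop where
  lt : a < b
  isClosed : IsClosed B
  chart : ∀ x ∈ B, ∃ e, x ∈ e.source ∧ IsAdaptedChart φ a b B e

variable {φ : M → ℝ} {a b : ℝ} {B : Set M}

theorem IsBlock.mem_Icc (hB : IsBlock φ a b B) {x : M} (hx : x ∈ B) : φ x ∈ Icc a b := by
  obtain ⟨e, hxe, he⟩ := hB.chart x hx
  have := (he.mem_iff x hxe).1 hx
  exact ⟨this.1, this.2.1⟩

theorem IsAdaptedChart.restrOpen {e : OpenPartialHomeomorph M E3} (he : IsAdaptedChart φ a b B e)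
    (O : Set M) (hO : IsOpen O) : IsAdaptedChart φ a b B (e.restrOpen O hO) := by
  refine ⟨?_, fun x hx => he.height x ?_, fun x hx => he.mem_iff x ?_⟩
  · exact restrOpen_mem_maximalAtlas he.mem_atlas hO
  · exact (by simpa using hx : x ∈ e.source ∧ x ∈ O).1
  · exact (by simpa using hx : x ∈ e.source ∧ x ∈ O).1

/-- Three functions with independent differentials, the first of which is `φ` and the second of which
cuts out `B` in the slab, are the coordinates of an adapted chart. -/
theorem exists_adaptedChart_of_coords [IsManifold (𝓡 3) 1 M] {e₀ : OpenPartialHomeomorph M E3}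
    (he₀ : e₀ ∈ IsManifold.maximalAtlas (𝓡 3) 1 M) {x : M} (hx : x ∈ e₀.source)
    (f : Fin 3 → E3 → ℝ) (hf : ∀ i, ContDiffAt ℝ 1 (f i) (e₀ x))
    (hinj : ∀ v, (∀ i, fderiv ℝ (f i) (e₀ x) v = 0) → v = 0)
    (h0 : ∀ x' ∈ e₀.source, f 0 (e₀ x') = φ x')
    (hB : ∀ᶠ x' in 𝓝 x, (x' ∈ B ↔ a ≤ φ x' ∧ φ x' ≤ b ∧ 0 ≤ f 1 (e₀ x'))) :
    ∃ e, x ∈ e.source ∧ e.source ⊆ e₀.source ∧ IsAdaptedChart φ a b B e := by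
  obtain ⟨e, he, hxe, hee, hef⟩ := exists_chart_of_coords he₀ hx f hf hinj
  obtain ⟨O, hO, hOo, hxO⟩ := eventually_nhds_iff.1 hB
  refine ⟨e.restrOpen O hOo, ⟨hxe, hxO⟩, inter_subset_left.trans hee, ?_, ?_, ?_⟩
  · exact restrOpen_mem_maximalAtlas he hOo
  · rintro x' ⟨hx', -⟩
    rw [← h0 x' (hee hx'), ← hef x' hx' 0]; rfl
  · rintro x' ⟨hx', hx'O⟩
    rw [hO x' hx'O, ← hef x' hx' 1]; rfl

/-- Near a regular point of `φ` at which `B` is cut out by the inequalities `a ≤ φ ≤ b` alone, an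
adapted chart exists. -/
theorem exists_adaptedChart_of_regular [IsManifold (𝓡 3) 1 M] {e₀ : OpenPartialHomeomorph M E3}
    (he₀ : e₀ ∈ IsManifold.maximalAtlas (𝓡 3) 1 M) {x : M} (hx : x ∈ e₀.source)
    (hf : ContDiffAt ℝ 1 (φ ∘ e₀.symm) (e₀ x)) (hd : fderiv ℝ (φ ∘ e₀.symm) (e₀ x) ≠ 0)
    (hB : ∀ᶠ x' in 𝓝 x, (x' ∈ B ↔ a ≤ φ x' ∧ φ x' ≤ b)) :
    ∃ e, x ∈ e.source ∧ e.source ⊆ e₀.source ∧ IsAdaptedChart φ a b B e := by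
  obtain ⟨i, hi⟩ : ∃ i : Fin 3,
      fderiv ℝ (φ ∘ e₀.symm) (e₀ x) (EuclideanSpace.single i 1) ≠ 0 := by
    by_contra! h
    refine hd (ContinuousLinearMap.coe_injective ?_)
    refine (EuclideanSpace.basisFun (Fin 3) ℝ).toBasis.ext fun i => ?_
    simpa using h i
  -- the other two coordinates, the first one normalised to take the value `1` at the point
  obtain ⟨j, k, hjk⟩ : ∃ j k : Fin 3, ∀ l, l = i ∨ l = j ∨ l = k := by
    have key : ∀ i : Fin 3, ∃ j k : Fin 3, ∀ l, l = i ∨ l = j ∨ l = k := by decide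
    exact key i
  have hp : ∀ (l : Fin 3) (r : ℝ) (y : E3), HasFDerivAt (fun y : E3 => y l + r)
      (EuclideanSpace.proj l : E3 →L[ℝ] ℝ) y := fun l r y =>
    ((EuclideanSpace.proj l : E3 →L[ℝ] ℝ).hasFDerivAt).add_const r
  refine exists_adaptedChart_of_coords he₀ hx
    ![φ ∘ e₀.symm, fun y => y j + (1 - e₀ x j), fun y => y k + 0] ?_ ?_ ?_ ?_
  · intro l
    fin_cases l
    · exact hf
    · exact ((EuclideanSpace.proj j : E3 →L[ℝ] ℝ).contDiff.add contDiff_const).contDiffAt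
    · exact ((EuclideanSpace.proj k : E3 →L[ℝ] ℝ).contDiff.add contDiff_const).contDiffAt
  · intro v hv
    have h0 := hv 0
    have h1 := hv 1
    have h2 := hv 2
    simp only [Matrix.cons_val_zero, Matrix.cons_val_one, Matrix.cons_val] at h0 h1 h2
    rw [(hp j _ _).fderiv] at h1
    rw [(hp k _ _).fderiv] at h2
    have hv' : v = v i • EuclideanSpace.single i 1 := by
      ext l
      rcases eq_or_ne l i with rfl | hl
      · simp
      · rcases hjk l with h | rfl | rfl
        · exact absurd h hl
        · simpa [hl] using h1
        · simpa [hl] using h2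
    rw [hv', map_smul, smul_eq_mul, mul_eq_zero] at h0
    rw [hv', h0.resolve_right hi, zero_smul]
  · intro x' hx'
    simp [e₀.left_inv hx']
  · have hc : ContinuousAt (fun x' => e₀ x' j + (1 - e₀ x j)) x :=
      ((EuclideanSpace.proj j : E3 →L[ℝ] ℝ).continuous.continuousAt.comp
        (e₀.continuousAt hx)).add continuousAt_const
    have hpos := hc.eventually (lt_mem_nhds (show (0 : ℝ) < _ by simp))
    filter_upwards [hB, hpos] with x' h1 h2
    rw [h1]
    simp only [Matrix.cons_val_one, Matrix.cons_val_zero]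
    exact ⟨fun h => ⟨h.1, h.2, h2.le⟩, fun h => ⟨h.1, h.2.1⟩⟩

end AdaptedCharts

/-! ### Thin slabs are products -/

section Thin

set_option linter.unusedSectionVars false

variable {M : Type*} [TopologicalSpace M] [ChartedSpace E3 M]

/-- The closed coordinate cube with centre `q` and half side `ρ`. -/
def cube (q : E3) (ρ : ℝ) : Set E3 := {y | ∀ i, |y i - q i| ≤ ρ}

/-- The point with first coordinate `u` and the other coordinates of `y`. -/
def setHeight (u : ℝ) (y : E3) : E3 := !₂[u, y 1, y 2]

@[simp] theorem setHeight_zero (u : ℝ) (y : E3) : setHeight u y 0 = u := rfl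
@[simp] theorem setHeight_one (u : ℝ) (y : E3) : setHeight u y 1 = y 1 := rfl
@[simp] theorem setHeight_two (u : ℝ) (y : E3) : setHeight u y 2 = y 2 := rfl

theorem continuous_setHeight : Continuous fun z : ℝ × E3 => setHeight z.1 z.2 := by
  refine (PiLp.continuous_toLp 2 _).comp (continuous_pi fun i => ?_)
  fin_cases i
  · exact continuous_fst
  · exact ((EuclideanSpace.proj 1 : E3 →L[ℝ] ℝ).continuous.comp continuous_snd)
  · exact ((EuclideanSpace.proj 2 : E3 →L[ℝ] ℝ).continuous.comp continuous_snd)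

theorem setHeight_self (y : E3) : setHeight (y 0) y = y := by
  ext i; fin_cases i <;> rfl

theorem norm_setHeight_sub (u v : ℝ) (y : E3) : ‖setHeight u y - setHeight v y‖ = |u - v| := by
  rw [EuclideanSpace.norm_eq, Fin.sum_univ_three]
  simp [Real.sqrt_sq_eq_abs]

theorem cube_eq (q : E3) (ρ : ℝ) : cube q ρ = ⋂ i, (EuclideanSpace.proj i : E3 →L[ℝ] ℝ) ⁻¹'
    Metric.closedBall (q i) ρ := by
  ext y; simp [cube, Real.dist_eq]

theorem isCompact_cube (q : E3) {ρ : ℝ} : IsCompact (cube q ρ) := by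
  have h : cube q ρ = (EuclideanSpace.equiv (Fin 3) ℝ).toHomeomorph ⁻¹'
      (univ.pi fun i => Metric.closedBall (q i) ρ) := by
    ext y; simp [cube, Real.dist_eq]
  rw [h]
  exact (Homeomorph.isCompact_preimage _).2 (isCompact_univ_pi fun i => isCompact_closedBall _ _)

theorem convex_cube (q : E3) (ρ : ℝ) : Convex ℝ (cube q ρ) := by
  rw [cube_eq]
  exact convex_iInter fun i => (convex_closedBall _ _).linear_preimage
    (EuclideanSpace.proj i : E3 →L[ℝ] ℝ).toLinearMap

theorem exists_cube_subset {O : Set E3} (hO : IsOpen O) {q : E3} (hq : q ∈ O) :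
    ∃ ρ > 0, cube q ρ ⊆ O := by
  have h1 : (fun y : Fin 3 → ℝ => (WithLp.toLp 2 y : E3)) ⁻¹' O ∈ 𝓝 (fun i => q i) :=
    (hO.preimage (PiLp.continuous_toLp 2 _)).mem_nhds hq
  obtain ⟨ρ, hρ, h⟩ := Metric.nhds_basis_closedBall.mem_iff.1 h1
  refine ⟨ρ, hρ, fun y hy => ?_⟩
  have : (fun i => y i) ∈ Metric.closedBall (fun i => q i) ρ := by
    rw [Metric.mem_closedBall, dist_pi_le_iff hρ.le]
    intro i
    rw [Real.dist_eq]; exact hy i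
  exact h this

theorem closedBall_subset_cube (q : E3) {r ρ : ℝ} (h : r ≤ ρ) : Metric.closedBall q r ⊆ cube q ρ := by
  intro y hy i
  rw [mem_closedBall_iff_norm] at hy
  have := PiLp.norm_apply_le (y - q) i
  rw [Real.norm_eq_abs, PiLp.sub_apply] at this
  linarith

/-- A `C¹` bump function supported in a coordinate cube. -/
theorem exists_bump [T2Space M] {e : OpenPartialHomeomorph M E3}
    (he : e ∈ IsManifold.maximalAtlas (𝓡 3) 1 M) {x : M} (hx : x ∈ e.source) {ρ : ℝ} (hρ : 0 < ρ)
    (hcube : cube (e x) ρ ⊆ e.target) :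
    ∃ b : M → ℝ, ContMDiff (𝓡 3) 𝓘(ℝ) 1 b ∧ (∀ y, b y ∈ Icc (0 : ℝ) 1) ∧ (∀ᶠ y in 𝓝 x, b y = 1) ∧
      ∃ Z, IsClosed Z ∧ (∀ y ∈ Z, y ∈ e.source ∧ ∀ i, |e y i - e x i| < ρ) ∧
        ∀ y ∉ Z, b y = 0 := by
  classical
  let χ : ContDiffBump (e x) := ⟨ρ / 4, ρ / 2, by positivity, by linarith⟩
  set Z : Set M := e.symm '' Metric.closedBall (e x) (ρ / 2) with hZ
  have hball : Metric.closedBall (e x) (ρ / 2) ⊆ e.target :=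
    (closedBall_subset_cube _ (by linarith)).trans hcube
  have hZc : IsClosed Z :=
    ((isCompact_closedBall _ _).image_of_continuousOn (e.continuousOn_symm.mono hball)).isClosed
  have hZmem : ∀ y ∈ Z, y ∈ e.source ∧ e y ∈ Metric.closedBall (e x) (ρ / 2) := by
    rintro _ ⟨z, hz, rfl⟩
    exact ⟨e.map_target (hball hz), by rwa [e.right_inv (hball hz)]⟩
  set b : M → ℝ := fun y => if y ∈ e.source then χ (e y) else 0 with hb
  have hb0 : ∀ y ∉ Z, b y = 0 := by
    intro y hy
    by_cases hys : y ∈ e.source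
    · simp only [hb, if_pos hys]
      refine χ.zero_of_le_dist ?_
      by_contra! h
      exact hy ⟨e y, Metric.mem_closedBall.2 h.le, e.left_inv hys⟩
    · simp [hb, hys]
  have hbs : ∀ y ∈ e.source, b =ᶠ[𝓝 y] χ ∘ e := fun y hy => by
    filter_upwards [e.open_source.mem_nhds hy] with z hz
    simp [hb, hz]
  refine ⟨b, fun y => ?_, fun y => ?_, ?_, Z, hZc, fun y hy => ⟨(hZmem y hy).1, fun i => ?_⟩, hb0⟩
  · by_cases hys : y ∈ e.source
    · exact (χ.contDiff.contMDiff.contMDiffAt.comp y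
        (contMDiffAt_of_mem_maximalAtlas he hys)).congr_of_eventuallyEq (hbs y hys)
    · have : b =ᶠ[𝓝 y] fun _ => 0 := by
        filter_upwards [hZc.isOpen_compl.mem_nhds fun h => hys (hZmem y h).1] with z hz
        exact hb0 z hz
      exact contMDiffAt_const.congr_of_eventuallyEq this
  · by_cases hys : y ∈ e.source
    · simp only [hb, if_pos hys]; exact ⟨χ.nonneg, χ.le_one⟩
    · simp [hb, hys]
  · refine (hbs x hx).trans ?_
    exact (e.continuousAt hx).eventually χ.eventuallyEq_one
  · have := closedBall_subset_cube (e x) le_rfl (hZmem y hy).2 i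
    linarith

/-- A `C¹` function is Lipschitz along the vertical lines of a coordinate cube. -/
theorem exists_slope {e : OpenPartialHomeomorph M E3}
    (he : e ∈ IsManifold.maximalAtlas (𝓡 3) 1 M) {q : E3} {ρ : ℝ}
    (hcube : cube q ρ ⊆ e.target) {b : M → ℝ} (hb : ContMDiff (𝓡 3) 𝓘(ℝ) 1 b) :
    ∃ K : ℝ, ∀ y : E3, ∀ u v : ℝ, setHeight u y ∈ cube q ρ → setHeight v y ∈ cube q ρ →
      |b (e.symm (setHeight u y)) - b (e.symm (setHeight v y))| ≤ K * |u - v| := by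
  have h1 : ContDiffOn ℝ 1 (b ∘ e.symm) (cube q ρ) :=
    (contMDiffOn_iff_contDiffOn.1
      (hb.comp_contMDiffOn (contMDiffOn_symm_of_mem_maximalAtlas he))).mono hcube
  obtain ⟨K, hK⟩ := h1.exists_lipschitzOnWith one_ne_zero (convex_cube q ρ) (isCompact_cube q)
  refine ⟨K, fun y u v hu hv => ?_⟩
  have := hK.dist_le_mul _ hu _ hv
  rwa [Real.dist_eq, dist_eq_norm, norm_setHeight_sub] at this

variable {φ : M → ℝ} {a b α β ρ : ℝ} {B : Set M} {e : OpenPartialHomeomorph M E3} {q : E3}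

/-- The part of the set `B` between the levels `s` and `s'`. -/
def slab (φ : M → ℝ) (B : Set M) (s s' : ℝ) : Set M := {x | x ∈ B ∧ φ x ∈ Icc s s'}

/-- The part of a slab in a coordinate cube of the chart `e`. -/
def slabBox (φ : M → ℝ) (B : Set M) (α β : ℝ) (e : OpenPartialHomeomorph M E3) (q : E3) (ρ : ℝ) :
    Set (slab φ B α β) :=
  {y | y.1 ∈ e.source ∧ |e y.1 1 - q 1| < ρ ∧ |e y.1 2 - q 2| < ρ}

/-- The vertical move in a coordinate cube; the identity where it would leave the slab. -/
def slabMove (φ : M → ℝ) (B : Set M) (α β : ℝ) (e : OpenPartialHomeomorph M E3) (u : ℝ)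
    (y : slab φ B α β) : slab φ B α β :=
  open Classical in
  if h : e.symm (setHeight u (e y)) ∈ slab φ B α β then ⟨_, h⟩ else y

theorem setHeight_mem_cube (hαβ : Icc α β ⊆ Icc (q 0 - ρ) (q 0 + ρ)) {u : ℝ} (hu : u ∈ Icc α β)
    {y : slab φ B α β} (hy : y ∈ slabBox φ B α β e q ρ) : setHeight u (e y) ∈ cube q ρ := by
  intro i
  fin_cases i
  · have := hαβ hu
    show |u - q 0| ≤ ρ
    rw [abs_le]; constructor <;> linarith [this.1, this.2]
  · exact hy.2.1.le
  · exact hy.2.2.le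

theorem slabMove_mem (he : IsAdaptedChart φ a b B e) (hcube : cube q ρ ⊆ e.target)
    (hαβ : Icc α β ⊆ Icc (q 0 - ρ) (q 0 + ρ)) (hab : Icc α β ⊆ Icc a b) {u : ℝ}
    (hu : u ∈ Icc α β) {y : slab φ B α β} (hy : y ∈ slabBox φ B α β e q ρ) :
    e.symm (setHeight u (e y)) ∈ slab φ B α β ∧ φ (e.symm (setHeight u (e y))) = u := by
  have ht := hcube (setHeight_mem_cube hαβ hu hy)
  have hs := e.map_target ht
  have hφ : φ (e.symm (setHeight u (e y))) = u := by
    rw [← he.height _ hs, e.right_inv ht, setHeight_zero]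
  refine ⟨⟨(he.mem_iff _ hs).2 ?_, by rwa [hφ]⟩, hφ⟩
  rw [hφ, e.right_inv ht, setHeight_one]
  exact ⟨(hab hu).1, (hab hu).2, ((he.mem_iff _ hy.1).1 y.2.1).2.2⟩

theorem coe_slabMove (he : IsAdaptedChart φ a b B e) (hcube : cube q ρ ⊆ e.target)
    (hαβ : Icc α β ⊆ Icc (q 0 - ρ) (q 0 + ρ)) (hab : Icc α β ⊆ Icc a b) {u : ℝ}
    (hu : u ∈ Icc α β) {y : slab φ B α β} (hy : y ∈ slabBox φ B α β e q ρ) :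
    (slabMove φ B α β e u y : M) = e.symm (setHeight u (e y)) := by
  rw [slabMove, dif_pos (slabMove_mem he hcube hαβ hab hu hy).1]

theorem isVerticalMove_slabMove (he : IsAdaptedChart φ a b B e) (hcube : cube q ρ ⊆ e.target)
    (hαβ : Icc α β ⊆ Icc (q 0 - ρ) (q 0 + ρ)) (hab : Icc α β ⊆ Icc a b) :
    IsVerticalMove (fun y : slab φ B α β => φ y) (Icc α β) (slabBox φ B α β e q ρ)
      (slabMove φ B α β e) := by
  have hcoe : ∀ u ∈ Icc α β, ∀ y ∈ slabBox φ B α β e q ρ,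
      (slabMove φ B α β e u y : M) = e.symm (setHeight u (e y)) ∧
      e (slabMove φ B α β e u y : M) = setHeight u (e y) := fun u hu y hy => by
    have h := coe_slabMove he hcube hαβ hab hu hy
    exact ⟨h, by rw [h, e.right_inv (hcube (setHeight_mem_cube hαβ hu hy))]⟩
  have hmem : ∀ u ∈ Icc α β, ∀ y ∈ slabBox φ B α β e q ρ,
      slabMove φ B α β e u y ∈ slabBox φ B α β e q ρ := fun u hu y hy => by
    refine ⟨?_, ?_, ?_⟩
    · rw [(hcoe u hu y hy).1]; exact e.map_target (hcube (setHeight_mem_cube hαβ hu hy))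
    · rw [(hcoe u hu y hy).2]; exact hy.2.1
    · rw [(hcoe u hu y hy).2]; exact hy.2.2
  refine ⟨?_, hmem, fun u hu y hy => ?_, fun y hy => ?_, fun u hu v hv y hy => ?_, ?_⟩
  · have : IsOpen (e.source ∩ e ⁻¹' {z : E3 | |z 1 - q 1| < ρ ∧ |z 2 - q 2| < ρ}) := by
      refine e.isOpen_inter_preimage ?_
      have hp : ∀ i : Fin 3, Continuous fun z : E3 => z i := fun i =>
        (EuclideanSpace.proj i : E3 →L[ℝ] ℝ).continuous
      exact (isOpen_lt ((hp 1).sub continuous_const).abs continuous_const).inter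
        (isOpen_lt ((hp 2).sub continuous_const).abs continuous_const)
    exact this.preimage continuous_subtype_val
  · simp only [coe_slabMove he hcube hαβ hab hu hy]
    exact (slabMove_mem he hcube hαβ hab hu hy).2
  · refine Subtype.ext ?_
    rw [(hcoe _ y.2.2 y hy).1, ← he.height _ hy.1, setHeight_self, e.left_inv hy.1]
  · refine Subtype.ext ?_
    rw [(hcoe u hu _ (hmem v hv y hy)).1, (hcoe v hv y hy).2, (hcoe u hu y hy).1]
    rfl
  · rw [continuousOn_iff_continuous_domRestrict, continuous_induced_rng]
    have : ContinuousOn (fun z : ℝ × slab φ B α β => e.symm (setHeight z.1 (e z.2)))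
        (Icc α β ×ˢ slabBox φ B α β e q ρ) := by
      refine e.continuousOn_symm.comp (continuous_setHeight.comp_continuousOn
        (continuousOn_fst.prodMk (e.continuousOn.comp
          (continuous_subtype_val.comp continuous_snd).continuousOn fun z hz => hz.2.1)))
        fun z hz => hcube (setHeight_mem_cube hαβ hz.1 hz.2)
    refine (continuousOn_iff_continuous_domRestrict.1 this).congr fun z => ?_
    exact (hcoe _ z.2.1 _ z.2.2).1.symm

/-- Near each level of a block, the block is the product of the level set with an interval. -/
theorem IsBlock.exists_homeomorph_near_level [T2Space M] [CompactSpace M] (hφ : Continuous φ)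
    (hB : IsBlock φ a b B) {t : ℝ} (ht : t ∈ Icc a b) :
    ∃ ε > 0, ∃ h : slab φ B (max a (t - ε)) (min b (t + ε)) ≃ₜ
      {y : slab φ B (max a (t - ε)) (min b (t + ε)) // φ y = t} ×
        Icc (max a (t - ε)) (min b (t + ε)), ∀ x, ((h x).2 : ℝ) = φ x := by
  have hdata : ∀ x : {x | x ∈ B ∧ φ x = t}, ∃ (e : OpenPartialHomeomorph M E3) (ρ : ℝ)
      (f : M → ℝ) (Z : Set M), IsAdaptedChart φ a b B e ∧ 0 < ρ ∧ cube (e x) ρ ⊆ e.target ∧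
      e x.1 0 = t ∧
      ContMDiff (𝓡 3) 𝓘(ℝ) 1 f ∧ (∀ y, f y ∈ Icc (0 : ℝ) 1) ∧ (∀ᶠ y in 𝓝 x.1, f y = 1) ∧
      IsClosed Z ∧ (∀ y ∈ Z, y ∈ e.source ∧ ∀ i, |e y i - e x i| < ρ) ∧ ∀ y ∉ Z, f y = 0 := by
    rintro ⟨x, hx, hxt⟩
    obtain ⟨e, hxe, he⟩ := hB.chart x hx
    obtain ⟨ρ, hρ, hc⟩ := exists_cube_subset e.open_target (e.map_source hxe)
    obtain ⟨f, h1, h2, h3, Z, h4, h5, h6⟩ := exists_bump he.mem_atlas hxe hρ hc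
    exact ⟨e, ρ, f, Z, he, hρ, hc, by rw [he.height x hxe, hxt], h1, h2, h3, h4, h5, h6⟩
  choose e ρ f Z he hρ hcube he0 hf hf01 hf1 hZ hZs hf0 using hdata
  have hlev : IsCompact {x | x ∈ B ∧ φ x = t} :=
    (hB.isClosed.inter (isClosed_singleton.preimage hφ)).isCompact
  -- finitely many bump functions are enough near the level `t`
  obtain ⟨T, hT⟩ := hlev.elim_nhds_subcover' (fun x hx => interior {y | f ⟨x, hx⟩ y = 1})
    (fun x hx => interior_mem_nhds.2 (hf1 ⟨x, hx⟩))
  set O : Set M := ⋃ x ∈ T, interior {y | f x y = 1} with hO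
  have hOo : IsOpen O := isOpen_biUnion fun _ _ => isOpen_interior
  have hnear : ∃ η > 0, ∀ x ∈ B, |φ x - t| < η → x ∈ O := by
    have hc : IsClosed (φ '' (B \ O)) :=
      (((hB.isClosed.sdiff hOo).isCompact).image hφ).isClosed
    have : (φ '' (B \ O))ᶜ ∈ 𝓝 t := hc.isOpen_compl.mem_nhds (by
      rintro ⟨x, ⟨hx, hxO⟩, hxt⟩
      exact hxO (hT ⟨hx, hxt⟩))
    obtain ⟨η, hη, h⟩ := Metric.mem_nhds_iff.1 this
    refine ⟨η, hη, fun x hx hxt => ?_⟩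
    by_contra hxO
    exact h (by rwa [Metric.mem_ball, Real.dist_eq]) ⟨x, ⟨hx, hxO⟩, rfl⟩
  obtain ⟨η, hη, hηO⟩ := hnear
  have hKex : ∀ p : T × T, ∃ K : ℝ, ∀ y : E3, ∀ u v : ℝ,
      setHeight u y ∈ cube (e p.2.1 p.2.1) (ρ p.2.1) →
      setHeight v y ∈ cube (e p.2.1 p.2.1) (ρ p.2.1) →
      |f p.1 ((e p.2.1).symm (setHeight u y)) - f p.1 ((e p.2.1).symm (setHeight v y))| ≤
        K * |u - v| := fun p => exists_slope (he p.2.1).mem_atlas (hcube p.2.1) (hf p.1)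
  choose K' hK' using hKex
  obtain ⟨K₁, hK₁⟩ := (Set.finite_range K').bddAbove
  set K := max K₁ 0 with hK
  have hε : ∀ᶠ ε in 𝓝[>] (0 : ℝ), (∀ i : T, ε ≤ ρ i.1) ∧ ε < η ∧ K * (2 * ε) < 1 := by
    refine (Filter.eventually_all.2 fun i => ?_).and (Filter.Eventually.and ?_ ?_)
    · exact nhdsWithin_le_nhds (Iic_mem_nhds (hρ i.1))
    · exact nhdsWithin_le_nhds (Iio_mem_nhds hη)
    · have : ContinuousAt (fun ε : ℝ => K * (2 * ε)) 0 := by fun_prop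
      exact nhdsWithin_le_nhds (this.eventually (gt_mem_nhds (by norm_num)))
  obtain ⟨ε, ⟨hερ, hεη, hεK⟩, hε0 : 0 < ε⟩ := (hε.and self_mem_nhdsWithin).exists
  refine ⟨ε, hε0, ?_⟩
  set α := max a (t - ε) with hα
  set β := min b (t + ε) with hβ
  have hαt : t - ε ≤ α := le_max_right _ _
  have hβt : β ≤ t + ε := min_le_right _ _
  have hab : Icc α β ⊆ Icc a b := Icc_subset_Icc (le_max_left _ _) (min_le_left _ _)
  have hcI : t ∈ Icc α β :=
    ⟨max_le ht.1 (by linarith), le_min ht.2 (by linarith)⟩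
  have hI : ∀ i : T, Icc α β ⊆ Icc (e i.1 i.1 0 - ρ i.1) (e i.1 i.1 0 + ρ i.1) := fun i => by
    rw [he0]
    exact Icc_subset_Icc (by linarith [hερ i]) (by linarith [hερ i])
  refine exists_homeomorph_level_prod (φ := fun y : slab φ B α β => φ y) (ι := T) (K := K) hcI
    (hφ.comp continuous_subtype_val) (fun x => x.2.2) (le_max_right _ _) ?_
    (fun i => slabBox φ B α β (e i.1) (e i.1 i.1) (ρ i.1)) (fun i => slabMove φ B α β (e i.1))
    (fun i => isVerticalMove_slabMove (he i.1) (hcube i.1) (hI i) hab)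
    (fun i y => f i.1 y) (fun i => (hf i.1).continuous.comp continuous_subtype_val)
    (fun i y => hf01 i.1 y) (fun i => ?_) (fun i j y hy u hu v hv => ?_) (fun x => ?_)
  · refine lt_of_le_of_lt (mul_le_mul_of_nonneg_left ?_ (le_max_right _ _)) hεK
    linarith
  · exact ⟨Subtype.val ⁻¹' Z i.1, (hZ i.1).preimage continuous_subtype_val,
      fun y hy => ⟨(hZs i.1 y hy).1, (hZs i.1 y hy).2 1, (hZs i.1 y hy).2 2⟩,
      fun y hy => hf0 i.1 y hy⟩
  · simp only
    rw [coe_slabMove (he j.1) (hcube j.1) (hI j) hab hu hy,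
      coe_slabMove (he j.1) (hcube j.1) (hI j) hab hv hy]
    refine (hK' (i, j) (e j.1 y) u v (setHeight_mem_cube (hI j) hu hy)
      (setHeight_mem_cube (hI j) hv hy)).trans ?_
    exact mul_le_mul_of_nonneg_right ((hK₁ (mem_range_self _)).trans (le_max_left _ _))
      (abs_nonneg _)
  · have hxO : (x : M) ∈ O := by
      refine hηO x x.2.1 (lt_of_le_of_lt ?_ hεη)
      rw [abs_le]; constructor <;> linarith [x.2.2.1, x.2.2.2]
    obtain ⟨i, hi, hxi⟩ := mem_iUnion₂.1 hxO
    exact ⟨⟨i, hi⟩, interior_subset (s := {y | f i y = 1}) hxi⟩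

/-- Slabs of a block between sufficiently close levels are products. -/
theorem IsBlock.exists_homeomorph_thin_slab [T2Space M] [CompactSpace M] (hφ : Continuous φ)
    (hB : IsBlock φ a b B) {t : ℝ} (ht : t ∈ Icc a b) :
    ∃ ε > 0, ∀ s s', a ≤ s → t - ε ≤ s → s < s' → s' ≤ b → s' ≤ t + ε →
      ∃ ℓ : slab φ B s s' ≃ₜ {x // x ∈ B ∧ φ x = t} × unitInterval,
        ∀ x : slab φ B s s', φ x = s + ((ℓ x).2 : ℝ) * (s' - s) := by
  obtain ⟨ε, hε, h, hh⟩ := hB.exists_homeomorph_near_level hφ ht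
  refine ⟨ε, hε, fun s s' h1 h2 h3 h4 h5 => ?_⟩
  have hI : Icc s s' ⊆ Icc (max a (t - ε)) (min b (t + ε)) :=
    Icc_subset_Icc (max_le h1 h2) (le_min h4 h5)
  have htI : t ∈ Icc (max a (t - ε)) (min b (t + ε)) :=
    ⟨max_le ht.1 (by linarith), le_min ht.2 (by linarith)⟩
  have hss : 0 < s' - s := by linarith
  have hsymm : ∀ z, φ (h.symm z) = z.2 := fun z => by rw [← hh, h.apply_symm_apply]
  have hτ : ∀ τ : unitInterval, s + τ * (s' - s) ∈ Icc s s' := fun τ =>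
    ⟨by nlinarith [τ.2.1], by nlinarith [τ.2.2]⟩
  have hdiv : ∀ x : slab φ B s s', (φ x - s) / (s' - s) ∈ Icc (0 : ℝ) 1 := fun x =>
    ⟨div_nonneg (by linarith [x.2.2.1]) hss.le, (div_le_one hss).2 (by linarith [x.2.2.2])⟩
  let up : slab φ B s s' → slab φ B (max a (t - ε)) (min b (t + ε)) := fun x =>
    ⟨x.1, x.2.1, hI x.2.2⟩
  let lift : {x // x ∈ B ∧ φ x = t} →
      {y : slab φ B (max a (t - ε)) (min b (t + ε)) // φ y = t} := fun y =>
    ⟨⟨y.1, y.2.1, by rw [y.2.2]; exact htI⟩, y.2.2⟩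
  refine ⟨{ toFun := fun x => (⟨(h (up x)).1.1.1, (h (up x)).1.1.2.1, (h (up x)).1.2⟩,
              ⟨(φ x - s) / (s' - s), hdiv x⟩)
            invFun := fun z => ⟨h.symm (lift z.1, ⟨s + z.2 * (s' - s), hI (hτ z.2)⟩),
              (h.symm _).2.1, by rw [hsymm]; exact hτ z.2⟩
            left_inv := fun x => ?_
            right_inv := fun z => ?_
            continuous_toFun := ?_
            continuous_invFun := ?_ }, fun x => ?_⟩
  · have e : (lift ⟨(h (up x)).1.1.1, (h (up x)).1.1.2.1, (h (up x)).1.2⟩,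
        (⟨s + (φ x - s) / (s' - s) * (s' - s), hI (hτ ⟨_, hdiv x⟩)⟩ :
            Icc (max a (t - ε)) (min b (t + ε)))) = h (up x) := by
      refine Prod.ext (Subtype.ext (Subtype.ext rfl)) (Subtype.ext ?_)
      refine Eq.trans ?_ (hh (up x)).symm
      show s + (φ x - s) / (s' - s) * (s' - s) = φ x
      rw [div_mul_cancel₀ _ hss.ne', add_sub_cancel]
    refine Subtype.ext ?_
    show (h.symm _).1 = x.1
    rw [e, h.symm_apply_apply]
  · refine Prod.ext (Subtype.ext ?_) (Subtype.ext ?_)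
    · show ((h (h.symm _)).1.1 : M) = z.1.1
      rw [h.apply_symm_apply]
    · show (φ (h.symm _) - s) / (s' - s) = z.2
      rw [hsymm]
      simp [hss.ne']
  · have hup : Continuous up := by fun_prop
    have hφ' : Continuous fun x : slab φ B s s' => (φ x - s) / (s' - s) := by fun_prop
    refine Continuous.prodMk ?_ (hφ'.subtype_mk _)
    exact (continuous_subtype_val.comp (continuous_subtype_val.comp
      (continuous_fst.comp (h.continuous.comp hup)))).subtype_mk _
  · have hlift : Continuous lift := by fun_prop
    refine Continuous.subtype_mk ?_ _
    refine continuous_subtype_val.comp (h.symm.continuous.comp ?_)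
    refine (hlift.comp continuous_fst).prodMk (Continuous.subtype_mk ?_ _)
    fun_prop
  · show φ x = s + (φ x - s) / (s' - s) * (s' - s)
    rw [div_mul_cancel₀ _ hss.ne']; ring

end Thin

/-! ### Orientation of adapted charts -/

section Orientation

set_option linter.unusedSectionVars false

variable {M : Type*} [TopologicalSpace M] [ChartedSpace E3 M]

/-- The determinant of the differential of the change of charts from `e` to `e'` at `x`. -/
def jacobianDet (e e' : OpenPartialHomeomorph M E3) (x : M) : ℝ :=
  (fderiv ℝ (e' ∘ e.symm) (e x)).det

theorem contDiffOn_transition {e e' : OpenPartialHomeomorph M E3}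
    (he : e ∈ IsManifold.maximalAtlas (𝓡 3) 1 M) (he' : e' ∈ IsManifold.maximalAtlas (𝓡 3) 1 M) :
    ContDiffOn ℝ 1 (e' ∘ e.symm) (e.target ∩ e.symm ⁻¹' e'.source) :=
  contMDiffOn_iff_contDiffOn.1 ((contMDiffOn_of_mem_maximalAtlas he').comp'
    (contMDiffOn_symm_of_mem_maximalAtlas he))

theorem contDiffAt_transition {e e' : OpenPartialHomeomorph M E3}
    (he : e ∈ IsManifold.maximalAtlas (𝓡 3) 1 M) (he' : e' ∈ IsManifold.maximalAtlas (𝓡 3) 1 M)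
    {x : M} (hx : x ∈ e.source) (hx' : x ∈ e'.source) : ContDiffAt ℝ 1 (e' ∘ e.symm) (e x) :=
  (contDiffOn_transition he he').contDiffAt ((e.isOpen_inter_preimage_symm e'.open_source).mem_nhds
    ⟨e.map_source hx, by simpa [e.left_inv hx] using hx'⟩)

theorem jacobianDet_self {e : OpenPartialHomeomorph M E3} {x : M} (hx : x ∈ e.source) :
    jacobianDet e e x = 1 := by
  have : e ∘ e.symm =ᶠ[𝓝 (e x)] id := by
    filter_upwards [e.open_target.mem_nhds (e.map_source hx)] with y hy
    exact e.right_inv hy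
  rw [jacobianDet, this.fderiv_eq, fderiv_id]
  exact LinearMap.det_id

theorem jacobianDet_trans {e₁ e₂ e₃ : OpenPartialHomeomorph M E3}
    (h₁ : e₁ ∈ IsManifold.maximalAtlas (𝓡 3) 1 M) (h₂ : e₂ ∈ IsManifold.maximalAtlas (𝓡 3) 1 M)
    (h₃ : e₃ ∈ IsManifold.maximalAtlas (𝓡 3) 1 M) {x : M} (hx₁ : x ∈ e₁.source)
    (hx₂ : x ∈ e₂.source) (hx₃ : x ∈ e₃.source) :
    jacobianDet e₁ e₃ x = jacobianDet e₂ e₃ x * jacobianDet e₁ e₂ x := by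
  have hev : e₃ ∘ e₁.symm =ᶠ[𝓝 (e₁ x)] (e₃ ∘ e₂.symm) ∘ (e₂ ∘ e₁.symm) := by
    filter_upwards [(e₁.isOpen_inter_preimage_symm e₂.open_source).mem_nhds
      ⟨e₁.map_source hx₁, by simpa [e₁.left_inv hx₁] using hx₂⟩] with y hy
    simp [e₂.left_inv hy.2]
  have hd1 := (contDiffAt_transition h₁ h₂ hx₁ hx₂).differentiableAt one_ne_zero
  have hd2 := (contDiffAt_transition h₂ h₃ hx₂ hx₃).differentiableAt one_ne_zero
  have hx : (e₂ ∘ e₁.symm) (e₁ x) = e₂ x := by simp [e₁.left_inv hx₁]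
  rw [jacobianDet, hev.fderiv_eq, fderiv_comp _ (by rwa [hx]) hd1, hx]
  exact LinearMap.det_comp _ _

theorem jacobianDet_pos_symm {e e' : OpenPartialHomeomorph M E3}
    (he : e ∈ IsManifold.maximalAtlas (𝓡 3) 1 M) (he' : e' ∈ IsManifold.maximalAtlas (𝓡 3) 1 M)
    {x : M} (hx : x ∈ e.source) (hx' : x ∈ e'.source) (h : 0 < jacobianDet e e' x) :
    0 < jacobianDet e' e x := by
  have h1 := jacobianDet_trans he he' he hx hx' hx
  rw [jacobianDet_self hx] at h1
  exact pos_of_mul_pos_left (h1 ▸ one_pos) h.le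

theorem isOpen_jacobianDet_mem {e e' : OpenPartialHomeomorph M E3}
    (he : e ∈ IsManifold.maximalAtlas (𝓡 3) 1 M) (he' : e' ∈ IsManifold.maximalAtlas (𝓡 3) 1 M)
    {O : Set ℝ} (hO : IsOpen O) :
    IsOpen {x | x ∈ e.source ∩ e'.source ∧ jacobianDet e e' x ∈ O} := by
  have hs := e.isOpen_inter_preimage_symm e'.open_source
  have h1 : ContinuousOn (fun y => (fderiv ℝ (e' ∘ e.symm) y).det)
      (e.target ∩ e.symm ⁻¹' e'.source) :=
    ContinuousLinearMap.continuous_det.comp_continuousOn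
      ((contDiffOn_transition he he').continuousOn_fderiv_of_isOpen hs le_rfl)
  have h2 : ContinuousOn (jacobianDet e e') (e.source ∩ e'.source) :=
    h1.comp (e.continuousOn.mono inter_subset_left) fun x hx =>
      ⟨e.map_source hx.1, by simpa [e.left_inv hx.1] using hx.2⟩
  exact h2.isOpen_inter_preimage (e.open_source.inter e'.open_source) hO

/-- The chart `e` is positively oriented with respect to the charts in `A`. -/
def IsPositive (A : Set (OpenPartialHomeomorph M E3)) (e : OpenPartialHomeomorph M E3) : Prop :=
  ∀ e' ∈ A, ∀ x ∈ e'.source ∩ e.source, 0 < jacobianDet e' e x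

/-- The defining properties of an oriented atlas, in terms of `jacobianDet`. -/
structure IsOrientedAtlas (A : Set (OpenPartialHomeomorph M E3)) : Prop where
  subset : A ⊆ IsManifold.maximalAtlas (𝓡 3) 1 M
  cover : ∀ x : M, ∃ e ∈ A, x ∈ e.source
  pos : ∀ e ∈ A, IsPositive A e

theorem IsOrientable.exists_isOrientedAtlas (h : IsOrientable (𝓡 3) M) :
    ∃ A : Set (OpenPartialHomeomorph M E3), IsOrientedAtlas A := by
  obtain ⟨A, h1, h2, h3⟩ := h
  refine ⟨A, h1, h2, fun e' he' e he x hx => ?_⟩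
  have := h3 e he e' he' x hx
  simpa [jacobianDet, Function.comp_def, fderivWithin_univ] using this

theorem IsPositive.jacobianDet_pos {A : Set (OpenPartialHomeomorph M E3)} (hA : IsOrientedAtlas A)
    {e e' : OpenPartialHomeomorph M E3} (he : e ∈ IsManifold.maximalAtlas (𝓡 3) 1 M)
    (he' : e' ∈ IsManifold.maximalAtlas (𝓡 3) 1 M) (h : IsPositive A e) (h' : IsPositive A e')
    {x : M} (hx : x ∈ e.source) (hx' : x ∈ e'.source) : 0 < jacobianDet e e' x := by
  obtain ⟨e₀, he₀, hx₀⟩ := hA.cover x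
  rw [jacobianDet_trans he (hA.subset he₀) he' hx hx₀ hx']
  exact mul_pos (h' _ he₀ _ ⟨hx₀, hx'⟩)
    (jacobianDet_pos_symm (hA.subset he₀) he hx₀ hx (h _ he₀ _ ⟨hx₀, hx⟩))

theorem det_clm_eq_det_matrix {n : ℕ} (L : EuclideanSpace ℝ (Fin n) →L[ℝ] EuclideanSpace ℝ (Fin n)) :
    L.det = Matrix.det (Matrix.of fun i j => L (EuclideanSpace.single j 1) i) := by
  have h := LinearMap.det_toMatrix (EuclideanSpace.basisFun (Fin n) ℝ).toBasis L.toLinearMap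
  rw [ContinuousLinearMap.det, ← h]
  rfl

variable {φ : M → ℝ} {a b : ℝ} {B : Set M}

/-- An adapted chart that is positively oriented at a point becomes positively oriented after
restriction to a neighbourhood of this point. -/
theorem exists_isPositive_of_jacobianDet_pos {A : Set (OpenPartialHomeomorph M E3)}
    (hA : IsOrientedAtlas A) {e e₀ : OpenPartialHomeomorph M E3} (he₀ : e₀ ∈ A) {x : M}
    (hx : x ∈ e.source) (hx₀ : x ∈ e₀.source) (he : IsAdaptedChart φ a b B e)
    (hpos : 0 < jacobianDet e₀ e x) :
    ∃ e', x ∈ e'.source ∧ IsAdaptedChart φ a b B e' ∧ IsPositive A e' := by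
  have hO := isOpen_jacobianDet_mem (hA.subset he₀) he.mem_atlas (isOpen_Ioi (a := (0 : ℝ)))
  refine ⟨e.restrOpen _ hO, ⟨hx, ⟨hx₀, hx⟩, hpos⟩, he.restrOpen _ hO, ?_⟩
  rintro e' he' y ⟨hy', hy, ⟨hy₀, -⟩, hyp⟩
  show 0 < jacobianDet e' e y
  rw [jacobianDet_trans (hA.subset he') (hA.subset he₀) he.mem_atlas hy' hy₀ hy]
  exact mul_pos hyp (hA.pos _ he₀ _ he' _ ⟨hy', hy₀⟩)

/-- Adapted charts can be chosen positively oriented: if necessary, change the sign of the last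
coordinate. -/
theorem IsBlock.exists_positive_chart [IsManifold (𝓡 3) 1 M]
    {A : Set (OpenPartialHomeomorph M E3)} (hA : IsOrientedAtlas A)
    (hB : IsBlock φ a b B) {x : M} (hx : x ∈ B) :
    ∃ e, x ∈ e.source ∧ IsAdaptedChart φ a b B e ∧ IsPositive A e := by
  obtain ⟨e, hxe, he⟩ := hB.chart x hx
  obtain ⟨e₀, he₀, hx₀⟩ := hA.cover x
  have hne : jacobianDet e₀ e x ≠ 0 := by
    intro h0
    have h1 := jacobianDet_trans he.mem_atlas (hA.subset he₀) he.mem_atlas hxe hx₀ hxe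
    rw [jacobianDet_self hxe, h0, zero_mul] at h1
    exact one_ne_zero h1
  rcases hne.lt_or_gt with hneg | hpos
  swap
  · exact exists_isPositive_of_jacobianDet_pos hA he₀ hxe hx₀ he hpos
  let s : Fin 3 → ℝ := ![1, 1, -1]
  have hs : ∀ i, s i ≠ 0 := by intro i; fin_cases i <;> simp [s]
  have hfd : ∀ i y, HasFDerivAt (fun y : E3 => s i * y i)
      (s i • (EuclideanSpace.proj i : E3 →L[ℝ] ℝ)) y := fun i y =>
    (EuclideanSpace.proj i : E3 →L[ℝ] ℝ).hasFDerivAt.const_smul (s i)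
  obtain ⟨e', he', hxe', hee', hcoord⟩ := exists_chart_of_coords he.mem_atlas hxe
    (fun i y => s i * y i)
    (fun i => (contDiff_const.mul (EuclideanSpace.proj i : E3 →L[ℝ] ℝ).contDiff).contDiffAt)
    (fun v hv => by
      ext i
      have := hv i
      rw [(hfd i _).fderiv] at this
      simpa [hs i] using this)
  have had : IsAdaptedChart φ a b B e' := by
    refine ⟨he', fun y hy => ?_, fun y hy => ?_⟩
    · rw [hcoord y hy 0, ← he.height y (hee' hy)]; simp [s]
    · rw [hcoord y hy 1, he.mem_iff y (hee' hy)]; simp [s]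
  refine exists_isPositive_of_jacobianDet_pos hA he₀ hxe' hx₀ had ?_
  rw [jacobianDet_trans (hA.subset he₀) he.mem_atlas he' hx₀ hxe hxe']
  refine mul_pos_of_neg_of_neg ?_ hneg
  let F : E3 →L[ℝ] E3 := LinearMap.toContinuousLinearMap
    (Matrix.toEuclideanLin (Matrix.diagonal s))
  have hF : ∀ y i, F y i = s i * y i := fun y i => by
    simp [F, Matrix.toLpLin_apply, Matrix.mulVec_diagonal]
  have hev : e' ∘ e.symm =ᶠ[𝓝 (e x)] F := by
    filter_upwards [(e.isOpen_inter_preimage_symm e'.open_source).mem_nhds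
      ⟨e.map_source hxe, by simpa [e.left_inv hxe] using hxe'⟩] with y hy
    ext i
    rw [hF, Function.comp_apply, hcoord _ hy.2, e.right_inv hy.1]
  rw [jacobianDet, hev.fderiv_eq, F.fderiv, det_clm_eq_det_matrix, Matrix.det_fin_three]
  simp [hF, s]

end Orientation

/-! ### Level sets of blocks are compact orientable surfaces -/

section Surface

set_option linter.unusedSectionVars false

/-- The plane, on which surfaces are modelled. -/
abbrev E2 : Type := EuclideanSpace ℝ (Fin 2)

/-- The inclusion of the plane as the horizontal plane of height `t`. -/
def planeAt (t : ℝ) (q : E2) : E3 := !₂[t, q 0, q 1]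

/-- The vertical projection to the plane. -/
def toPlane (y : E3) : E2 := !₂[y 1, y 2]

@[simp] theorem planeAt_zero (t : ℝ) (q : E2) : planeAt t q 0 = t := rfl
@[simp] theorem planeAt_one (t : ℝ) (q : E2) : planeAt t q 1 = q 0 := rfl
@[simp] theorem planeAt_two (t : ℝ) (q : E2) : planeAt t q 2 = q 1 := rfl
@[simp] theorem toPlane_zero (y : E3) : toPlane y 0 = y 1 := rfl
@[simp] theorem toPlane_one (y : E3) : toPlane y 1 = y 2 := rfl

theorem planeAt_toPlane (y : E3) : planeAt (y 0) (toPlane y) = y := by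
  ext i; fin_cases i <;> rfl

/-- The linear part of `planeAt`. -/
def planeIncl : E2 →L[ℝ] E3 := LinearMap.toContinuousLinearMap
  { toFun := planeAt 0
    map_add' := fun x y => by ext i; fin_cases i <;> simp
    map_smul' := fun c x => by ext i; fin_cases i <;> simp }

/-- `toPlane` as a continuous linear map. -/
def planeProj : E3 →L[ℝ] E2 := LinearMap.toContinuousLinearMap
  { toFun := toPlane
    map_add' := fun x y => by ext i; fin_cases i <;> simp
    map_smul' := fun c x => by ext i; fin_cases i <;> simp }

theorem planeAt_eq (t : ℝ) (q : E2) : planeAt t q = planeIncl q + !₂[t, 0, 0] := by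
  ext i; fin_cases i <;> simp [planeIncl]

theorem hasFDerivAt_planeAt (t : ℝ) (q : E2) : HasFDerivAt (planeAt t) planeIncl q := by
  rw [show planeAt t = fun q => planeIncl q + !₂[t, 0, 0] from funext (planeAt_eq t)]
  exact planeIncl.hasFDerivAt.add_const _

theorem contDiff_planeAt (t : ℝ) : ContDiff ℝ 1 (planeAt t) := by
  rw [show planeAt t = fun q => planeIncl q + !₂[t, 0, 0] from funext (planeAt_eq t)]
  exact planeIncl.contDiff.add contDiff_const

theorem hasFDerivAt_toPlane (y : E3) : HasFDerivAt toPlane planeProj y := planeProj.hasFDerivAt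

theorem contDiff_toPlane : ContDiff ℝ 1 toPlane := planeProj.contDiff

/-- A linear map that preserves the first coordinate has the same determinant as the map it induces
on the plane. -/
theorem det_plane_eq (D : E3 →L[ℝ] E3) (hD : ∀ v, D v 0 = v 0) :
    (planeProj ∘L D ∘L planeIncl).det = D.det := by
  have h0 : planeIncl (EuclideanSpace.single 0 1) = EuclideanSpace.single 1 1 := by
    ext i; fin_cases i <;> simp [planeIncl]
  have h1 : planeIncl (EuclideanSpace.single 1 1) = EuclideanSpace.single 2 1 := by
    ext i; fin_cases i <;> simp [planeIncl]
  have hp0 : ∀ y, planeProj y 0 = y 1 := fun _ => rfl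
  have hp1 : ∀ y, planeProj y 1 = y 2 := fun _ => rfl
  rw [det_clm_eq_det_matrix, det_clm_eq_det_matrix, Matrix.det_fin_two, Matrix.det_fin_three]
  simp [h0, h1, hp0, hp1, hD]

variable {M : Type u} [TopologicalSpace M] [ChartedSpace E3 M]

/-- The level set of height `t` of a block. -/
abbrev LevelSet (φ : M → ℝ) (B : Set M) (t : ℝ) : Type u := {x : M // x ∈ B ∧ φ x = t}

variable {φ : M → ℝ} {a b t : ℝ} {B : Set M}

theorem IsAdaptedChart.planeAt_toPlane {e : OpenPartialHomeomorph M E3}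
    (he : IsAdaptedChart φ a b B e) {x : M} (hx : x ∈ e.source) :
    planeAt (φ x) (toPlane (e x)) = e x := by
  rw [← he.height x hx, _root_.planeAt_toPlane]

theorem IsAdaptedChart.symm_mem {e : OpenPartialHomeomorph M E3}
    (he : IsAdaptedChart φ a b B e) (ht : t ∈ Icc a b) {q : E2} (hq : planeAt t q ∈ e.target)
    (hq0 : 0 ≤ q 0) : e.symm (planeAt t q) ∈ B ∧ φ (e.symm (planeAt t q)) = t := by
  have hs := e.map_target hq
  have hφ : φ (e.symm (planeAt t q)) = t := by
    rw [← he.height _ hs, e.right_inv hq, planeAt_zero]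
  refine ⟨(he.mem_iff _ hs).2 ?_, hφ⟩
  rw [hφ, e.right_inv hq]
  exact ⟨ht.1, ht.2, hq0⟩

/-- The chart of the level set of height `t` given by the last two coordinates of an adapted chart.
The point `y₀` is the value of the inverse chart outside the target. -/
def surfaceChart {e : OpenPartialHomeomorph M E3} (he : IsAdaptedChart φ a b B e)
    (ht : t ∈ Icc a b) (y₀ : LevelSet φ B t) :
    OpenPartialHomeomorph (LevelSet φ B t) (EuclideanHalfSpace 2) where
  toFun y := ⟨!₂[max (e y 1) 0, e y 2], le_max_right _ _⟩
  invFun q := open Classical in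
    if h : e.symm (planeAt t q.1) ∈ B ∧ φ (e.symm (planeAt t q.1)) = t then ⟨_, h⟩ else y₀
  source := {y | y.1 ∈ e.source}
  target := {q | planeAt t q.1 ∈ e.target}
  map_source' := by
    intro y hy
    have h := ((he.mem_iff _ hy).1 y.2.1).2.2
    have h2 : planeAt t !₂[max (e y 1) 0, e y 2] = e y := by
      rw [max_eq_left h]
      have := he.planeAt_toPlane hy
      rwa [y.2.2] at this
    show planeAt t _ ∈ e.target
    rw [h2]
    exact e.map_source hy
  map_target' := by
    intro q hq
    have h := he.symm_mem ht hq q.2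
    rw [dif_pos h]
    exact e.map_target hq
  left_inv' := by
    intro y hy
    have h := ((he.mem_iff _ hy).1 y.2.1).2.2
    have h2 : planeAt t !₂[max (e y 1) 0, e y 2] = e y := by
      rw [max_eq_left h]
      have := he.planeAt_toPlane hy
      rwa [y.2.2] at this
    have h3 : e.symm (planeAt t !₂[max (e y 1) 0, e y 2]) = y := by rw [h2, e.left_inv hy]
    rw [dif_pos (by rw [h3]; exact y.2)]
    exact Subtype.ext h3
  right_inv' := by
    intro q hq
    have h := he.symm_mem ht hq q.2
    rw [dif_pos h]
    refine EuclideanHalfSpace.ext _ _ ?_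
    have h1 : e (e.symm (planeAt t q.1)) = planeAt t q.1 := e.right_inv hq
    simp only [h1]
    have h0 := q.2
    ext i
    fin_cases i
    · simpa using h0
    · simp
  open_source := e.open_source.preimage continuous_subtype_val
  open_target := e.open_target.preimage ((contDiff_planeAt t).continuous.comp continuous_subtype_val)
  continuousOn_toFun := by
    rw [continuousOn_iff_continuous_domRestrict, continuous_induced_rng]
    suffices h : ContinuousOn (fun y : LevelSet φ B t => (!₂[max (e y 1) 0, e y 2] : E2))
        {y | y.1 ∈ e.source} from continuousOn_iff_continuous_domRestrict.1 h
    have h1 : ContinuousOn (fun y : LevelSet φ B t => e y) {y | y.1 ∈ e.source} :=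
      e.continuousOn.comp continuous_subtype_val.continuousOn fun y hy => hy
    refine (PiLp.continuous_toLp 2 _).comp_continuousOn (continuousOn_pi.2 fun i => ?_)
    fin_cases i
    · exact ((EuclideanSpace.proj 1 : E3 →L[ℝ] ℝ).continuous.comp_continuousOn h1).sup
        continuousOn_const
    · exact (EuclideanSpace.proj 2 : E3 →L[ℝ] ℝ).continuous.comp_continuousOn h1
  continuousOn_invFun := by
    rw [continuousOn_iff_continuous_domRestrict, continuous_induced_rng]
    have h1 : ContinuousOn (fun q : EuclideanHalfSpace 2 => e.symm (planeAt t q.1))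
        {q | planeAt t q.1 ∈ e.target} :=
      e.continuousOn_symm.comp
        ((contDiff_planeAt t).continuous.comp continuous_subtype_val).continuousOn fun q hq => hq
    refine (continuousOn_iff_continuous_domRestrict.1 h1).congr fun q => ?_
    have h := he.symm_mem ht q.2 q.1.2
    simp [h]

theorem surfaceChart_coe {e : OpenPartialHomeomorph M E3} (he : IsAdaptedChart φ a b B e)
    (ht : t ∈ Icc a b) (y₀ : LevelSet φ B t) {y : LevelSet φ B t} (hy : y.1 ∈ e.source) :
    (surfaceChart he ht y₀ y).1 = toPlane (e y) := by
  have h := ((he.mem_iff _ hy).1 y.2.1).2.2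
  show !₂[max (e y 1) 0, e y 2] = _
  rw [max_eq_left h]
  rfl

theorem surfaceChart_symm_coe {e : OpenPartialHomeomorph M E3} (he : IsAdaptedChart φ a b B e)
    (ht : t ∈ Icc a b) (y₀ : LevelSet φ B t) {q : EuclideanHalfSpace 2}
    (hq : planeAt t q.1 ∈ e.target) :
    ((surfaceChart he ht y₀).symm q).1 = e.symm (planeAt t q.1) := by
  have h := he.symm_mem ht hq q.2
  simp [surfaceChart, h]

/-- In adapted charts, the change of charts of the level set is the restriction of the change of
charts of the manifold. -/
theorem surfaceChart_transition {e₁ e₂ : OpenPartialHomeomorph M E3}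
    (he₁ : IsAdaptedChart φ a b B e₁) (he₂ : IsAdaptedChart φ a b B e₂) (ht : t ∈ Icc a b)
    (y₁ y₂ : LevelSet φ B t) {q : E2}
    (hq : q ∈ (𝓡∂ 2).symm ⁻¹' ((surfaceChart he₁ ht y₁).symm ≫ₕ surfaceChart he₂ ht y₂).source ∩
      range (𝓡∂ 2)) :
    (planeAt t q ∈ e₁.target ∩ e₁.symm ⁻¹' e₂.source) ∧
    (𝓡∂ 2) (surfaceChart he₂ ht y₂ ((surfaceChart he₁ ht y₁).symm ((𝓡∂ 2).symm q))) =
      toPlane (e₂ (e₁.symm (planeAt t q))) := by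
  obtain ⟨⟨h1, h2⟩, h3⟩ := hq
  have hqv : ((𝓡∂ 2).symm q).1 = q := (𝓡∂ 2).right_inv h3
  have h1' : planeAt t ((𝓡∂ 2).symm q).1 ∈ e₁.target := h1
  have h2' : ((surfaceChart he₁ ht y₁).symm ((𝓡∂ 2).symm q)).1 ∈ e₂.source := h2
  have hs := surfaceChart_symm_coe he₁ ht y₁ h1'
  refine ⟨⟨by rwa [hqv] at h1', ?_⟩, ?_⟩
  · rw [hs, hqv] at h2'
    exact h2'
  · have := surfaceChart_coe he₂ ht y₂ h2'
    rw [hs, hqv] at this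
    exact this

/-- The charted space structure of a level set, given by the positively oriented adapted charts. -/
@[reducible]
def levelSetChartedSpace [IsManifold (𝓡 3) 1 M] {A : Set (OpenPartialHomeomorph M E3)}
    (hA : IsOrientedAtlas A) (hB : IsBlock φ a b B) (ht : t ∈ Icc a b) :
    ChartedSpace (EuclideanHalfSpace 2) (LevelSet φ B t) where
  atlas := {c | ∃ (e : OpenPartialHomeomorph M E3) (he : IsAdaptedChart φ a b B e)
    (y₀ : LevelSet φ B t), IsPositive A e ∧ c = surfaceChart he ht y₀}
  chartAt y := surfaceChart (hB.exists_positive_chart hA y.2.1).choose_spec.2.1 ht y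
  mem_chart_source y := (hB.exists_positive_chart hA y.2.1).choose_spec.1
  chart_mem_atlas y := ⟨_, _, _, (hB.exists_positive_chart hA y.2.1).choose_spec.2.2, rfl⟩

/-- The charts of a level set that come from positively oriented adapted charts have transition maps of
positive determinant. -/
theorem det_surface_transition {A : Set (OpenPartialHomeomorph M E3)} (hA : IsOrientedAtlas A)
    {e₁ e₂ : OpenPartialHomeomorph M E3}
    (he₁ : IsAdaptedChart φ a b B e₁) (he₂ : IsAdaptedChart φ a b B e₂) (ht : t ∈ Icc a b)
    (hp₁ : IsPositive A e₁) (hp₂ : IsPositive A e₂)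
    (y₁ y₂ : LevelSet φ B t) {y : LevelSet φ B t}
    (hy₁ : y.1 ∈ e₁.source) (hy₂ : y.1 ∈ e₂.source) :
    0 < (fderivWithin ℝ (fun q : E2 => (𝓡∂ 2) (surfaceChart he₂ ht y₂
      ((surfaceChart he₁ ht y₁).symm ((𝓡∂ 2).symm q)))) (range (𝓡∂ 2))
      ((𝓡∂ 2) (surfaceChart he₁ ht y₁ y))).det := by
  set c₁ := surfaceChart he₁ ht y₁
  set c₂ := surfaceChart he₂ ht y₂
  set q₀ : E2 := (𝓡∂ 2) (c₁ y) with hq₀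
  have hq₀' : planeAt t q₀ = e₁ y := by
    have h1 : q₀ = toPlane (e₁ y) := surfaceChart_coe he₁ ht y₁ hy₁
    have h2 := he₁.planeAt_toPlane hy₁
    rwa [y.2.2, ← h1] at h2
  set T : E3 → E3 := e₂ ∘ e₁.symm with hT
  have hev : (fun q : E2 => (𝓡∂ 2) (c₂ (c₁.symm ((𝓡∂ 2).symm q)))) =ᶠ[𝓝[range (𝓡∂ 2)] q₀]
      toPlane ∘ T ∘ planeAt t := by
    have hO : IsOpen ((𝓡∂ 2).symm ⁻¹' (c₁.symm ≫ₕ c₂).source) :=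
      (c₁.symm ≫ₕ c₂).open_source.preimage (𝓡∂ 2).continuous_symm
    have hm : q₀ ∈ (𝓡∂ 2).symm ⁻¹' (c₁.symm ≫ₕ c₂).source := by
      have : (𝓡∂ 2).symm q₀ = c₁ y := (𝓡∂ 2).left_inv _
      rw [mem_preimage, this]
      refine ⟨c₁.map_source hy₁, ?_⟩
      show c₁.symm (c₁ y) ∈ c₂.source
      rw [c₁.left_inv hy₁]
      exact hy₂
    filter_upwards [self_mem_nhdsWithin, mem_nhdsWithin_of_mem_nhds (hO.mem_nhds hm)] with q h1 h2
    exact (surfaceChart_transition he₁ he₂ ht y₁ y₂ ⟨h2, h1⟩).2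
  have hTd : HasFDerivAt T (fderiv ℝ T (planeAt t q₀)) (planeAt t q₀) := by
    rw [hq₀']
    exact ((contDiffAt_transition he₁.mem_atlas he₂.mem_atlas hy₁ hy₂).differentiableAt
      one_ne_zero).hasFDerivAt
  have hd : HasFDerivAt (toPlane ∘ T ∘ planeAt t)
      (planeProj ∘L (fderiv ℝ T (planeAt t q₀)) ∘L planeIncl) q₀ :=
    (hasFDerivAt_toPlane _).comp q₀ (hTd.comp q₀ (hasFDerivAt_planeAt t q₀))
  have huniq : UniqueDiffWithinAt ℝ (range (𝓡∂ 2)) q₀ :=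
    (𝓡∂ 2).uniqueDiffOn _ (mem_range_self _)
  rw [hev.fderivWithin_eq_of_mem (mem_range_self _), hd.hasFDerivWithinAt.fderivWithin huniq,
    det_plane_eq, hq₀']
  · exact hp₁.jacobianDet_pos hA he₁.mem_atlas he₂.mem_atlas hp₂ hy₁ hy₂
  · intro v
    -- both charts have first coordinate `φ`, so the change of charts preserves it
    have h1 : (fun z => T z 0) =ᶠ[𝓝 (planeAt t q₀)] fun z => z 0 := by
      rw [hq₀']
      filter_upwards [(e₁.isOpen_inter_preimage_symm e₂.open_source).mem_nhds
        ⟨e₁.map_source hy₁, by simpa [e₁.left_inv hy₁] using hy₂⟩] with z hz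
      rw [hT, Function.comp_apply, he₂.height _ hz.2, ← he₁.height _ (e₁.map_target hz.1),
        e₁.right_inv hz.1]
    have h2 := ((EuclideanSpace.proj 0 : E3 →L[ℝ] ℝ).hasFDerivAt.comp _ hTd).fderiv
    have h3 := (EuclideanSpace.proj 0 : E3 →L[ℝ] ℝ).fderiv (x := planeAt t q₀)
    have h4 : ((EuclideanSpace.proj 0 : E3 →L[ℝ] ℝ) ∘ T) =ᶠ[𝓝 (planeAt t q₀)]
      (EuclideanSpace.proj 0 : E3 →L[ℝ] ℝ) := h1
    have h5 := h4.fderiv_eq (𝕜 := ℝ)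
    rw [h2, h3] at h5
    exact congrArg (fun L : E3 →L[ℝ] ℝ => L v) h5

/-- The level sets of a block in an orientable manifold are compact orientable surfaces. -/
theorem IsBlock.exists_surface [T2Space M] [CompactSpace M] [IsManifold (𝓡 3) 1 M]
    (hM : IsOrientable (𝓡 3) M) (hφ : Continuous φ) (hB : IsBlock φ a b B) (ht : t ∈ Icc a b) :
    ∃ F : CompactOrientableSurface.{u}, Nonempty (LevelSet φ B t ≃ₜ F.carrier) := by
  obtain ⟨A, hA⟩ := IsOrientable.exists_isOrientedAtlas hM
  let _ := levelSetChartedSpace hA hB ht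
  have hc : IsClosed {x | x ∈ B ∧ φ x = t} :=
    hB.isClosed.inter (isClosed_singleton.preimage hφ)
  have : CompactSpace (LevelSet φ B t) := isCompact_iff_compactSpace.1 hc.isCompact
  have : IsManifold (𝓡∂ 2) 1 (LevelSet φ B t) := by
    refine isManifold_of_contDiffOn _ _ _ ?_
    rintro _ _ ⟨e₁, he₁, y₁, -, rfl⟩ ⟨e₂, he₂, y₂, -, rfl⟩
    have h1 : ContDiffOn ℝ 1 (toPlane ∘ (e₂ ∘ e₁.symm) ∘ planeAt t)
        (planeAt t ⁻¹' (e₁.target ∩ e₁.symm ⁻¹' e₂.source)) :=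
      contDiff_toPlane.comp_contDiffOn
        ((contDiffOn_transition he₁.mem_atlas he₂.mem_atlas).comp
          (contDiff_planeAt t).contDiffOn fun q hq => hq)
    refine (h1.mono fun q hq => (surfaceChart_transition he₁ he₂ ht y₁ y₂ hq).1).congr
      fun q hq => (surfaceChart_transition he₁ he₂ ht y₁ y₂ hq).2
  refine ⟨⟨LevelSet φ B t, ?_⟩, ⟨.refl _⟩⟩
  refine ⟨atlas _ _, IsManifold.subset_maximalAtlas,
    fun y => ⟨_, chart_mem_atlas _ y, mem_chart_source _ y⟩, ?_⟩
  rintro _ ⟨e₁, he₁, y₁, hp₁, rfl⟩ _ ⟨e₂, he₂, y₂, hp₂, rfl⟩ y hy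
  exact det_surface_transition hA he₁ he₂ ht hp₁ hp₂ y₁ y₂ hy.1 hy.2

end Surface

/-! ### Stacking slabs -/

section Stacking

set_option linter.unusedSectionVars false

/-- A homeomorphism that straightens the edge of the wedge `0 ≤ σ (y₀ - c)`, `0 ≤ y₁`, where
`σ = 1` or `σ = -1`: the new first coordinate is the minimum of the two functions. -/
def straighten (σ c : ℝ) (hσ : σ * σ = 1) : E3 ≃ₜ E3 where
  toFun y := !₂[min (σ * (y 0 - c)) (y 1), σ * (y 0 - c) - y 1, y 2]
  invFun z := !₂[c + σ * (z 0 + max (z 1) 0), z 0 + max (-z 1) 0, z 2]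
  left_inv y := by
    ext i
    fin_cases i
    · show c + σ * (min (σ * (y 0 - c)) (y 1) + max (σ * (y 0 - c) - y 1) 0) = y 0
      have h : min (σ * (y 0 - c)) (y 1) + max (σ * (y 0 - c) - y 1) 0 = σ * (y 0 - c) := by
        rcases le_total (σ * (y 0 - c)) (y 1) with h | h
        · rw [min_eq_left h, max_eq_right (by linarith), add_zero]
        · rw [min_eq_right h, max_eq_left (by linarith)]; ring
      rw [h, ← mul_assoc, hσ]; ring
    · show min (σ * (y 0 - c)) (y 1) + max (-(σ * (y 0 - c) - y 1)) 0 = y 1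
      rcases le_total (σ * (y 0 - c)) (y 1) with h | h
      · rw [min_eq_left h, max_eq_left (by linarith)]; ring
      · rw [min_eq_right h, max_eq_right (by linarith), add_zero]
    · rfl
  right_inv z := by
    have h0 : σ * (c + σ * (z 0 + max (z 1) 0) - c) = z 0 + max (z 1) 0 := by
      rw [add_sub_cancel_left, ← mul_assoc, hσ, one_mul]
    ext i
    fin_cases i
    · show min (σ * (c + σ * (z 0 + max (z 1) 0) - c)) (z 0 + max (-z 1) 0) = z 0
      rw [h0]
      rcases le_total (z 1) 0 with h | h
      · rw [max_eq_right h, min_eq_left (by linarith [le_max_right (-z 1) 0]), add_zero]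
      · rw [max_eq_right (by linarith : -z 1 ≤ 0), min_eq_right (by linarith [le_max_right (z 1) 0]),
          add_zero]
    · show σ * (c + σ * (z 0 + max (z 1) 0) - c) - (z 0 + max (-z 1) 0) = z 1
      rw [h0]
      rcases le_total (z 1) 0 with h | h
      · rw [max_eq_right h, max_eq_left (by linarith)]; ring
      · rw [max_eq_left h, max_eq_right (by linarith)]; ring
    · rfl
  continuous_toFun := by
    refine (PiLp.continuous_toLp 2 _).comp (continuous_pi fun i => ?_)
    have hp : ∀ i : Fin 3, Continuous fun z : E3 => z i := fun i =>
      (EuclideanSpace.proj i : E3 →L[ℝ] ℝ).continuous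
    have h0 := hp 0
    have h1 := hp 1
    have h2 := hp 2
    fin_cases i
    · exact (continuous_const.mul (h0.sub continuous_const)).min h1
    · exact (continuous_const.mul (h0.sub continuous_const)).sub h1
    · exact h2
  continuous_invFun := by
    refine (PiLp.continuous_toLp 2 _).comp (continuous_pi fun i => ?_)
    have hp : ∀ i : Fin 3, Continuous fun z : E3 => z i := fun i =>
      (EuclideanSpace.proj i : E3 →L[ℝ] ℝ).continuous
    have h0 := hp 0
    have h1 := hp 1
    have h2 := hp 2
    fin_cases i
    · exact continuous_const.add (continuous_const.mul (h0.add (h1.max continuous_const)))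
    · exact h0.add (h1.neg.max continuous_const)
    · exact h2

variable {M : Type u} [TopologicalSpace M] [ChartedSpace E3 M]
variable {φ : M → ℝ} {a b s s' α β γ : ℝ} {B N S : Set M}

/-- A slab of a block is a locally flat submanifold: near each of its points at most two of the
three defining inequalities matter, and the resulting edge can be straightened. -/
theorem IsBlock.isSubmanifold3_slab (hφ : Continuous φ) (hB : IsBlock φ a b B) (has : a ≤ s)
    (hss : s < s') (hsb : s' ≤ b) : IsSubmanifold3 (slab φ B s s') := by
  intro x hx
  obtain ⟨e, hxe, he⟩ := hB.chart x hx.1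
  rcases hx.2.2.lt_or_eq with hlt | heq
  · have hO : IsOpen {y | φ y < s'} := isOpen_lt hφ continuous_const
    refine ⟨(e.restrOpen _ hO).transHomeomorph (straighten 1 s (by norm_num)), ⟨hxe, hlt⟩, ?_⟩
    rintro y ⟨hy, hys : φ y < s'⟩
    show 0 ≤ min (1 * (e y 0 - s)) (e y 1) ↔ y ∈ B ∧ φ y ∈ Icc s s'
    rw [he.mem_iff y hy, he.height y hy, le_min_iff, one_mul, sub_nonneg]
    exact ⟨fun h => ⟨⟨has.trans h.1, hys.le.trans hsb, h.2⟩, h.1, hys.le⟩,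
      fun h => ⟨h.2.1, h.1.2.2⟩⟩
  · have hO : IsOpen {y | s < φ y} := isOpen_lt continuous_const hφ
    refine ⟨(e.restrOpen _ hO).transHomeomorph (straighten (-1) s' (by norm_num)),
      ⟨hxe, show s < φ x by rwa [heq]⟩, ?_⟩
    rintro y ⟨hy, hys : s < φ y⟩
    show 0 ≤ min (-1 * (e y 0 - s')) (e y 1) ↔ y ∈ B ∧ φ y ∈ Icc s s'
    rw [he.mem_iff y hy, he.height y hy, le_min_iff, neg_one_mul, neg_nonneg, sub_nonpos]
    exact ⟨fun h => ⟨⟨has.trans hys.le, h.1.trans hsb, h.2⟩, hys.le, h.1⟩,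
      fun h => ⟨h.2.2, h.1.2.2⟩⟩

/-- `S` is a submanifold that is the product of a compact orientable surface with an interval, in
such a way that `φ` increases from `s` to `s'` along the interval. -/
structure IsProductSlab (φ : M → ℝ) (S : Set M) (s s' : ℝ) : Prop where
  lt : s < s'
  isSubmanifold3 : IsSubmanifold3 S
  exists_homeomorph : ∃ (F : CompactOrientableSurface.{u}) (ℓ : S ≃ₜ F.carrier × unitInterval),
    ∀ x : S, φ x = s + ((ℓ x).2 : ℝ) * (s' - s)

theorem IsBlock.exists_isProductSlab [T2Space M] [CompactSpace M] [IsManifold (𝓡 3) 1 M]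
    (hM : IsOrientable (𝓡 3) M) (hφ : Continuous φ) (hB : IsBlock φ a b B) {t : ℝ}
    (ht : t ∈ Icc a b) :
    ∃ ε > 0, ∀ s s', a ≤ s → t - ε ≤ s → s < s' → s' ≤ b → s' ≤ t + ε →
      IsProductSlab φ (slab φ B s s') s s' := by
  obtain ⟨ε, hε, h⟩ := hB.exists_homeomorph_thin_slab hφ ht
  obtain ⟨F, ⟨g⟩⟩ := hB.exists_surface hM hφ ht
  refine ⟨ε, hε, fun s s' h1 h2 h3 h4 h5 => ⟨h3, hB.isSubmanifold3_slab hφ h1 h3 h4, ?_⟩⟩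
  obtain ⟨ℓ, hℓ⟩ := h s s' h1 h2 h3 h4 h5
  exact ⟨F, ℓ.trans (g.prodCongr (.refl _)), hℓ⟩

/-- `N` is a stack of product slabs, which lie between consecutive levels that increase from `α` to
`β`. -/
def IsStack (φ : M → ℝ) (N : Set M) (α β : ℝ) : Prop :=
  ∃ (r : ℕ) (τ : ℕ → ℝ) (S : ℕ → Set M), τ 0 = α ∧ τ r = β ∧
    (∀ j < r, IsProductSlab φ (S j) (τ j) (τ (j + 1))) ∧ N = ⋃ j ∈ Iio r, S j

theorem isStack_empty (φ : M → ℝ) (α : ℝ) : IsStack φ ∅ α α :=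
  ⟨0, fun _ => α, fun _ => ∅, rfl, rfl, by simp, by simp⟩

theorem IsStack.append (h : IsStack φ N α β) (hS : IsProductSlab φ S β γ) :
    IsStack φ (N ∪ S) α γ := by
  obtain ⟨r, τ, T, h0, hr, hT, rfl⟩ := h
  refine ⟨r + 1, fun j => if j ≤ r then τ j else γ, fun j => if j < r then T j else S,
    by simpa using h0, by simp, fun j hj => ?_, ?_⟩
  · rcases (Nat.lt_succ_iff.1 hj).lt_or_eq with h | rfl
    · simpa [h, h.le, Nat.succ_le_of_lt h] using hT j h
    · simpa [hr] using hS
  · ext x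
    simp only [mem_union, mem_iUnion, mem_Iio, exists_prop]
    constructor
    · rintro (⟨j, hj, hx⟩ | hx)
      · exact ⟨j, by omega, by simpa [hj] using hx⟩
      · exact ⟨r, by omega, by simpa using hx⟩
    · rintro ⟨j, hj, hx⟩
      by_cases h : j < r
      · exact Or.inl ⟨j, h, by simpa [h] using hx⟩
      · exact Or.inr (by simpa [h] using hx)

/-- A block can be cut into thin product slabs. -/
theorem IsStack.append_block [T2Space M] [CompactSpace M] [IsManifold (𝓡 3) 1 M]
    (hM : IsOrientable (𝓡 3) M) (hφ : Continuous φ) (hN : IsStack φ N α a)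
    (hB : IsBlock φ a b B) : IsStack φ (N ∪ B) α b := by
  have hloc : ∀ t : Icc a b, ∃ ε > 0, ∀ s s', a ≤ s → t - ε ≤ s → s < s' → s' ≤ b → s' ≤ t + ε →
      IsProductSlab φ (slab φ B s s') s s' := fun t => hB.exists_isProductSlab hM hφ t.2
  choose ε hε hprod using hloc
  obtain ⟨η, hη, hη'⟩ := lebesgue_number_lemma_of_metric (isCompact_Icc (a := a) (b := b))
    (c := fun t : Icc a b => Metric.ball (t : ℝ) (ε t)) (fun t => Metric.isOpen_ball)
    fun t ht => mem_iUnion.2 ⟨⟨t, ht⟩, Metric.mem_ball_self (hε ⟨t, ht⟩)⟩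
  have hab := hB.lt
  obtain ⟨n, hn⟩ := exists_nat_gt ((b - a) / η)
  have hn0 : (0 : ℝ) < n := (div_pos (by linarith) hη).trans hn
  set d := (b - a) / n with hd
  have hd0 : 0 < d := div_pos (by linarith) hn0
  have hdη : d < η := by
    rw [hd, div_lt_iff₀ hn0]
    rwa [div_lt_iff₀ hη, mul_comm] at hn
  have hdn : n * d = b - a := by rw [hd]; field_simp
  have hpiece : ∀ j < n, IsProductSlab φ (slab φ B (a + j * d) (a + (j + 1 : ℕ) * d))
      (a + j * d) (a + (j + 1 : ℕ) * d) := by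
    intro j hj
    have h1 : (j : ℝ) * d + d ≤ b - a := by
      have : ((j : ℝ) + 1) ≤ n := by exact_mod_cast hj
      nlinarith
    have h0 : 0 ≤ (j : ℝ) * d := by positivity
    have h2 : ((j + 1 : ℕ) : ℝ) * d = j * d + d := by push_cast; ring
    rw [h2]
    obtain ⟨t, ht⟩ := hη' (a + j * d) ⟨by linarith, by linarith⟩
    have e1 : a + j * d ∈ Metric.ball (t : ℝ) (ε t) := ht (Metric.mem_ball_self hη)
    have e2 : a + (j * d + d) ∈ Metric.ball (t : ℝ) (ε t) := ht (by
      rw [Metric.mem_ball, Real.dist_eq, abs_lt]; constructor <;> linarith)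
    rw [Metric.mem_ball, Real.dist_eq, abs_lt] at e1 e2
    exact hprod t _ _ (by linarith) (by linarith [e1.1]) (by linarith) (by linarith)
      (by linarith [e2.2])
  have hstack : ∀ j ≤ n, IsStack φ (N ∪ ⋃ i ∈ Iio j, slab φ B (a + i * d) (a + (i + 1 : ℕ) * d))
      α (a + j * d) := by
    intro j
    induction j with
    | zero => intro _; simpa using hN
    | succ j ih =>
      intro hj
      have h1 := (ih (by omega)).append (hpiece j (by omega))
      rwa [union_assoc, show (⋃ i ∈ Iio j, slab φ B (a + i * d) (a + (i + 1 : ℕ) * d)) ∪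
        slab φ B (a + j * d) (a + (j + 1 : ℕ) * d) =
        ⋃ i ∈ Iio (j + 1), slab φ B (a + i * d) (a + (i + 1 : ℕ) * d) by
          ext x
          simp only [mem_union, mem_iUnion, mem_Iio, exists_prop]
          constructor
          · rintro (⟨i, hi, h⟩ | h)
            · exact ⟨i, by omega, h⟩
            · exact ⟨j, by omega, h⟩
          · rintro ⟨i, hi, h⟩
            rcases (Nat.lt_succ_iff.1 hi).lt_or_eq with h' | rfl
            · exact Or.inl ⟨i, h', h⟩
            · exact Or.inr h] at h1
  have hfin := hstack n le_rfl
  rw [hdn, add_sub_cancel] at hfin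
  convert hfin using 2
  ext x
  simp only [mem_iUnion, mem_Iio, exists_prop]
  constructor
  · intro hx
    obtain ⟨h1, h2⟩ := hB.mem_Icc hx
    rcases h2.lt_or_eq with h2 | h2
    · refine ⟨⌊(φ x - a) / d⌋₊, ?_, hx, ?_, ?_⟩
      · rw [Nat.floor_lt (div_nonneg (by linarith) hd0.le), div_lt_iff₀ hd0, hdn]
        linarith
      · have := Nat.floor_le (div_nonneg (sub_nonneg.2 h1) hd0.le)
        rw [le_div_iff₀ hd0] at this
        linarith
      · have := Nat.lt_floor_add_one ((φ x - a) / d)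
        rw [div_lt_iff₀ hd0] at this
        push_cast
        linarith
    · have hn1 : n ≠ 0 := by rintro rfl; simp at hn0
      obtain ⟨m, rfl⟩ := Nat.exists_eq_succ_of_ne_zero hn1
      refine ⟨m, Nat.lt_succ_self m, hx, ?_, ?_⟩
      · have : ((m : ℝ) + 1) * d = b - a := by exact_mod_cast hdn
        nlinarith
      · have : ((m + 1 : ℕ) : ℝ) * d = b - a := hdn
        rw [this]; linarith
  · rintro ⟨i, -, hx⟩
    exact hx.1

/-- A stack is a stratification: consecutive slabs can only meet on their common level. -/
theorem IsStack.exists_isStratification (h : IsStack φ N α β) :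
    ∃ (r : ℕ) (S : Fin r → Set M), IsStratification N S := by
  obtain ⟨r, τ, S, -, -, hS, rfl⟩ := h
  choose F ℓ hℓ using fun i : Fin r => (hS i i.2).exists_homeomorph
  have hτ : ∀ i j, i < j → j ≤ r → τ i < τ j := by
    intro i j hij
    induction j, hij using Nat.le_induction with
    | base => intro hj; exact (hS i hj).lt
    | succ j hij ih => intro hj; exact (ih (by omega)).trans (hS j hj).lt
  have hIcc : ∀ (i : Fin r) (x : M) (hx : x ∈ S i), φ x ∈ Icc (τ i) (τ (i + 1)) := by
    intro i x hx
    have h1 := hℓ i ⟨x, hx⟩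
    have h2 := (ℓ i ⟨x, hx⟩).2.2
    have h3 := (hS i i.2).lt
    simp only at h1
    rw [h1]
    constructor <;> nlinarith [h2.1, h2.2]
  refine ⟨r, fun i => S i, fun i => (hS i i.2).isSubmanifold3, ?_, F, ℓ, ?_, ?_⟩
  · ext x
    simp only [mem_iUnion, mem_Iio, exists_prop]
    exact ⟨fun ⟨j, hj, hx⟩ => ⟨⟨j, hj⟩, hx⟩, fun ⟨j, hx⟩ => ⟨j, j.2, hx⟩⟩
  · intro i j hij
    refine Subset.antisymm ?_ ?_
    · rintro x ⟨hxi, hxj⟩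
      have h1 := (hIcc i x hxi).2
      have h2 := (hIcc j x hxj).1
      rw [hij] at h2
      have h3 := hℓ i ⟨x, hxi⟩
      have h4 := hℓ j ⟨x, hxj⟩
      have h5 := (hS i i.2).lt
      have h6 := (hS j j.2).lt
      have hφx : φ x = τ (i + 1) := le_antisymm h1 h2
      simp only at h3 h4
      rw [hφx] at h3
      rw [hφx, ← hij] at h4
      refine ⟨⟨⟨x, hxi⟩, Subtype.ext ?_, rfl⟩, ⟨⟨x, hxj⟩, Subtype.ext ?_, rfl⟩⟩
      · have : (((ℓ i ⟨x, hxi⟩).2 : ℝ) - 1) * (τ (i + 1) - τ i) = 0 := by linarith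
        rcases mul_eq_zero.1 this with h | h
        · show ((ℓ i ⟨x, hxi⟩).2 : ℝ) = 1
          linarith
        · linarith
      · have : ((ℓ j ⟨x, hxj⟩).2 : ℝ) * (τ (j + 1) - τ j) = 0 := by linarith
        rcases mul_eq_zero.1 this with h | h
        · exact h
        · linarith
    · rintro x ⟨⟨y, -, rfl⟩, ⟨z, -, hz⟩⟩
      exact ⟨y.2, hz ▸ z.2⟩
  · intro i j hij
    rw [eq_empty_iff_forall_notMem]
    rintro x ⟨hxi, hxj⟩
    have h1 := (hIcc i x hxi).2
    have h2 := (hIcc j x hxj).1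
    have h3 := hτ (i + 1) j (by omega) j.2.le
    linarith

end Stacking

/-! ### The canonical ball -/

section CanonicalBall

set_option linter.unusedSectionVars false

theorem stdForm_one (x : E3) : stdForm 1 x = x 0 ^ 2 + x 1 ^ 2 - x 2 ^ 2 := by
  simp [stdForm, Fin.sum_univ_three]; ring

theorem stdForm_two (x : E3) : stdForm 2 x = x 0 ^ 2 - x 1 ^ 2 - x 2 ^ 2 := by
  simp [stdForm, Fin.sum_univ_three]; ring

theorem stdForm_zero (x : E3) : stdForm 0 x = x 0 ^ 2 + x 1 ^ 2 + x 2 ^ 2 := by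
  simp [stdForm, Fin.sum_univ_three]

theorem stdForm_of_three_le {n : ℕ} (hn : 3 ≤ n) (x : E3) :
    stdForm n x = -(x 0 ^ 2 + x 1 ^ 2 + x 2 ^ 2) := by
  have h : ∀ i : ℕ, ¬ (i + 1 + n ≤ 3) := by omega
  simp [stdForm, Fin.sum_univ_three, h]

theorem hasFDerivAt_coord (i : Fin 3) (x : E3) :
    HasFDerivAt (fun y : E3 => y i) (EuclideanSpace.proj i : E3 →L[ℝ] ℝ) x :=
  (EuclideanSpace.proj i : E3 →L[ℝ] ℝ).hasFDerivAt

theorem continuous_coord (i : Fin 3) : Continuous fun y : E3 => y i :=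
  (EuclideanSpace.proj i : E3 →L[ℝ] ℝ).continuous

theorem contDiff_coord {n : WithTop ℕ∞} (i : Fin 3) : ContDiff ℝ n fun y : E3 => y i :=
  (EuclideanSpace.proj i : E3 →L[ℝ] ℝ).contDiff

theorem contDiff_stdForm (n : ℕ) {m : WithTop ℕ∞} : ContDiff ℝ m (stdForm n) :=
  ContDiff.sum fun i _ => contDiff_const.mul ((contDiff_coord i).pow 2)

theorem fderiv_stdForm_one (x v : E3) :
    fderiv ℝ (stdForm 1) x v = 2 * (x 0 * v 0 + x 1 * v 1 - x 2 * v 2) := by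
  have h : HasFDerivAt (fun y : E3 => y 0 ^ 2 + y 1 ^ 2 - y 2 ^ 2) _ x :=
    (((hasFDerivAt_coord 0 x).pow 2).add ((hasFDerivAt_coord 1 x).pow 2)).sub
      ((hasFDerivAt_coord 2 x).pow 2)
  rw [show stdForm 1 = fun y : E3 => y 0 ^ 2 + y 1 ^ 2 - y 2 ^ 2 from funext stdForm_one, h.fderiv]
  simp
  ring

theorem gradient_stdForm_one (x : E3) : gradient (stdForm 1) x = !₂[2 * x 0, 2 * x 1, -2 * x 2] := by
  refine ext_inner_right ℝ fun v => ?_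
  rw [gradient, InnerProductSpace.toDual_symm_apply, fderiv_stdForm_one]
  simp [PiLp.inner_apply, Fin.sum_univ_three]
  ring

/-- The square of the product of the distances from the third axis and from the horizontal plane,
an integral of the gradient flow of `x₁² + x₂² - x₃²`. -/
def hyp (x : E3) : ℝ := (x 0 ^ 2 + x 1 ^ 2) * x 2 ^ 2

theorem continuous_hyp : Continuous hyp :=
  (((continuous_coord 0).pow 2).add ((continuous_coord 1).pow 2)).mul ((continuous_coord 2).pow 2)

theorem sq_mem_Icc_of_hyp_eq {x : E3} (hx : hyp x = 12) (h1 : stdForm 1 x ∈ Icc (-1 : ℝ) 1) :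
    x 2 ^ 2 ∈ Icc (3 : ℝ) 4 := by
  rw [stdForm_one] at h1
  rw [hyp] at hx
  obtain ⟨h1, h2⟩ := h1
  set r := x 0 ^ 2 + x 1 ^ 2
  have hw : 0 ≤ x 2 ^ 2 := sq_nonneg _
  set w := x 2 ^ 2
  constructor
  · by_contra! h
    nlinarith
  · by_contra! h
    nlinarith

/-- The trajectories of a linear differential equation `c' = k c` are exponentials. -/
theorem eq_exp_mul_of_hasDerivWithinAt {k μ : ℝ} {f : ℝ → ℝ}
    (hf : ∀ t ∈ Icc 0 μ, HasDerivWithinAt f (k * f t) (Icc 0 μ) t) {t : ℝ} (ht : t ∈ Icc 0 μ) :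
    f t = Real.exp (k * t) * f 0 := by
  rcases ht.1.eq_or_lt with rfl | h0
  · simp
  have hμ : 0 < μ := h0.trans_le ht.2
  have hd : ∀ t ∈ Icc 0 μ, HasDerivWithinAt (fun t => Real.exp (-(k * t)) * f t) 0 (Icc 0 μ) t := by
    intro t ht
    have h1 : HasDerivAt (fun t => Real.exp (-(k * t))) (Real.exp (-(k * t)) * (-(k * 1))) t :=
      (((hasDerivAt_id t).const_mul k).neg).exp
    exact (h1.hasDerivWithinAt.mul (hf t ht)).congr_deriv (by ring)
  have := constant_of_derivWithin_zero (fun t ht => (hd t ht).differentiableWithinAt)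
    (fun t ht => (hd t ⟨ht.1, ht.2.le⟩).derivWithin (uniqueDiffOn_Icc hμ t ⟨ht.1, ht.2.le⟩)) t ht
  simp only [mul_zero, neg_zero, Real.exp_zero, one_mul] at this
  rw [← this, ← mul_assoc, ← Real.exp_add]
  simp

/-- The trajectories that sweep out a ring stay on one level surface of `hyp`, and `ψ` increases from
`-1` to `1` along them. -/
theorem ring3_subset {s : ℝ} (hs : s * s = 1) {x : E3} (hx : x ∈ ring3 s) :
    hyp x = 12 ∧ stdForm 1 x ∈ Icc (-1 : ℝ) 1 ∧ 0 < s * x 2 := by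
  obtain ⟨μ, hμ, c, hc, ⟨⟨h0, -, -⟩, h2⟩, hL, τ, hτ, rfl⟩ := hx
  have hco : ∀ i : Fin 3, ∀ t ∈ Icc 0 μ, HasDerivWithinAt (fun t => c t i)
      ((gradient (stdForm 1) (c t)) i) (Icc 0 μ) t := fun i t ht =>
    ((hasFDerivAt_coord i (c t)).comp_hasDerivWithinAt t (hc t ht))
  have e0 : ∀ t ∈ Icc 0 μ, c t 0 = Real.exp (2 * t) * c 0 0 := fun t ht =>
    eq_exp_mul_of_hasDerivWithinAt (f := fun t => c t 0) (fun t ht => by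
      have := hco 0 t ht; rw [gradient_stdForm_one] at this; exact this) ht
  have e1 : ∀ t ∈ Icc 0 μ, c t 1 = Real.exp (2 * t) * c 0 1 := fun t ht =>
    eq_exp_mul_of_hasDerivWithinAt (f := fun t => c t 1) (fun t ht => by
      have := hco 1 t ht; rw [gradient_stdForm_one] at this; exact this) ht
  have e2 : ∀ t ∈ Icc 0 μ, c t 2 = Real.exp (-2 * t) * c 0 2 := fun t ht =>
    eq_exp_mul_of_hasDerivWithinAt (f := fun t => c t 2) (fun t ht => by
      have := hco 2 t ht; rw [gradient_stdForm_one] at this; exact this) ht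
  have hz : c 0 2 ^ 2 = 4 := by
    have : (s * c 0 2) ^ 2 = 4 := by rw [h2]; norm_num
    calc c 0 2 ^ 2 = (s * s) * c 0 2 ^ 2 := by rw [hs, one_mul]
      _ = (s * c 0 2) ^ 2 := by ring
      _ = 4 := this
  have hr : c 0 0 ^ 2 + c 0 1 ^ 2 = 3 := by
    rw [stdForm_one] at h0; linarith
  have hinv : ∀ t : ℝ, Real.exp (2 * t) * Real.exp (-2 * t) = 1 := fun t => by
    rw [← Real.exp_add]; simp
  -- along the trajectory, `ψ` is an increasing function of time
  have hψ : ∀ t ∈ Icc 0 μ, stdForm 1 (c t) = 3 * Real.exp (2 * t) ^ 2 - 4 * Real.exp (-2 * t) ^ 2 := by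
    intro t ht
    rw [stdForm_one, e0 t ht, e1 t ht, e2 t ht]
    linear_combination Real.exp (2 * t) ^ 2 * hr - Real.exp (-2 * t) ^ 2 * hz
  have hmono : ∀ t ∈ Icc 0 μ, ∀ t' ∈ Icc 0 μ, t ≤ t' → stdForm 1 (c t) ≤ stdForm 1 (c t') := by
    intro t ht t' ht' htt
    rw [hψ t ht, hψ t' ht']
    have h3 : Real.exp (2 * t) ≤ Real.exp (2 * t') := Real.exp_le_exp.2 (by linarith)
    have h4 : Real.exp (-2 * t') ≤ Real.exp (-2 * t) := Real.exp_le_exp.2 (by linarith)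
    have h5 := pow_le_pow_left₀ (Real.exp_pos _).le h3 2
    have h6 := pow_le_pow_left₀ (Real.exp_pos _).le h4 2
    linarith
  refine ⟨?_, ⟨?_, ?_⟩, ?_⟩
  · rw [hyp, e0 τ hτ, e1 τ hτ, e2 τ hτ]
    have : (Real.exp (2 * τ) * Real.exp (-2 * τ)) ^ 2 = 1 := by rw [hinv, one_pow]
    calc ((Real.exp (2 * τ) * c 0 0) ^ 2 + (Real.exp (2 * τ) * c 0 1) ^ 2) *
          (Real.exp (-2 * τ) * c 0 2) ^ 2
        = (Real.exp (2 * τ) * Real.exp (-2 * τ)) ^ 2 * ((c 0 0 ^ 2 + c 0 1 ^ 2) * c 0 2 ^ 2) := by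
          ring
      _ = 12 := by rw [this, hr, hz]; norm_num
  · rw [← h0]
    exact hmono 0 ⟨le_rfl, hμ.le⟩ τ hτ hτ.1
  · have : stdForm 1 (c μ) = 1 := hL
    rw [← this]
    exact hmono τ hτ μ ⟨hμ.le, le_rfl⟩ hτ.2
  · rw [e2 τ hτ]
    have : s * (Real.exp (-2 * τ) * c 0 2) = Real.exp (-2 * τ) * (s * c 0 2) := by ring
    rw [this, h2]
    positivity

theorem mem_ring3 {s : ℝ} (hs : s * s = 1) {x : E3} (hx : hyp x = 12)
    (h1 : stdForm 1 x ∈ Icc (-1 : ℝ) 1) (hsx : 0 < s * x 2) : x ∈ ring3 s := by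
  obtain ⟨hw1, hw2⟩ := sq_mem_Icc_of_hyp_eq hx h1
  have hsq : (s * x 2) ^ 2 = x 2 ^ 2 := by rw [mul_pow, pow_two s, hs, one_mul]
  set p := s * x 2 with hp
  have hp2 : p ≤ 2 := by nlinarith
  have h3 : (0 : ℝ) < √3 := by positivity
  have h33 : √3 ^ 2 = 3 := Real.sq_sqrt (by norm_num)
  have hp3 : √3 ≤ p := by nlinarith
  -- times needed to flow from the rim to `x`, and from the rim to the surface `ψ = 1`
  set τ := Real.log (2 / p) / 2 with hτ
  set μ := Real.log (2 / √3) / 2 with hμ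
  have hexp : ∀ q : ℝ, 0 < q → Real.exp (2 * (Real.log q / 2)) = q := fun q hq => by
    rw [mul_div_cancel₀ _ (two_ne_zero), Real.exp_log hq]
  have eτ : Real.exp (2 * τ) = 2 / p := hexp _ (by positivity)
  have eμ : Real.exp (2 * μ) = 2 / √3 := hexp _ (by positivity)
  have hτ0 : 0 ≤ τ := by
    have := Real.log_nonneg ((one_le_div hsx).2 hp2)
    positivity
  have hτμ : τ ≤ μ := by
    have := Real.log_le_log (by positivity) (div_le_div_of_nonneg_left zero_le_two h3 hp3)
    simp only [hτ, hμ]; linarith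
  have hμ0 : 0 < μ := by
    have h4 : √3 < 2 := by nlinarith
    have := Real.log_pos ((one_lt_div h3).2 h4)
    positivity
  let c : ℝ → E3 := fun t => !₂[x 0 * Real.exp (2 * (t - τ)), x 1 * Real.exp (2 * (t - τ)),
    x 2 * Real.exp (-2 * (t - τ))]
  have hr : x 0 ^ 2 + x 1 ^ 2 = 12 / p ^ 2 := by
    rw [hsq, eq_div_iff (by positivity)]; exact hx
  have hψc : ∀ t (E : ℝ), 0 < E → Real.exp (2 * (t - τ)) = E →
      stdForm 1 (c t) = 12 / p ^ 2 * E ^ 2 - p ^ 2 / E ^ 2 ∧ s * c t 2 = p / E := by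
    intro t E hE h
    have h' : Real.exp (-2 * (t - τ)) = E⁻¹ := by rw [← h, ← Real.exp_neg]; ring_nf
    have c0 : c t 0 = x 0 * E := by rw [← h]; rfl
    have c1 : c t 1 = x 1 * E := by rw [← h]; rfl
    have c2 : c t 2 = x 2 * E⁻¹ := by rw [← h']; rfl
    refine ⟨?_, by rw [c2, hp]; ring⟩
    rw [stdForm_one, c0, c1, c2, ← hr, hsq]
    ring
  have E0 : Real.exp (2 * (0 - τ)) = p / 2 := by
    rw [show 2 * (0 - τ) = -(2 * τ) by ring, Real.exp_neg, eτ, inv_div]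
  have Eμ : Real.exp (2 * (μ - τ)) = p / √3 := by
    rw [show 2 * (μ - τ) = 2 * μ - 2 * τ by ring, Real.exp_sub, eτ, eμ]
    field_simp
  obtain ⟨a0, a1⟩ := hψc 0 (p / 2) (by positivity) E0
  obtain ⟨b0, b1⟩ := hψc μ (p / √3) (by positivity) Eμ
  have a1' : s * c 0 2 = 2 := by rw [a1]; field_simp
  refine ⟨μ, hμ0, c, fun t _ => HasDerivAt.hasDerivWithinAt ?_, ⟨⟨?_, ?_, ?_⟩, a1'⟩, ?_, τ,
    ⟨hτ0, hτμ⟩, ?_⟩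
  · rw [gradient_stdForm_one]
    have d1 : HasDerivAt (fun t => Real.exp (2 * (t - τ))) (Real.exp (2 * (t - τ)) * (2 * 1)) t :=
      (((hasDerivAt_id t).sub_const τ).const_mul 2).exp
    have d2 : HasDerivAt (fun t => Real.exp (-2 * (t - τ))) (Real.exp (-2 * (t - τ)) * (-2 * 1)) t :=
      (((hasDerivAt_id t).sub_const τ).const_mul (-2)).exp
    refine (PiLp.continuousLinearEquiv 2 ℝ (fun _ : Fin 3 => ℝ)).symm.hasFDerivAt.comp_hasDerivAt t
      (f := fun t i => c t i) (f' := fun i => (!₂[2 * c t 0, 2 * c t 1, -2 * c t 2] : E3) i)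
      (hasDerivAt_pi.2 fun i => ?_)
    fin_cases i
    · refine (d1.const_mul (x 0)).congr_deriv ?_
      show _ = 2 * (x 0 * Real.exp (2 * (t - τ)))
      ring
    · refine (d1.const_mul (x 1)).congr_deriv ?_
      show _ = 2 * (x 1 * Real.exp (2 * (t - τ)))
      ring
    · refine (d2.const_mul (x 2)).congr_deriv ?_
      show _ = -2 * (x 2 * Real.exp (-2 * (t - τ)))
      ring
  · rw [a0]
    field_simp
    norm_num
  · rw [a1']; norm_num
  · rw [a1']
  · show stdForm 1 (c μ) = 1
    rw [b0, div_pow, h33]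
    field_simp
    norm_num
  · ext i
    fin_cases i <;> simp [c]

/-- The two rings form the wall `hyp = 12` between `ψ = -1` and `ψ = 1`: every point of it is
reached by the explicit exponential trajectory. -/
theorem ring3_union : ring3 1 ∪ ring3 (-1) = {x | hyp x = 12 ∧ stdForm 1 x ∈ Icc (-1 : ℝ) 1} := by
  ext x
  constructor
  · rintro (h | h)
    · exact ⟨(ring3_subset (by norm_num) h).1, (ring3_subset (by norm_num) h).2.1⟩
    · exact ⟨(ring3_subset (by norm_num) h).1, (ring3_subset (by norm_num) h).2.1⟩
  · rintro ⟨h1, h2⟩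
    have h3 := (sq_mem_Icc_of_hyp_eq h1 h2).1
    have hne : x 2 ≠ 0 := by intro h; rw [h] at h3; norm_num at h3
    rcases hne.lt_or_gt with h | h
    · exact Or.inr (mem_ring3 (by norm_num) h1 h2 (by linarith))
    · exact Or.inl (mem_ring3 (by norm_num) h1 h2 (by linarith))

/-! ### Bounded components -/

/-- A function that avoids the value `k` on a preconnected set stays on one side of it. -/
theorem lt_of_isPreconnected {T : Set E3} (hT : IsPreconnected T) {f : E3 → ℝ}
    (hf : Continuous f) {k : ℝ} (hk : ∀ y ∈ T, f y ≠ k) {x : E3} (hx : x ∈ T) (hxk : f x < k) :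
    ∀ y ∈ T, f y < k := by
  intro y hy
  by_contra! h
  obtain ⟨z, hz, hzk⟩ := hT.intermediate_value hx hy hf.continuousOn ⟨hxk.le, h⟩
  exact hk z hz hzk

/-- If `f` avoids `k` on `A`, and the part `f < k` of `A` is bounded, then this part lies in the bounded
part of `A`. -/
theorem mem_boundedPart {A D : Set E3} {f : E3 → ℝ} (hf : Continuous f) {k : ℝ}
    (hk : ∀ y ∈ A, f y ≠ k) (hD : Bornology.IsBounded D) (hAD : ∀ y ∈ A, f y < k → y ∈ D) {x : E3}
    (hx : x ∈ A) (hxk : f x < k) : x ∈ boundedPart A :=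
  ⟨hx, hD.subset fun y hy => hAD y (connectedComponentIn_subset _ _ hy)
    (lt_of_isPreconnected isPreconnected_connectedComponentIn hf
      (fun z hz => hk z (connectedComponentIn_subset _ _ hz)) (mem_connectedComponentIn hx) hxk y hy)⟩

/-- A point on an unbounded ray in `A` does not lie in the bounded part of `A`. -/
theorem notMem_boundedPart {A : Set E3} {γ : ℝ → E3} (hγ : ContinuousOn γ (Ici 1))
    (hA : ∀ t ∈ Ici (1 : ℝ), γ t ∈ A) (i : Fin 3) {v : ℝ} (hv : v ≠ 0)
    (hi : ∀ t ∈ Ici (1 : ℝ), γ t i = t * v) : γ 1 ∉ boundedPart A := by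
  rintro ⟨-, h⟩
  have hsub : γ '' Ici 1 ⊆ connectedComponentIn A (γ 1) :=
    (isPreconnected_Ici.image γ hγ).subset_connectedComponentIn
      (mem_image_of_mem γ (mem_Ici.2 le_rfl)) (by rintro _ ⟨t, ht, rfl⟩; exact hA t ht)
  obtain ⟨C, hC⟩ := (h.subset hsub).exists_norm_le
  set t := max 1 ((C + 1) / |v|) with ht
  have ht1 : t ∈ Ici (1 : ℝ) := mem_Ici.2 (le_max_left _ _)
  have h1 := hC _ (mem_image_of_mem γ ht1)
  have h2 := PiLp.norm_apply_le (γ t) i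
  rw [hi t ht1, Real.norm_eq_abs, abs_mul, abs_of_pos (zero_lt_one.trans_le ht1)] at h2
  have h3 : (C + 1) / |v| ≤ t := le_max_right _ _
  rw [div_le_iff₀ (abs_pos.2 hv)] at h3
  linarith

theorem isBounded_of_sq_le {D : Set E3} {C : ℝ}
    (hD : ∀ y ∈ D, y 0 ^ 2 + y 1 ^ 2 + y 2 ^ 2 ≤ C) : Bornology.IsBounded D := by
  refine isBounded_iff_forall_norm_le.2 ⟨√C, fun y hy => ?_⟩
  rw [EuclideanSpace.norm_eq, Fin.sum_univ_three]
  refine Real.sqrt_le_sqrt ?_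
  simpa using hD y hy

/-- The bounded component of the complement of the rings in the hyperboloid `L` is the part around the
waist; its other two components are unbounded, as they contain rays of hyperbolas. -/
theorem cloak_eq : cloak = {x | stdForm 1 x = 1 ∧ hyp x ≤ 12} := by
  have hA : cylL \ (ring3 1 ∪ ring3 (-1)) = {x | stdForm 1 x = 1 ∧ x 2 ^ 2 ≠ 3} := by
    rw [ring3_union]
    ext x
    have key : stdForm 1 x = 1 → (hyp x = 12 ↔ x 2 ^ 2 = 3) := by
      intro h
      rw [stdForm_one] at h
      have : hyp x = (1 + x 2 ^ 2) * x 2 ^ 2 := by rw [hyp]; congr 1; linarith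
      rw [this]
      have hw := sq_nonneg (x 2)
      constructor
      · intro h
        have : (x 2 ^ 2 - 3) * (x 2 ^ 2 + 4) = 0 := by linarith
        rcases mul_eq_zero.1 this with h | h <;> linarith
      · intro h; rw [h]; norm_num
    constructor
    · rintro ⟨h1 : stdForm 1 x = 1, h2⟩
      exact ⟨h1, fun h => h2 ⟨(key h1).2 h, by rw [h1]; norm_num⟩⟩
    · rintro ⟨h1, h2⟩
      exact ⟨h1, fun h => h2 ((key h1).1 h.1)⟩
  have hcont : Continuous fun x : E3 => x 2 ^ 2 := (continuous_coord 2).pow 2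
  have hbd : boundedPart {x | stdForm 1 x = 1 ∧ x 2 ^ 2 ≠ 3} =
      {x | stdForm 1 x = 1 ∧ x 2 ^ 2 < 3} := by
    ext x
    constructor
    · intro hx
      have hxA := hx.1
      refine ⟨hxA.1, lt_of_le_of_ne ?_ hxA.2⟩
      by_contra! h
      have h1 : x 0 ^ 2 + x 1 ^ 2 = 1 + x 2 ^ 2 := by
        have := hxA.1; rw [stdForm_one] at this; linarith
      have hz : x 2 ≠ 0 := by rintro h0; rw [h0] at h; norm_num at h
      -- move away along the hyperbola through `x` in a plane containing the third axis
      let ρ : ℝ → ℝ := fun t => √((1 + (t * x 2) ^ 2) / (1 + x 2 ^ 2))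
      let γ : ℝ → E3 := fun t => !₂[ρ t * x 0, ρ t * x 1, t * x 2]
      have hγ : Continuous γ := by
        refine (PiLp.continuous_toLp 2 _).comp (continuous_pi fun i => ?_)
        have hρ : Continuous ρ := by fun_prop
        fin_cases i
        · exact hρ.mul continuous_const
        · exact hρ.mul continuous_const
        · exact continuous_id.mul continuous_const
      have hγ1 : γ 1 = x := by
        have hρ1 : ρ 1 = 1 := by
          have : 1 + x 2 ^ 2 ≠ 0 := by positivity
          simp [ρ, this]
        ext i
        fin_cases i <;> simp [γ, hρ1]
      have hnot := notMem_boundedPart (A := {x | stdForm 1 x = 1 ∧ x 2 ^ 2 ≠ 3}) hγ.continuousOn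
        (fun t ht => ?_) 2 hz (fun t _ => rfl)
      · rw [hγ1] at hnot; exact hnot hx
      · have hρt : ρ t ^ 2 = (1 + (t * x 2) ^ 2) / (1 + x 2 ^ 2) := Real.sq_sqrt (by positivity)
        have hg0 : γ t 0 = ρ t * x 0 := rfl
        have hg1 : γ t 1 = ρ t * x 1 := rfl
        have hg2 : γ t 2 = t * x 2 := rfl
        refine ⟨?_, ?_⟩
        · rw [stdForm_one, hg0, hg1, hg2, mul_pow, mul_pow, ← mul_add, hρt, h1,
            div_mul_cancel₀ _ (by positivity)]
          ring
        · rw [hg2, mul_pow]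
          have h2 : 1 ≤ t ^ 2 := one_le_pow₀ ht
          nlinarith
    · rintro ⟨h1, h2⟩
      refine mem_boundedPart (f := fun x => x 2 ^ 2) hcont (fun y hy => hy.2)
        (D := {y | stdForm 1 y = 1 ∧ y 2 ^ 2 < 3}) (isBounded_of_sq_le (C := 7) ?_)
        (fun y hy h => ⟨hy.1, h⟩) ⟨h1, h2.ne⟩ h2
      rintro y ⟨hy1, hy2⟩
      rw [stdForm_one] at hy1
      linarith
  rw [cloak, hA, hbd]
  refine Subset.antisymm ?_ ?_
  · refine closure_minimal ?_ ?_
    · rintro x ⟨h1, h2⟩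
      refine ⟨h1, ?_⟩
      rw [stdForm_one] at h1
      rw [hyp, show x 0 ^ 2 + x 1 ^ 2 = 1 + x 2 ^ 2 by linarith]
      nlinarith [sq_nonneg (x 2)]
    · exact (isClosed_eq (contDiff_stdForm 1 (m := 0)).continuous continuous_const).inter
        (isClosed_le continuous_hyp continuous_const)
  · rintro x ⟨h1, h2⟩
    have h1' : x 0 ^ 2 + x 1 ^ 2 = 1 + x 2 ^ 2 := by rw [stdForm_one] at h1; linarith
    have h3 : x 2 ^ 2 ≤ 3 := by
      rw [hyp, h1'] at h2
      nlinarith [sq_nonneg (x 2)]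
    -- approach `x` along the same hyperbola, from the side of the waist
    let ρ : ℝ → ℝ := fun t => √((1 + (t * x 2) ^ 2) / (1 + x 2 ^ 2))
    let γ : ℝ → E3 := fun t => !₂[ρ t * x 0, ρ t * x 1, t * x 2]
    have hγ : Continuous γ := by
      refine (PiLp.continuous_toLp 2 _).comp (continuous_pi fun i => ?_)
      have hρ : Continuous ρ := by fun_prop
      fin_cases i
      · exact hρ.mul continuous_const
      · exact hρ.mul continuous_const
      · exact continuous_id.mul continuous_const
    have hγ1 : γ 1 = x := by
      have hρ1 : ρ 1 = 1 := by
        have : 1 + x 2 ^ 2 ≠ 0 := by positivity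
        simp [ρ, this]
      ext i
      fin_cases i <;> simp [γ, hρ1]
    have hlim : Filter.Tendsto γ (𝓝[Ico 0 1] 1) (𝓝 x) := by
      rw [← hγ1]
      exact hγ.continuousAt.continuousWithinAt
    have hne : (𝓝[Ico (0 : ℝ) 1] 1).NeBot := by
      rw [← mem_closure_iff_nhdsWithin_neBot, closure_Ico zero_ne_one]
      exact ⟨zero_le_one, le_rfl⟩
    refine mem_closure_of_tendsto hlim ?_
    filter_upwards [self_mem_nhdsWithin] with t ht
    have hρt : ρ t ^ 2 = (1 + (t * x 2) ^ 2) / (1 + x 2 ^ 2) := Real.sq_sqrt (by positivity)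
    have hg0 : γ t 0 = ρ t * x 0 := rfl
    have hg1 : γ t 1 = ρ t * x 1 := rfl
    have hg2 : γ t 2 = t * x 2 := rfl
    refine ⟨?_, ?_⟩
    · rw [stdForm_one, hg0, hg1, hg2, mul_pow, mul_pow, ← mul_add, hρt, h1',
        div_mul_cancel₀ _ (by positivity)]
      ring
    · rw [hg2, mul_pow]
      have h5 : t ^ 2 < 1 := by nlinarith [ht.1, ht.2]
      nlinarith [sq_nonneg (x 2)]

/-- The canonical sphere is the boundary of the domain cut out by `|ψ| ≤ 1` and `hyp ≤ 12`. -/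
theorem canonicalSphere_eq :
    canonicalSphere = {x | max |stdForm 1 x| (hyp x / 12) = 1} := by
  have hbay : bay 1 ∪ bay (-1) = {x | stdForm 1 x = -1 ∧ hyp x ≤ 12} := by
    ext x
    have key : stdForm 1 x = -1 → (hyp x ≤ 12 ↔ x 2 ^ 2 ≤ 4) := by
      intro h
      rw [stdForm_one] at h
      have : hyp x = (x 2 ^ 2 - 1) * x 2 ^ 2 := by rw [hyp]; congr 1; linarith
      rw [this]
      have hw := sq_nonneg (x 2)
      constructor
      · intro h; nlinarith
      · intro h; nlinarith
    simp only [bay, mem_union, mem_ofPred_eq]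
    constructor
    · rintro (⟨h, h1, h2⟩ | ⟨h, h1, h2⟩)
      · exact ⟨h, (key h).2 (by nlinarith)⟩
      · exact ⟨h, (key h).2 (by nlinarith)⟩
    · rintro ⟨h, h1⟩
      have h2 := (key h).1 h1
      rcases le_total 0 (x 2) with h0 | h0
      · exact Or.inl ⟨h, by linarith, by nlinarith⟩
      · exact Or.inr ⟨h, by linarith, by nlinarith⟩
  have : canonicalSphere = (bay 1 ∪ bay (-1)) ∪ (ring3 1 ∪ ring3 (-1)) ∪ cloak := by
    rw [canonicalSphere, ← union_assoc]
  rw [this, hbay, ring3_union, cloak_eq]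
  ext x
  simp only [mem_union, mem_ofPred_eq]
  constructor
  · rintro ((⟨h1, h2⟩ | ⟨h1, h2⟩) | ⟨h1, h2⟩)
    · rw [h1, abs_neg, abs_one, max_eq_left]; linarith
    · rw [h1, max_eq_right] <;> norm_num
      exact abs_le.2 h2
    · rw [h1, abs_one, max_eq_left]; linarith
  · intro h
    have ha : |stdForm 1 x| ≤ 1 := h ▸ le_max_left _ _
    have hb : hyp x / 12 ≤ 1 := h ▸ le_max_right _ _
    rcases max_choice |stdForm 1 x| (hyp x / 12) with h' | h'
    · rw [h'] at h
      rcases abs_eq zero_le_one |>.1 h with h'' | h''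
      · exact Or.inr ⟨h'', by linarith⟩
      · exact Or.inl (Or.inl ⟨h'', by linarith⟩)
    · rw [h'] at h
      exact Or.inl (Or.inr ⟨by linarith, abs_le.1 ha⟩)

theorem stdForm_smul (n : ℕ) (c : ℝ) (x : E3) : stdForm n (c • x) = c ^ 2 * stdForm n x := by
  simp only [stdForm, Finset.mul_sum, PiLp.smul_apply, smul_eq_mul]
  exact Finset.sum_congr rfl fun i _ => by ring

theorem hyp_smul (c : ℝ) (x : E3) : hyp (c • x) = c ^ 4 * hyp x := by
  simp only [hyp, PiLp.smul_apply, smul_eq_mul]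
  ring

theorem hyp_nonneg (x : E3) : 0 ≤ hyp x := by unfold hyp; positivity

/-- The canonical ball is cut out by two inequalities. -/
theorem canonicalBall_eq : canonicalBall = {x | |stdForm 1 x| ≤ 1 ∧ hyp x ≤ 12} := by
  set f : E3 → ℝ := fun x => max |stdForm 1 x| (hyp x / 12) with hf
  have hfc : Continuous f :=
    ((contDiff_stdForm 1 (m := 0)).continuous.abs).max (continuous_hyp.div_const _)
  have hlow : ∀ (c : ℝ) x, 0 ≤ c → c ≤ 1 → f (c • x) ≤ c ^ 2 * f x := by
    intro c x h0 h1
    simp only [hf]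
    rw [stdForm_smul, hyp_smul, abs_mul, abs_of_nonneg (sq_nonneg c), mul_max_of_nonneg _ _ (sq_nonneg c)]
    refine max_le_max le_rfl ?_
    have h2 : c ^ 4 ≤ c ^ 2 := pow_le_pow_of_le_one h0 h1 (by norm_num)
    have h3 := hyp_nonneg x
    rw [mul_div_assoc]
    exact mul_le_mul_of_nonneg_right h2 (by positivity)
  have hbd : boundedPart canonicalSphereᶜ = {x | f x < 1} := by
    rw [canonicalSphere_eq]
    ext x
    constructor
    · intro hx
      refine lt_of_le_of_ne ?_ hx.1
      by_contra! h
      have hx0 : ∃ i, x i ≠ 0 := by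
        by_contra! h0
        have h00 : f x = 0 := by simp [hf, stdForm_one, hyp, h0]
        exact absurd (h00 ▸ h : (1 : ℝ) < 0) (by norm_num)
      obtain ⟨i, hi⟩ := hx0
      have hγ : Continuous fun t : ℝ => t • x := continuous_id.smul continuous_const
      refine notMem_boundedPart (γ := fun t : ℝ => t • x) hγ.continuousOn (fun t ht => ?_) i hi
        (fun t _ => rfl) ((one_smul ℝ x).symm ▸ hx)
      have ht0 : (0 : ℝ) < t := zero_lt_one.trans_le ht
      have h1 := hlow t⁻¹ (t • x) (by positivity) (inv_le_one_of_one_le₀ ht)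
      rw [smul_smul, inv_mul_cancel₀ ht0.ne', one_smul] at h1
      have h2 : t⁻¹ ^ 2 ≤ 1 := pow_le_one₀ (by positivity) (inv_le_one_of_one_le₀ ht)
      intro (h3 : f (t • x) = 1)
      rw [h3] at h1
      linarith
    · intro hx
      refine mem_boundedPart (D := {y | f y < 1}) hfc (fun y hy => hy)
        (isBounded_of_sq_le (C := 7) fun y hy => ?_) (fun y _ h => h) (ne_of_lt hx) hx
      obtain ⟨h1, h2⟩ := max_lt_iff.1 (show max _ _ < (1 : ℝ) from hy)
      rw [abs_lt, stdForm_one] at h1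
      rw [hyp] at h2
      have h3 : (y 0 ^ 2 + y 1 ^ 2 - y 2 ^ 2) ^ 2 ≤ 1 := by nlinarith [h1.1, h1.2]
      nlinarith [sq_nonneg (y 0), sq_nonneg (y 1), sq_nonneg (y 2)]
  have hset : {x | |stdForm 1 x| ≤ 1 ∧ hyp x ≤ 12} = {x | f x ≤ 1} := by
    ext x
    simp only [hf, mem_ofPred_eq, max_le_iff]
    rw [div_le_one (by norm_num)]
  rw [canonicalBall, hbd, hset]
  refine Subset.antisymm
    (closure_minimal (fun x (hx : f x < 1) => hx.le) (isClosed_le hfc continuous_const)) ?_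
  intro x (hx : f x ≤ 1)
  have hlim : Filter.Tendsto (fun t : ℝ => t • x) (𝓝[Ico 0 1] 1) (𝓝 x) := by
    have : ContinuousAt (fun t : ℝ => t • x) 1 := by fun_prop
    have h2 := this.continuousWithinAt (s := Ico 0 1)
    rwa [ContinuousWithinAt, one_smul] at h2
  have hne : (𝓝[Ico (0 : ℝ) 1] 1).NeBot := by
    rw [← mem_closure_iff_nhdsWithin_neBot, closure_Ico zero_ne_one]
    exact ⟨zero_le_one, le_rfl⟩
  refine mem_closure_of_tendsto hlim ?_
  filter_upwards [self_mem_nhdsWithin] with t ht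
  show f (t • x) < 1
  have h1 := hlow t x ht.1 ht.2.le
  have h2 : t ^ 2 < 1 := by nlinarith [ht.1, ht.2]
  have h3 : 0 ≤ f x := le_max_of_le_left (abs_nonneg _)
  nlinarith

end CanonicalBall

/-! ### The models of the canonical charts -/

section Model

set_option linter.unusedSectionVars false

/-- The common properties of the quadratic forms `ψ` and of the functions `g` that cut out the
canonical domains `{|ψ| ≤ 1, g ≤ 12}`. The vertical part of the boundary is `{g = 12}`; it is empty
if the index is `0` or `3`, where `g = 0`. The field `indep` says that `ψ` and `g` can be completed to
local coordinates at the points of `{g = 12}`. -/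
structure IsModel (ψ g : E3 → ℝ) : Prop where
  contDiff_form : ContDiff ℝ 1 ψ
  contDiff_wall : ContDiff ℝ 1 g
  form_smul : ∀ (c : ℝ) x, ψ (c • x) = c ^ 2 * ψ x
  wall_smul : ∀ (c : ℝ) x, g (c • x) = c ^ 4 * g x
  wall_nonneg : ∀ x, 0 ≤ g x
  pos : ∀ x, ψ x = 0 → g x = 0 → x = 0
  indep : ∀ x, g x = 12 → ∃ ℓ : E3 →L[ℝ] ℝ, ∀ v, fderiv ℝ ψ x v = 0 → fderiv ℝ g x v = 0 →
    ℓ v = 0 → v = 0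

/-- The domain cut out by the functions of a model. -/
def modelBall (ψ g : E3 → ℝ) : Set E3 := {x | |ψ x| ≤ 1 ∧ g x ≤ 12}

theorem isModel_zero {ψ : E3 → ℝ} (h1 : ContDiff ℝ 1 ψ) (h2 : ∀ (c : ℝ) x, ψ (c • x) = c ^ 2 * ψ x)
    (h3 : ∀ x, ψ x = 0 → x = 0) : IsModel ψ fun _ => 0 :=
  ⟨h1, contDiff_const, h2, fun _ _ => by simp, fun _ => le_rfl, fun x h _ => h3 x h,
    fun _ h => by norm_num at h⟩

theorem E3.ext_coords {x y : E3} (h0 : x 0 = y 0) (h1 : x 1 = y 1) (h2 : x 2 = y 2) : x = y := by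
  ext i
  fin_cases i
  exacts [h0, h1, h2]

theorem fderiv_stdForm_two (x v : E3) :
    fderiv ℝ (stdForm 2) x v = 2 * (x 0 * v 0 - x 1 * v 1 - x 2 * v 2) := by
  have h : HasFDerivAt (fun y : E3 => y 0 ^ 2 - y 1 ^ 2 - y 2 ^ 2) _ x :=
    (((hasFDerivAt_coord 0 x).pow 2).sub ((hasFDerivAt_coord 1 x).pow 2)).sub
      ((hasFDerivAt_coord 2 x).pow 2)
  rw [show stdForm 2 = fun y : E3 => y 0 ^ 2 - y 1 ^ 2 - y 2 ^ 2 from funext stdForm_two, h.fderiv]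
  simp
  ring

theorem fderiv_wall (i j k : Fin 3) (x v : E3) :
    fderiv ℝ (fun y : E3 => (y i ^ 2 + y j ^ 2) * y k ^ 2) x v =
      2 * ((x i * v i + x j * v j) * x k ^ 2 + (x i ^ 2 + x j ^ 2) * x k * v k) := by
  have h : HasFDerivAt (fun y : E3 => (y i ^ 2 + y j ^ 2) * y k ^ 2) _ x :=
    (((hasFDerivAt_coord i x).pow 2).add ((hasFDerivAt_coord j x).pow 2)).mul
      ((hasFDerivAt_coord k x).pow 2)
  rw [h.fderiv]
  simp
  ring

/-- The linear algebra behind the independence of the differentials of the two functions of a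
model of index `1` or `2`. -/
theorem wall_indep {a b c u v w : ℝ} (hg : (a ^ 2 + b ^ 2) * c ^ 2 = 12)
    (h1 : a * u + b * v = c * w) (h2 : (a * u + b * v) * c ^ 2 + (a ^ 2 + b ^ 2) * c * w = 0)
    (h3 : a * v - b * u = 0) : u = 0 ∧ v = 0 ∧ w = 0 := by
  have hc : c ≠ 0 := by rintro rfl; norm_num at hg
  have hr : a ^ 2 + b ^ 2 ≠ 0 := by intro h; rw [h] at hg; norm_num at hg
  have h4 : c * w * (c ^ 2 + (a ^ 2 + b ^ 2)) = 0 := by rw [h1] at h2; linarith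
  have h5 : c ^ 2 + (a ^ 2 + b ^ 2) ≠ 0 := by positivity
  have h6 : c * w = 0 := (mul_eq_zero.1 h4).resolve_right h5
  have h7 : a * u + b * v = 0 := h1.trans h6
  refine ⟨?_, ?_, (mul_eq_zero.1 h6).resolve_left hc⟩
  · refine (mul_eq_zero.1 (?_ : (a ^ 2 + b ^ 2) * u = 0)).resolve_left hr
    linear_combination a * h7 - b * h3
  · refine (mul_eq_zero.1 (?_ : (a ^ 2 + b ^ 2) * v = 0)).resolve_left hr
    linear_combination b * h7 + a * h3

theorem isModel_one : IsModel (stdForm 1) hyp where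
  contDiff_form := contDiff_stdForm 1
  contDiff_wall :=
    (((contDiff_coord 0).pow 2).add ((contDiff_coord 1).pow 2)).mul ((contDiff_coord 2).pow 2)
  form_smul := stdForm_smul 1
  wall_smul := hyp_smul
  wall_nonneg := hyp_nonneg
  pos x h1 h2 := by
    rw [stdForm_one] at h1
    rw [hyp] at h2
    have h3 : x 2 ^ 2 = 0 := by
      have : (x 2 ^ 2) * (x 2 ^ 2) = 0 := by rw [← h2]; congr 1; linarith
      simpa using this
    have h4 : x 0 = 0 := by nlinarith [sq_nonneg (x 0), sq_nonneg (x 1)]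
    have h5 : x 1 = 0 := by nlinarith [sq_nonneg (x 0), sq_nonneg (x 1)]
    exact E3.ext_coords h4 h5 (by simpa using h3)
  indep x hx := by
    refine ⟨x 0 • EuclideanSpace.proj 1 - x 1 • EuclideanSpace.proj 0, fun v h1 h2 h3 => ?_⟩
    rw [fderiv_stdForm_one] at h1
    rw [show hyp = fun y : E3 => (y 0 ^ 2 + y 1 ^ 2) * y 2 ^ 2 from rfl, fderiv_wall] at h2
    simp at h3
    obtain ⟨a0, a1, a2⟩ := wall_indep (u := v 0) (v := v 1) (w := v 2) hx (by linarith)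
      (by linarith) (by linarith)
    exact E3.ext_coords a0 a1 a2

theorem isModel_two : IsModel (stdForm 2) fun y => (y 1 ^ 2 + y 2 ^ 2) * y 0 ^ 2 where
  contDiff_form := contDiff_stdForm 2
  contDiff_wall :=
    (((contDiff_coord 1).pow 2).add ((contDiff_coord 2).pow 2)).mul ((contDiff_coord 0).pow 2)
  form_smul := stdForm_smul 2
  wall_smul c x := by simp; ring
  wall_nonneg x := by positivity
  pos x h1 h2 := by
    rw [stdForm_two] at h1
    have h3 : x 0 ^ 2 = 0 := by
      have : (x 0 ^ 2) * (x 0 ^ 2) = 0 := by rw [← h2]; congr 1; linarith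
      simpa using this
    have h4 : x 1 = 0 := by nlinarith [sq_nonneg (x 1), sq_nonneg (x 2)]
    have h5 : x 2 = 0 := by nlinarith [sq_nonneg (x 1), sq_nonneg (x 2)]
    exact E3.ext_coords (by simpa using h3) h4 h5
  indep x hx := by
    refine ⟨x 1 • EuclideanSpace.proj 2 - x 2 • EuclideanSpace.proj 1, fun v h1 h2 h3 => ?_⟩
    rw [fderiv_stdForm_two] at h1
    rw [fderiv_wall] at h2
    simp at h3
    obtain ⟨a0, a1, a2⟩ := wall_indep (u := v 1) (v := v 2) (w := v 0) hx (by linarith)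
      (by linarith) (by linarith)
    exact E3.ext_coords a2 a0 a1

theorem closedBall_eq_sq : Metric.closedBall (0 : E3) 1 = {x | x 0 ^ 2 + x 1 ^ 2 + x 2 ^ 2 ≤ 1} := by
  ext x
  rw [mem_closedBall_zero_iff, EuclideanSpace.norm_eq, Fin.sum_univ_three, Real.sqrt_le_one]
  simp

/-- Every canonical domain is the domain of a model. -/
theorem exists_isModel (n : ℕ) :
    ∃ g, IsModel (stdForm n) g ∧ canonicalDomain n = modelBall (stdForm n) g := by
  have hsq : ∀ x : E3, x 0 ^ 2 + x 1 ^ 2 + x 2 ^ 2 = 0 → x = 0 := fun x h =>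
    E3.ext_coords (by simp; nlinarith [sq_nonneg (x 0), sq_nonneg (x 1), sq_nonneg (x 2)])
      (by simp; nlinarith [sq_nonneg (x 0), sq_nonneg (x 1), sq_nonneg (x 2)])
      (by simp; nlinarith [sq_nonneg (x 0), sq_nonneg (x 1), sq_nonneg (x 2)])
  have hnn : ∀ x : E3, 0 ≤ x 0 ^ 2 + x 1 ^ 2 + x 2 ^ 2 := fun x => by positivity
  rcases (by omega : n = 0 ∨ n = 1 ∨ n = 2 ∨ 3 ≤ n) with rfl | rfl | rfl | hn
  · refine ⟨fun _ => 0, isModel_zero (contDiff_stdForm 0) (stdForm_smul 0)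
      fun x h => hsq x (by rwa [stdForm_zero] at h), ?_⟩
    rw [canonicalDomain, if_neg (by norm_num), if_neg (by norm_num), closedBall_eq_sq]
    ext x
    simp [modelBall, stdForm_zero, abs_of_nonneg (hnn x)]
  · exact ⟨hyp, isModel_one, by rw [canonicalDomain, if_pos rfl, canonicalBall_eq]; rfl⟩
  · refine ⟨_, isModel_two, ?_⟩
    rw [canonicalDomain, if_neg (by norm_num), if_pos rfl, canonicalBall_eq]
    have key : ∀ x : E3, stdForm 2 (rotY x) = -stdForm 1 x := fun x => by
      rw [stdForm_one, stdForm_two]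
      show x 2 ^ 2 - x 1 ^ 2 - (-x 0) ^ 2 = _
      ring
    ext y
    constructor
    · rintro ⟨x, ⟨h1, h2⟩, rfl⟩
      refine ⟨by rwa [key, abs_neg], ?_⟩
      show (x 1 ^ 2 + (-x 0) ^ 2) * x 2 ^ 2 ≤ 12
      rw [hyp] at h2
      linarith
    · rintro ⟨h1, h2⟩
      have hy : rotY !₂[-y 2, y 1, y 0] = y := by
        refine E3.ext_coords ?_ ?_ ?_ <;> simp [rotY]
      refine ⟨_, ⟨?_, ?_⟩, hy⟩
      · rwa [← hy, key, abs_neg] at h1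
      · show ((-y 2) ^ 2 + y 1 ^ 2) * y 0 ^ 2 ≤ 12
        linarith
  · refine ⟨fun _ => 0, isModel_zero (contDiff_stdForm n) (stdForm_smul n) fun x h => hsq x
      (by rw [stdForm_of_three_le hn] at h; linarith), ?_⟩
    rw [canonicalDomain, if_neg (by omega), if_neg (by omega), closedBall_eq_sq]
    ext x
    simp only [modelBall, mem_ofPred_eq, stdForm_of_three_le hn, abs_neg, abs_of_nonneg (hnn x)]
    norm_num

variable {ψ g : E3 → ℝ}

/-- Euler's identity for the quadratic form of a model. -/
theorem IsModel.fderiv_form_self (h : IsModel ψ g) (y : E3) : fderiv ℝ ψ y y = 2 * ψ y := by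
  have h1 : HasDerivAt (fun t : ℝ => ψ (t • y)) (fderiv ℝ ψ y y) 1 := by
    have h2 : HasDerivAt (fun t : ℝ => t • y) y 1 := by
      simpa using (hasDerivAt_id (1 : ℝ)).smul_const y
    have h3 : HasFDerivAt ψ (fderiv ℝ ψ y) ((1 : ℝ) • y) := by
      rw [one_smul]
      exact (h.contDiff_form.differentiable one_ne_zero y).hasFDerivAt
    exact h3.comp_hasDerivAt (1 : ℝ) h2
  have h4 : HasDerivAt (fun t : ℝ => ψ (t • y)) (2 * ψ y) 1 := by
    simp only [h.form_smul]
    simpa using ((hasDerivAt_id (1 : ℝ)).pow 2).mul_const (ψ y)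
  exact h1.unique h4

/-- A function with `{gauge ≤ 1} = modelBall`, homogeneous of degree two. -/
def modelGauge (ψ g : E3 → ℝ) (x : E3) : ℝ := max |ψ x| √(g x / 12)

theorem IsModel.continuous_gauge (h : IsModel ψ g) : Continuous (modelGauge ψ g) :=
  h.contDiff_form.continuous.abs.max (h.contDiff_wall.continuous.div_const _).sqrt

theorem IsModel.gauge_smul (h : IsModel ψ g) (c : ℝ) (x : E3) :
    modelGauge ψ g (c • x) = c ^ 2 * modelGauge ψ g x := by
  have hc := sq_nonneg c
  rw [modelGauge, modelGauge, h.form_smul, h.wall_smul, abs_mul, abs_of_nonneg hc,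
    mul_max_of_nonneg _ _ hc, show c ^ 4 * g x / 12 = (c ^ 2) ^ 2 * (g x / 12) by ring,
    Real.sqrt_mul (by positivity), Real.sqrt_sq hc]

theorem IsModel.gauge_pos (h : IsModel ψ g) {x : E3} (hx : x ≠ 0) : 0 < modelGauge ψ g x := by
  rw [modelGauge, lt_max_iff, abs_pos, Real.sqrt_pos]
  by_contra! h0
  exact hx (h.pos x h0.1 (le_antisymm (by linarith [h0.2]) (h.wall_nonneg x)))

/-- The model ball is the unit ball of the gauge. -/
theorem IsModel.gauge_le_one (x : E3) : modelGauge ψ g x ≤ 1 ↔ x ∈ modelBall ψ g := by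
  rw [modelGauge, max_le_iff, Real.sqrt_le_one, div_le_one (by norm_num)]
  rfl

end Model

/-! ### A function near the boundary of a model ball -/

section Model

variable {ψ g F : E3 → ℝ} {T : Set E3} {c δ : ℝ}

/-- A `C¹` function that is given by a normal form on a model ball has the differential of the
normal form there, also at the boundary points. -/
theorem IsModel.fderiv_eq (h : IsModel ψ g) (hT : IsOpen T) (hF : ContDiffOn ℝ 1 F T)
    (hKT : modelBall ψ g ⊆ T) (hFK : ∀ y ∈ modelBall ψ g, F y = c + δ * ψ y) {y : E3}
    (hy : y ∈ modelBall ψ g) : fderiv ℝ F y = δ • fderiv ℝ ψ y := by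
  set O : Set E3 := {x | |ψ x| < 1 ∧ g x < 12} with hO
  have hOo : IsOpen O :=
    (isOpen_lt h.contDiff_form.continuous.abs continuous_const).inter
      (isOpen_lt h.contDiff_wall.continuous continuous_const)
  have hOK : O ⊆ modelBall ψ g := fun x hx => ⟨hx.1.le, hx.2.le⟩
  have hEq : EqOn (fderiv ℝ F) (fun y => δ • fderiv ℝ ψ y) O := by
    intro x hx
    have h1 : F =ᶠ[𝓝 x] fun y => c + δ * ψ y := by
      filter_upwards [hOo.mem_nhds hx] with z hz using hFK z (hOK hz)
    rw [h1.fderiv_eq, fderiv_const_add, fderiv_const_mul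
      (h.contDiff_form.differentiable one_ne_zero x)]
  refine hEq.of_subset_closure (t := modelBall ψ g) ?_ ?_ hOK ?_ hy
  · exact ((hF.continuousOn_fderiv_of_isOpen hT le_rfl)).mono hKT
  · exact ((h.contDiff_form.continuous_fderiv one_ne_zero).const_smul δ).continuousOn
  · intro x hx
    have hlim : Filter.Tendsto (fun t : ℝ => t • x) (𝓝[Ico 0 1] 1) (𝓝 x) := by
      have : ContinuousAt (fun t : ℝ => t • x) 1 := by fun_prop
      have h2 := this.continuousWithinAt (s := Ico 0 1)
      rwa [ContinuousWithinAt, one_smul] at h2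
    have hne : (𝓝[Ico (0 : ℝ) 1] 1).NeBot := by
      rw [← mem_closure_iff_nhdsWithin_neBot, closure_Ico zero_ne_one]
      exact ⟨zero_le_one, le_rfl⟩
    refine mem_closure_of_tendsto hlim ?_
    filter_upwards [self_mem_nhdsWithin] with t ht
    have h2 : t ^ 2 < 1 := pow_lt_one₀ ht.1 ht.2 two_ne_zero
    have h4 : t ^ 4 < 1 := pow_lt_one₀ ht.1 ht.2 four_ne_zero
    refine ⟨?_, ?_⟩
    · rw [h.form_smul, abs_mul, abs_of_nonneg (sq_nonneg t)]
      nlinarith [hx.1, abs_nonneg (ψ x), sq_nonneg t]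
    · rw [h.wall_smul]
      have h5 := mul_le_mul_of_nonneg_left hx.2 (show 0 ≤ t ^ 4 by positivity)
      linarith

/-- Just outside a model ball, and inside the wall `{g = 12}`, a function with the normal form
`c + δψ` on the ball takes no value in `[c - δ, c + δ]`: along the rays it moves away from this
interval. -/
theorem IsModel.eventually_notMem_Icc (h : IsModel ψ g) (hT : IsOpen T) (hF : ContDiffOn ℝ 1 F T)
    (hδ : 0 < δ) (hKT : modelBall ψ g ⊆ T) (hFK : ∀ y ∈ modelBall ψ g, F y = c + δ * ψ y) {y : E3}
    (hy : y ∈ modelBall ψ g) :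
    ∀ᶠ z in 𝓝 y, z ∉ modelBall ψ g → g z ≤ 12 → F z ∉ Icc (c - δ) (c + δ) := by
  have hψc := h.contDiff_form.continuous
  rcases hy.1.lt_or_eq with hlt | heq
  · filter_upwards [hψc.abs.continuousAt.eventually (gt_mem_nhds hlt)] with z hz hzK hgz
    exact absurd ⟨hz.le, hgz⟩ hzK
  set σ := ψ y with hσ
  have hσ2 : σ * σ = 1 := by rw [← abs_mul_abs_self, heq, one_mul]
  -- the radial derivative of `σ * F` is positive near `y`
  have hDc : ContinuousAt (fun w => σ * fderiv ℝ F w w) y := by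
    have h1 : ContinuousAt (fderiv ℝ F) y :=
      (hF.continuousOn_fderiv_of_isOpen hT le_rfl).continuousAt (hT.mem_nhds (hKT hy))
    exact continuousAt_const.mul (h1.clm_apply continuousAt_id)
  have hDy : 0 < σ * fderiv ℝ F y y := by
    rw [h.fderiv_eq hT hF hKT hFK hy, smul_apply, h.fderiv_form_self, smul_eq_mul,
      ← hσ]
    have : σ * (δ * (2 * σ)) = 2 * δ * (σ * σ) := by ring
    rw [this, hσ2]; linarith
  obtain ⟨r, hr, hball⟩ := Metric.eventually_nhds_iff_ball.1
    ((hDc.eventually (lt_mem_nhds hDy)).and (hT.mem_nhds (hKT hy)))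
  -- the point of the ray through `z` at which `ψ` takes the value `σ`
  have hcψ : ContinuousAt (fun z => σ * ψ z) y := (continuous_const.mul hψc).continuousAt
  have hs : ContinuousAt (fun z => (√(σ * ψ z))⁻¹) y :=
    hcψ.sqrt.inv₀ (by rw [← hσ, hσ2]; simp)
  have hz₀ : ContinuousAt (fun z => (√(σ * ψ z))⁻¹ • z) y := hs.smul continuousAt_id
  have hz₀y : (√(σ * ψ y))⁻¹ • y = y := by rw [← hσ, hσ2]; simp
  filter_upwards [Metric.ball_mem_nhds y hr,
    hz₀.eventually_mem (Metric.ball_mem_nhds _ hr),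
    hcψ.eventually (lt_mem_nhds (show 0 < σ * ψ y by rw [← hσ, hσ2]; exact one_pos))]
    with z hz hzz hpos hzK hgz
  have hzz' : (√(σ * ψ z))⁻¹ • z ∈ Metric.ball y r := by simpa only [hz₀y] using hzz
  have habs : |ψ z| = σ * ψ z := by
    rw [← abs_of_pos hpos, abs_mul, heq, one_mul]
  have h1 : 1 < σ * ψ z := by
    rw [← habs]
    by_contra! hle
    exact hzK ⟨hle, hgz⟩
  set s := (√(σ * ψ z))⁻¹ with hsdef
  have hs1 : s < 1 := inv_lt_one_of_one_lt₀ (by rw [Real.lt_sqrt zero_le_one]; simpa using h1)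
  have hs0 : 0 < s := inv_pos.2 (Real.sqrt_pos.2 hpos)
  have hs2 : s ^ 2 * (σ * ψ z) = 1 := by
    rw [hsdef, inv_pow, Real.sq_sqrt hpos.le, inv_mul_cancel₀ hpos.ne']
  have hψs : ψ (s • z) = σ := by
    rw [h.form_smul]
    calc s ^ 2 * ψ z = σ * σ * (s ^ 2 * ψ z) := by rw [hσ2, one_mul]
      _ = σ * (s ^ 2 * (σ * ψ z)) := by ring
      _ = σ := by rw [hs2, mul_one]
  have hsK : s • z ∈ modelBall ψ g := by
    refine ⟨by rw [hψs, heq], ?_⟩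
    rw [h.wall_smul]
    have : s ^ 4 ≤ 1 := pow_le_one₀ hs0.le hs1.le
    nlinarith [h.wall_nonneg z]
  have hseg : ∀ t ∈ Icc s 1, t • z ∈ Metric.ball y r := by
    intro t ht
    have hmem : t • z ∈ segment ℝ (s • z) z := by
      have h3 : (0 : ℝ) < 1 - s := by linarith
      refine ⟨(1 - t) / (1 - s), (t - s) / (1 - s), div_nonneg (by linarith [ht.2]) h3.le,
        div_nonneg (by linarith [ht.1]) h3.le, by field_simp; ring, ?_⟩
      rw [smul_smul, ← add_smul]
      congr 1
      field_simp
      ring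
    exact (convex_ball y r).segment_subset hzz' hz hmem
  have hd : ∀ t ∈ Icc s 1, HasDerivAt (fun t : ℝ => σ * F (t • z)) (σ * fderiv ℝ F (t • z) z) t := by
    intro t ht
    have hFd : HasFDerivAt F (fderiv ℝ F (t • z)) (t • z) :=
      (((hF.contDiffAt (hT.mem_nhds (hball _ (hseg t ht)).2)).differentiableAt
        one_ne_zero)).hasFDerivAt
    have h4 : HasDerivAt (fun t : ℝ => t • z) z t := by
      simpa using (hasDerivAt_id t).smul_const z
    exact (hFd.comp_hasDerivAt t h4).const_mul σ
  have hmono : StrictMonoOn (fun t : ℝ => σ * F (t • z)) (Icc s 1) := by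
    refine strictMonoOn_of_deriv_pos (convex_Icc _ _)
      (fun t ht => (hd t ht).continuousAt.continuousWithinAt) fun t ht => ?_
    have ht' : t ∈ Icc s 1 := interior_subset ht
    have ht0 : 0 < t := hs0.trans_le ht'.1
    rw [(hd t ht').deriv]
    have h5 : 0 < σ * fderiv ℝ F (t • z) (t • z) := (hball _ (hseg t ht')).1
    rw [map_smul, smul_eq_mul] at h5
    have : 0 < t * (σ * fderiv ℝ F (t • z) z) := by linarith
    exact pos_of_mul_pos_right this ht0.le
  have key := hmono ⟨le_rfl, hs1.le⟩ ⟨hs1.le, le_rfl⟩ hs1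
  simp only [one_smul] at key
  rw [hFK _ hsK, hψs] at key
  rintro ⟨h6, h7⟩
  rcases eq_or_eq_neg_of_abs_eq heq with h8 | h8 <;> rw [h8] at key <;> linarith

end Model

/-! ### The blocks between consecutive levels -/

section Blocks

variable {M : Type*} [TopologicalSpace M] [ChartedSpace E3 M] {φ : M → ℝ} {a b : ℝ} {B : Set M}

theorem contDiffOn_comp_symm [IsManifold (𝓡 3) 1 M] (hφ : ContMDiff (𝓡 3) 𝓘(ℝ) 1 φ)
    {e : OpenPartialHomeomorph M E3} (he : e ∈ IsManifold.maximalAtlas (𝓡 3) 1 M) :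
    ContDiffOn ℝ 1 (φ ∘ e.symm) e.target :=
  (hφ.comp_contMDiffOn (contMDiffOn_symm_of_mem_maximalAtlas he)).contDiffOn

theorem exists_adaptedChart_of_not_isCritical [IsManifold (𝓡 3) 1 M]
    (hφ : ContMDiff (𝓡 3) 𝓘(ℝ) 1 φ) {x : M} (hx : ¬ IsCritical φ x)
    (hB : ∀ᶠ x' in 𝓝 x, (x' ∈ B ↔ a ≤ φ x' ∧ φ x' ≤ b)) :
    ∃ e, x ∈ e.source ∧ IsAdaptedChart φ a b B e := by
  have he : chartAt E3 x ∈ IsManifold.maximalAtlas (𝓡 3) 1 M := IsManifold.chart_mem_maximalAtlas x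
  have hxs := mem_chart_source E3 x
  have hne : fderiv ℝ (φ ∘ (chartAt E3 x).symm) (chartAt E3 x x) ≠ 0 := by
    intro h0
    refine hx ?_
    have hd : MDifferentiableAt (𝓡 3) 𝓘(ℝ) φ x := hφ.mdifferentiable one_ne_zero x
    have h1 := hd.mfderiv
    simp only [writtenInExtChartAt, extChartAt, mfld_simps, fderivWithin_univ] at h1
    exact h1.trans h0
  obtain ⟨e, h1, -, h2⟩ := exists_adaptedChart_of_regular he hxs
    ((contDiffOn_comp_symm hφ he).contDiffAt
      ((chartAt E3 x).open_target.mem_nhds (mem_chart_target E3 x))) hne hB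
  exact ⟨e, h1, h2⟩

/-- A slab without critical points is a block. -/
theorem isBlock_preimage_Icc [IsManifold (𝓡 3) 1 M] (hφ : ContMDiff (𝓡 3) 𝓘(ℝ) 1 φ) (hab : a < b)
    (hreg : ∀ x, φ x ∈ Icc a b → ¬ IsCritical φ x) : IsBlock φ a b (φ ⁻¹' Icc a b) :=
  ⟨hab, isClosed_Icc.preimage hφ.continuous, fun x hx =>
    exists_adaptedChart_of_not_isCritical hφ (hreg x hx) (.of_forall fun _ => Iff.rfl)⟩

/-- A regular point is a limit of points at lower levels and of points at higher levels. -/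
theorem mem_closure_lt_gt_of_not_isCritical [IsManifold (𝓡 3) 1 M] (hφ : ContMDiff (𝓡 3) 𝓘(ℝ) 1 φ)
    {x : M} (hx : ¬ IsCritical φ x) :
    x ∈ closure {x' | φ x' < φ x} ∧ x ∈ closure {x' | φ x < φ x'} := by
  obtain ⟨e, hxe, he⟩ := exists_adaptedChart_of_not_isCritical (a := 1) (b := 0) (B := ∅) hφ hx
    (.of_forall fun x' => ⟨fun h => h.elim, fun h => by linarith [h.1, h.2]⟩)
  let γ : ℝ → E3 := fun t => e x + t • EuclideanSpace.single 0 1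
  have hγ : Continuous γ := by fun_prop
  have hγ0 : γ 0 = e x := by simp [γ]
  have hlim : Filter.Tendsto (e.symm ∘ γ) (𝓝 0) (𝓝 x) := by
    have h1 : ContinuousAt e.symm (γ 0) := by
      rw [hγ0]; exact e.symm.continuousAt (e.map_source hxe)
    have h2 := h1.comp hγ.continuousAt
    rwa [ContinuousAt, Function.comp_apply, hγ0, e.left_inv hxe] at h2
  have hev : ∀ᶠ t in 𝓝 (0 : ℝ), φ (e.symm (γ t)) = φ x + t := by
    have : ∀ᶠ t in 𝓝 (0 : ℝ), γ t ∈ e.target :=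
      hγ.continuousAt (by rw [hγ0]; exact e.open_target.mem_nhds (e.map_source hxe))
    filter_upwards [this] with t ht
    rw [← he.height _ (e.map_target ht), e.right_inv ht, ← he.height x hxe]
    simp [γ]
  constructor
  · refine mem_closure_of_tendsto (hlim.mono_left (nhdsWithin_le_nhds (s := Iio 0))) ?_
    filter_upwards [hev.filter_mono nhdsWithin_le_nhds, self_mem_nhdsWithin] with t h1 h2
    rw [Function.comp_apply, h1]
    linarith [mem_Iio.1 h2]
  · refine mem_closure_of_tendsto (hlim.mono_left (nhdsWithin_le_nhds (s := Ioi 0))) ?_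
    filter_upwards [hev.filter_mono nhdsWithin_le_nhds, self_mem_nhdsWithin] with t h1 h2
    rw [Function.comp_apply, h1]
    linarith [mem_Ioi.1 h2]

/-- Between the levels `c - δ` and `c + δ` of a critical point, the closure of the complement of a
canonical neighbourhood is a block. Its vertical boundary is the wall `{g = 12}`. -/
theorem IsModel.isBlock [IsManifold (𝓡 3) 1 M] (hφ : ContMDiff (𝓡 3) 𝓘(ℝ) 1 φ)
    {ψ g : E3 → ℝ} (h : IsModel ψ g) {c δ : ℝ} (hδ : 0 < δ) {e : OpenPartialHomeomorph M E3}
    (he : e ∈ IsManifold.maximalAtlas (𝓡 3) 1 M) {U : Set M} (hU : IsClosed U)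
    (hUe : U ⊆ e.source) (hUK : e '' U = modelBall ψ g)
    (hFK : ∀ y ∈ modelBall ψ g, φ (e.symm y) = c + δ * ψ y)
    (hreg : ∀ x, φ x ∈ Icc (c - δ) (c + δ) → x ∉ U → ¬ IsCritical φ x) :
    IsBlock φ (c - δ) (c + δ) (closure (φ ⁻¹' Icc (c - δ) (c + δ) \ U)) := by
  set F : E3 → ℝ := φ ∘ e.symm with hFdef
  have hF : ContDiffOn ℝ 1 F e.target := contDiffOn_comp_symm hφ he
  have hKT : modelBall ψ g ⊆ e.target := by
    rw [← hUK]; rintro _ ⟨x, hx, rfl⟩; exact e.map_source (hUe hx)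
  have hmemU : ∀ x ∈ e.source, (x ∈ U ↔ e x ∈ modelBall ψ g) := by
    intro x hx
    rw [← hUK]
    refine ⟨fun h => mem_image_of_mem _ h, ?_⟩
    rintro ⟨x', hx', heq⟩
    rwa [← e.injOn (hUe hx') hx heq]
  have hslab : IsClosed (φ ⁻¹' Icc (c - δ) (c + δ)) := isClosed_Icc.preimage hφ.continuous
  set A := φ ⁻¹' Icc (c - δ) (c + δ) \ U with hA
  have hBs : closure A ⊆ φ ⁻¹' Icc (c - δ) (c + δ) := closure_minimal sdiff_subset hslab
  refine ⟨by linarith, isClosed_closure, fun x hx => ?_⟩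
  by_cases hxU : x ∈ U
  swap
  · refine exists_adaptedChart_of_not_isCritical hφ (hreg x (hBs hx) hxU) ?_
    filter_upwards [hU.isOpen_compl.mem_nhds hxU] with x' hx'
    exact ⟨fun h => hBs h, fun h => subset_closure ⟨h, hx'⟩⟩
  have hxe := hUe hxU
  have hyK : e x ∈ modelBall ψ g := (hmemU x hxe).1 hxU
  have hgc : ContinuousOn (fun x' => g (e x')) e.source :=
    h.contDiff_wall.continuous.comp_continuousOn e.continuousOn
  -- near `x`, the set `A` lies behind the wall
  have hR : ∀ᶠ x' in 𝓝 x, x' ∈ e.source ∧ (x' ∈ A → 12 < g (e x')) := by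
    filter_upwards [e.open_source.mem_nhds hxe, (e.continuousAt hxe).eventually
      (h.eventually_notMem_Icc e.open_target hF hδ hKT hFK hyK)] with x' hx' h1
    refine ⟨hx', fun hA' => ?_⟩
    by_contra! hle
    refine h1 (fun h2 => hA'.2 ((hmemU x' hx').2 h2)) hle ?_
    rw [hFdef, Function.comp_apply, e.left_inv hx']
    exact hA'.1
  have hR' : ∀ᶠ x' in 𝓝 x, x' ∈ closure A → 12 ≤ g (e x') := by
    filter_upwards [hR.eventually_nhds] with x' h1 hx'
    by_contra! hlt
    have hx'e := h1.self_of_nhds.1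
    obtain ⟨z, hzA, hz1, hz2⟩ := ((mem_closure_iff_frequently.1 hx').and_eventually
      (h1.and ((hgc.continuousAt (e.open_source.mem_nhds hx'e)).eventually
        (gt_mem_nhds hlt)))).exists
    exact absurd (hz1.2 hzA) (not_lt.2 hz2.le)
  have hg12 : g (e x) = 12 := le_antisymm hyK.2 (hR'.self_of_nhds hx)
  obtain ⟨ℓ, hℓ⟩ := h.indep _ hg12
  let f : Fin 3 → E3 → ℝ := ![F, fun y => g y - 12, ℓ]
  have hf : ∀ i, ContDiffAt ℝ 1 (f i) (e x) := by
    intro i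
    fin_cases i
    · exact hF.contDiffAt (e.open_target.mem_nhds (e.map_source hxe))
    · exact (h.contDiff_wall.sub contDiff_const).contDiffAt
    · exact ℓ.contDiff.contDiffAt
  have hinj : ∀ v, (∀ i, fderiv ℝ (f i) (e x) v = 0) → v = 0 := by
    intro v hv
    have h0 : fderiv ℝ F (e x) v = 0 := hv 0
    have h1 : fderiv ℝ (fun y => g y - 12) (e x) v = 0 := hv 1
    have h2 : fderiv ℝ ℓ (e x) v = 0 := hv 2
    rw [h.fderiv_eq e.open_target hF hKT hFK hyK, smul_apply, smul_eq_mul,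
      mul_eq_zero] at h0
    rw [fderiv_sub_const] at h1
    rw [ℓ.fderiv] at h2
    exact hℓ v (h0.resolve_left hδ.ne') h1 h2
  have hf0 : ∀ x' ∈ e.source, f 0 (e x') = φ x' := fun x' hx' => by
    simp [f, hFdef, e.left_inv hx']
  obtain ⟨e', -, hxe', hee', hef'⟩ := exists_chart_of_coords he hxe f hf hinj
  suffices hB : ∀ᶠ x' in 𝓝 x,
      (x' ∈ closure A ↔ c - δ ≤ φ x' ∧ φ x' ≤ c + δ ∧ 0 ≤ f 1 (e x')) by
    obtain ⟨e₁, h1, -, h2⟩ := exists_adaptedChart_of_coords he hxe f hf hinj hf0 hB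
    exact ⟨e₁, h1, h2⟩
  filter_upwards [hR', e'.open_source.mem_nhds hxe'] with x' h1 hx'
  have hf1 : f 1 (e x') = g (e x') - 12 := rfl
  rw [hf1, sub_nonneg]
  refine ⟨fun h => ⟨(hBs h).1, (hBs h).2, h1 h⟩, fun ⟨h2, h3, h4⟩ => ?_⟩
  -- a point of the slab on or behind the wall: move away from the wall at constant height
  let γ : ℝ → E3 := fun t => e' x' + t • EuclideanSpace.single 1 1
  have hγ : Continuous γ := by fun_prop
  have hγ0 : γ 0 = e' x' := by simp [γ]
  have hlim : Filter.Tendsto (e'.symm ∘ γ) (𝓝 0) (𝓝 x') := by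
    have h1 : ContinuousAt e'.symm (γ 0) := by
      rw [hγ0]; exact e'.symm.continuousAt (e'.map_source hx')
    have h2 := h1.comp hγ.continuousAt
    rwa [ContinuousAt, Function.comp_apply, hγ0, e'.left_inv hx'] at h2
  have hev : ∀ᶠ t in 𝓝 (0 : ℝ), γ t ∈ e'.target :=
    hγ.continuousAt (by rw [hγ0]; exact e'.open_target.mem_nhds (e'.map_source hx'))
  refine mem_closure_of_tendsto (hlim.mono_left (nhdsWithin_le_nhds (s := Ioi 0))) ?_
  filter_upwards [hev.filter_mono nhdsWithin_le_nhds, self_mem_nhdsWithin] with t ht ht0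
  have hz := e'.map_target ht
  have hz' := hee' hz
  have e0 : φ (e'.symm (γ t)) = φ x' := by
    rw [← hf0 _ hz', ← hef' _ hz, e'.right_inv ht, ← hf0 _ (hee' hx'), ← hef' _ hx']
    simp [γ]
  have e1 : g (e (e'.symm (γ t))) = g (e x') + t := by
    have h5 : g (e (e'.symm (γ t))) - 12 = (g (e x') - 12) + t := by
      rw [← hf1, ← hef' _ hx' 1]
      change f 1 (e (e'.symm (γ t))) = _
      rw [← hef' _ hz, e'.right_inv ht]
      simp [γ]
    linarith
  refine ⟨?_, fun hzU => ?_⟩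
  · rw [mem_preimage, Function.comp_apply, e0]; exact ⟨h2, h3⟩
  · have h6 := ((hmemU _ hz').1 hzU).2
    rw [e1] at h6
    linarith [mem_Ioi.1 ht0]

end Blocks

/-! ### Local flatness -/

section Flat

/-- Near each point off the origin, a positive continuous function that is homogeneous of degree
`2` is, up to a constant, the first coordinate of a local homeomorphism: polar coordinates with
respect to its level surfaces. -/
theorem exists_openPartialHomeomorph_of_homogeneous {G : E3 → ℝ} (hG : Continuous G)
    (hsmul : ∀ (c : ℝ) x, G (c • x) = c ^ 2 * G x) (hpos : ∀ x, x ≠ 0 → 0 < G x) {y : E3}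
    (hy : y ≠ 0) :
    ∃ f : OpenPartialHomeomorph E3 E3, y ∈ f.source ∧ ∀ z ∈ f.source, f z 0 = G z - 1 := by
  have hne : (EuclideanSpace.single 0 1 : E3) ≠ 0 := by simp
  obtain ⟨A, hA⟩ := SeparatingDual.exists_continuousLinearEquiv_apply_eq (R := ℝ) hy hne
  set H : E3 → ℝ := G ∘ A.symm with hH
  have hHc : Continuous H := hG.comp A.symm.continuous
  have hHs : ∀ (c : ℝ) x, H (c • x) = c ^ 2 * H x := fun c x => by simp [hH, hsmul]
  have hHp : ∀ x : E3, 0 < x 0 → 0 < H x := fun x hx => by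
    refine hpos _ fun h => ?_
    rw [(map_eq_zero_iff A.symm A.symm.injective).1 h] at hx
    exact lt_irrefl _ hx
  let u : E3 → E3 := fun w => !₂[1, w 1, w 2]
  have huc : Continuous u := by
    refine (PiLp.continuous_toLp 2 _).comp (continuous_pi fun i => ?_)
    fin_cases i
    exacts [continuous_const, continuous_coord 1, continuous_coord 2]
  have hHu : ∀ w, 0 < H (u w) := fun w => hHp _ (by simp [u])
  let r : E3 → ℝ := fun w => √((1 + w 0) / H (u w))
  have hr : ∀ w : E3, 0 < 1 + w 0 → 0 < r w := fun w hw => Real.sqrt_pos.2 (div_pos hw (hHu w))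
  have hr2 : ∀ w : E3, 0 < 1 + w 0 → r w ^ 2 * H (u w) = 1 + w 0 := fun w hw => by
    rw [Real.sq_sqrt (div_pos hw (hHu w)).le, div_mul_cancel₀ _ (hHu w).ne']
  let q : OpenPartialHomeomorph E3 E3 :=
    { toFun := fun z => !₂[H z - 1, z 1 / z 0, z 2 / z 0]
      invFun := fun w => r w • u w
      source := {z | 0 < z 0}
      target := {w | 0 < 1 + w 0}
      map_source' := fun z hz => by
        have := hHp z hz
        simpa using this
      map_target' := fun w hw => by
        simpa [u] using hr w hw
      left_inv' := fun z (hz : 0 < z 0) => by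
        have h1 : u !₂[H z - 1, z 1 / z 0, z 2 / z 0] = (z 0)⁻¹ • z := by
          refine E3.ext_coords ?_ ?_ ?_
          · simp [u, hz.ne']
          · simp [u, div_eq_inv_mul]
          · simp [u, div_eq_inv_mul]
        have h2 : r !₂[H z - 1, z 1 / z 0, z 2 / z 0] = z 0 := by
          have h3 := (hHp z hz).ne'
          simp only [r]
          rw [h1, hHs]
          have : (1 + (!₂[H z - 1, z 1 / z 0, z 2 / z 0] : E3) 0) / ((z 0)⁻¹ ^ 2 * H z) =
              z 0 ^ 2 := by
            simp
            field_simp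
          rw [this, Real.sqrt_sq hz.le]
        rw [h1, h2, smul_smul, mul_inv_cancel₀ hz.ne', one_smul]
      right_inv' := fun w (hw : 0 < 1 + w 0) => by
        have h1 := (hr w hw).ne'
        refine E3.ext_coords ?_ ?_ ?_
        · simp [hHs, hr2 w hw]
        · simp [u, h1]
        · simp [u, h1]
      open_source := isOpen_lt continuous_const (continuous_coord 0)
      open_target := isOpen_lt continuous_const (continuous_const.add (continuous_coord 0))
      continuousOn_toFun := by
        refine (PiLp.continuous_toLp 2 _).comp_continuousOn (continuousOn_pi.2 fun i => ?_)
        fin_cases i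
        · exact (hHc.sub continuous_const).continuousOn
        · exact (continuous_coord 1).continuousOn.div (continuous_coord 0).continuousOn
            fun z hz => ne_of_gt hz
        · exact (continuous_coord 2).continuousOn.div (continuous_coord 0).continuousOn
            fun z hz => ne_of_gt hz
      continuousOn_invFun := by
        have : Continuous r := ((continuous_const.add (continuous_coord 0)).div₀
          (hHc.comp huc) fun w => (hHu w).ne').sqrt
        exact (this.smul huc).continuousOn }
  refine ⟨A.toHomeomorph.toOpenPartialHomeomorph ≫ₕ q, ?_, fun z _ => ?_⟩
  · simp [q, hA]
  · simp [q, hH]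

variable {M : Type*} [TopologicalSpace M]

theorem exists_isImage_of_mem_nhds [ChartedSpace E3 M] {N : Set M} {x : M} (hx : N ∈ 𝓝 x) :
    ∃ e : OpenPartialHomeomorph M E3, x ∈ e.source ∧ e.IsImage N {y : E3 | 0 ≤ y 0} := by
  set e := chartAt E3 x
  have hxe : x ∈ e.source := mem_chart_source E3 x
  let e₁ : OpenPartialHomeomorph M E3 :=
    e ≫ₕ (Homeomorph.addRight (EuclideanSpace.single 0 (1 - e x 0))).toOpenPartialHomeomorph
  have he₁ : ∀ x', e₁ x' 0 = e x' 0 + (1 - e x 0) := fun x' => by simp [e₁]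
  have hx1 : x ∈ e₁.source := by simpa [e₁] using hxe
  have hc : ContinuousAt (fun x' => e₁ x' 0) x :=
    (continuous_coord 0).continuousAt.comp (e₁.continuousAt hx1)
  obtain ⟨O, hO, hOo, hxO⟩ := eventually_nhds_iff.1 ((Filter.eventually_mem_set.2 hx).and
    (hc.eventually (lt_mem_nhds (show 0 < e₁ x 0 by rw [he₁]; simp))))
  refine ⟨e₁.restrOpen O hOo, ⟨hx1, hxO⟩, fun x' hx' => ?_⟩
  have h := hO x' hx'.2
  exact ⟨fun _ => h.1, fun _ => h.2.le⟩

theorem exists_isImage_of_eventually {N N' : Set M} {x : M} (h : ∀ᶠ x' in 𝓝 x, x' ∈ N ↔ x' ∈ N')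
    {t : Set E3}
    (hN : ∃ e : OpenPartialHomeomorph M E3, x ∈ e.source ∧ e.IsImage N' t) :
    ∃ e : OpenPartialHomeomorph M E3, x ∈ e.source ∧ e.IsImage N t := by
  obtain ⟨e, hxe, he⟩ := hN
  obtain ⟨O, hO, hOo, hxO⟩ := eventually_nhds_iff.1 h
  refine ⟨e.restrOpen O hOo, ⟨hxe, hxO⟩, fun x' hx' => ?_⟩
  rw [hO x' hx'.2]
  exact he hx'.1

/-- The closed complement of a set that is a ball for a homogeneous gauge in some chart is locally
flat. -/
theorem exists_isImage_closure_compl {G : E3 → ℝ} (hG : Continuous G)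
    (hsmul : ∀ (c : ℝ) x, G (c • x) = c ^ 2 * G x) (hpos : ∀ x, x ≠ 0 → 0 < G x)
    {e : OpenPartialHomeomorph M E3} {U : Set M} (hU : ∀ x ∈ e.source, x ∈ U ↔ G (e x) ≤ 1)
    {x : M} (hxe : x ∈ e.source) (hx : x ∈ closure Uᶜ) :
    ∃ e : OpenPartialHomeomorph M E3, x ∈ e.source ∧ e.IsImage (closure Uᶜ) {y : E3 | 0 ≤ y 0} := by
  have hge : ∀ x' ∈ e.source, x' ∈ closure Uᶜ → 1 ≤ G (e x') := by
    intro x' hx' hcl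
    by_contra! hlt
    have hev : ∀ᶠ z in 𝓝 x', z ∈ U := by
      filter_upwards [e.open_source.mem_nhds hx',
        (hG.continuousAt.comp (e.continuousAt hx')).eventually (gt_mem_nhds hlt)] with z hz h1
      exact (hU z hz).2 (le_of_lt h1)
    exact mem_closure_iff_frequently.1 hcl (hev.mono fun z hz => not_not.2 hz)
  have hx0 : e x ≠ 0 := by
    intro h0
    have h1 := hge x hxe hx
    have h2 := hsmul 0 0
    rw [zero_smul] at h2
    rw [h0, h2] at h1
    norm_num at h1
  obtain ⟨f, hyf, hf⟩ := exists_openPartialHomeomorph_of_homogeneous hG hsmul hpos hx0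
  refine ⟨e ≫ₕ f, by simpa using ⟨hxe, hyf⟩, fun x' hx' => ?_⟩
  have hx'e : x' ∈ e.source := by
    rw [OpenPartialHomeomorph.trans_source] at hx'; exact hx'.1
  have hx'f : e x' ∈ f.source := by
    rw [OpenPartialHomeomorph.trans_source] at hx'; exact hx'.2
  have h0 : (e ≫ₕ f) x' 0 = G (e x') - 1 := hf _ hx'f
  rw [mem_ofPred_eq, h0, sub_nonneg]
  refine ⟨fun h1 => ?_, hge x' hx'e⟩
  -- leave the ball along a ray
  have ht : Filter.Tendsto (fun t : ℝ => t • e x') (𝓝[>] 1) (𝓝 (e x')) := by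
    have : ContinuousAt (fun t : ℝ => t • e x') 1 := by fun_prop
    have h2 := this.continuousWithinAt (s := Ioi 1)
    rwa [ContinuousWithinAt, one_smul] at h2
  have hlim : Filter.Tendsto (fun t : ℝ => e.symm (t • e x')) (𝓝[>] 1) (𝓝 x') := by
    have h2 := (e.symm.continuousAt (e.map_source hx'e)).tendsto.comp ht
    rwa [e.left_inv hx'e] at h2
  refine mem_closure_of_tendsto hlim ?_
  filter_upwards [self_mem_nhdsWithin,
    ht.eventually (e.open_target.mem_nhds (e.map_source hx'e))] with t h2 h3 hUt
  have h4 := (hU _ (e.map_target h3)).1 hUt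
  rw [e.right_inv h3, hsmul] at h4
  have h5 : 1 < t ^ 2 := one_lt_pow₀ h2 two_ne_zero
  nlinarith

/-- The closed complement of finitely many disjoint closed sets, each of which is a ball for a
homogeneous gauge in some chart, is a locally flat submanifold. -/
theorem isSubmanifold3_closure_compl_iUnion {M : Type u} [TopologicalSpace M] [ChartedSpace E3 M]
    {ι : Type*} [Finite ι] {U : ι → Set M} (hcl : ∀ i, IsClosed (U i))
    (hdisj : ∀ i j, i ≠ j → Disjoint (U i) (U j))
    (hU : ∀ i, ∃ (G : E3 → ℝ) (e : OpenPartialHomeomorph M E3), Continuous G ∧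
      (∀ (c : ℝ) x, G (c • x) = c ^ 2 * G x) ∧ (∀ x, x ≠ 0 → 0 < G x) ∧ U i ⊆ e.source ∧
      ∀ x ∈ e.source, x ∈ U i ↔ G (e x) ≤ 1) :
    IsSubmanifold3 (closure (⋃ i, U i)ᶜ) := by
  intro x hx
  by_cases hxU : x ∈ ⋃ i, U i
  swap
  · exact exists_isImage_of_mem_nhds (Filter.mem_of_superset
      ((isClosed_iUnion_of_finite hcl).isOpen_compl.mem_nhds hxU) subset_closure)
  obtain ⟨i, hi⟩ := mem_iUnion.1 hxU
  obtain ⟨G, e, hG, hsmul, hpos, hUe, hUG⟩ := hU i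
  -- the other sets stay away from `x`
  have hev : ∀ᶠ x' in 𝓝 x, (x' ∈ (⋃ j, U j)ᶜ ↔ x' ∈ (U i)ᶜ) := by
    have hev' : ∀ᶠ x' in 𝓝 x, ∀ j, j ≠ i → x' ∉ U j := by
      refine Filter.eventually_all.2 fun j => ?_
      by_cases hj : j = i
      · exact .of_forall fun _ h => absurd hj h
      · filter_upwards [(hcl j).isOpen_compl.mem_nhds (disjoint_right.1 (hdisj j i hj) hi)]
          with x' hx' _ using hx'
    filter_upwards [hev'] with x' hx'
    refine not_congr ⟨fun h => ?_, fun h => mem_iUnion.2 ⟨i, h⟩⟩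
    obtain ⟨j, hj⟩ := mem_iUnion.1 h
    by_cases hji : j = i
    · exact hji ▸ hj
    · exact absurd hj (hx' j hji)
  have hN : ∀ᶠ x' in 𝓝 x, x' ∈ closure (⋃ j, U j)ᶜ ↔ x' ∈ closure (U i)ᶜ := by
    filter_upwards [hev.eventually_nhds] with x' hx'
    rw [mem_closure_iff_frequently, mem_closure_iff_frequently]
    exact Filter.frequently_congr hx'
  exact exists_isImage_of_eventually hN
    (exists_isImage_closure_compl hG hsmul hpos hUG (hUe hi) (hN.self_of_nhds.1 hx))

end Flat

/-! ### Stacking the blocks -/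

section Assembly

/-- Intervals `[lo i, hi i]` that are separated from their successors are pairwise separated. -/
theorem lt_of_lt_of_gaps {k : ℕ} {lo hi : Fin (k + 1) → ℝ} (hlt : ∀ i, lo i < hi i)
    (hgap : ∀ i : Fin k, hi i.castSucc < lo i.succ) {i j : Fin (k + 1)} (hij : i < j) :
    hi i < lo j := by
  have hmono : StrictMono hi := Fin.strictMono_iff_lt_succ.2 fun i => (hgap i).trans (hlt _)
  obtain ⟨j', rfl⟩ := Fin.exists_succ_eq.2 (Fin.ne_zero_of_lt hij)
  exact (hmono.monotone (Fin.le_castSucc_iff.2 hij)).trans_lt (hgap j')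

variable {M : Type u} [TopologicalSpace M] [T2Space M] [CompactSpace M] [ChartedSpace E3 M]
  [IsManifold (𝓡 3) 1 M]

/-- If the critical points lie in sets `U i` that are contained in disjoint slabs, and the closed
complement of `U i` in its slab is a block, then these blocks and the slabs between them form a
stack, whose union is the closed complement of all the `U i`. -/
theorem isStack_closure_compl_iUnion [Nonempty M] (hM : IsOrientable (𝓡 3) M) {φ : M → ℝ}
    (hφ : ContMDiff (𝓡 3) 𝓘(ℝ) 1 φ) {k : ℕ} {lo hi : Fin (k + 1) → ℝ} (hlt : ∀ i, lo i < hi i)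
    (hgap : ∀ i : Fin k, hi i.castSucc < lo i.succ) {U : Fin (k + 1) → Set M}
    (hUs : ∀ i, U i ⊆ φ ⁻¹' Icc (lo i) (hi i))
    (hcrit : ∀ x, IsCritical φ x → ∃ i, x ∈ U i ∧ φ x ∈ Ioo (lo i) (hi i))
    (hblock : ∀ i, IsBlock φ (lo i) (hi i) (closure (φ ⁻¹' Icc (lo i) (hi i) \ U i))) :
    IsStack φ (closure (⋃ i, U i)ᶜ) (lo 0) (hi (Fin.last k)) := by
  have hsep := fun {i j} => lt_of_lt_of_gaps hlt hgap (i := i) (j := j)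
  have hmono : StrictMono hi := Fin.strictMono_iff_lt_succ.2 fun i => (hgap i).trans (hlt _)
  have hmono' : StrictMono lo := Fin.strictMono_iff_lt_succ.2 fun i => (hlt _).trans (hgap i)
  -- a minimum or a maximum of `φ` is critical, which bounds `φ`
  have hbot : ∀ x, lo 0 ≤ φ x := by
    obtain ⟨m, -, hm'⟩ := isCompact_univ.exists_isMinOn univ_nonempty hφ.continuous.continuousOn
    have hm : ∀ z, φ m ≤ φ z := fun z => hm' (mem_univ z)
    have hmc : IsCritical φ m := by
      by_contra hreg
      have h1 := (mem_closure_lt_gt_of_not_isCritical hφ hreg).1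
      obtain ⟨z, hz⟩ := closure_nonempty_iff.1 ⟨m, h1⟩
      exact not_le.2 hz (hm z)
    obtain ⟨i, -, hi'⟩ := hcrit m hmc
    exact fun x => (hmono'.monotone (Fin.zero_le i)).trans (hi'.1.le.trans (hm x))
  have htop : ∀ x, φ x ≤ hi (Fin.last k) := by
    obtain ⟨m, -, hm'⟩ := isCompact_univ.exists_isMaxOn univ_nonempty hφ.continuous.continuousOn
    have hm : ∀ z, φ z ≤ φ m := fun z => hm' (mem_univ z)
    have hmc : IsCritical φ m := by
      by_contra hreg
      have h1 := (mem_closure_lt_gt_of_not_isCritical hφ hreg).2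
      obtain ⟨z, hz⟩ := closure_nonempty_iff.1 ⟨m, h1⟩
      exact not_le.2 hz (hm z)
    obtain ⟨i, -, hi'⟩ := hcrit m hmc
    exact fun x => (hm x).trans (hi'.2.le.trans (hmono.monotone (Fin.le_last i)))
  set N := closure (⋃ i, U i)ᶜ with hN
  -- the blocks lie in `N`
  have hBN : ∀ i, closure (φ ⁻¹' Icc (lo i) (hi i) \ U i) ⊆ N := by
    refine fun i => closure_mono ?_
    rintro x ⟨hx, hxU⟩ hxU'
    obtain ⟨j, hj⟩ := mem_iUnion.1 hxU'
    have hj' := hUs j hj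
    rcases lt_trichotomy i j with h | rfl | h
    · exact absurd (hsep h) (not_lt.2 (hj'.1.trans hx.2))
    · exact hxU hj
    · exact absurd (hsep h) (not_lt.2 (hx.1.trans hj'.2))
  -- the levels strictly between two consecutive slabs do not meet the sets `U j`
  have hout : ∀ (i : Fin k) x, hi i.castSucc < φ x → φ x < lo i.succ → x ∈ (⋃ i, U i)ᶜ := by
    intro i x h1 h2 hxU
    obtain ⟨j, hj⟩ := mem_iUnion.1 hxU
    have hj' := hUs j hj
    rcases le_or_gt j i.castSucc with h | h
    · exact absurd h1 (not_lt.2 (hj'.2.trans (hmono.monotone h)))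
    · exact absurd h2 (not_lt.2 ((hmono'.monotone (Fin.castSucc_lt_iff_succ_le.1 h)).trans hj'.1))
  have hreg : ∀ (i : Fin k) x, φ x ∈ Icc (hi i.castSucc) (lo i.succ) → ¬ IsCritical φ x := by
    intro i x hx hc
    obtain ⟨j, -, hj'⟩ := hcrit x hc
    rcases le_or_gt j i.castSucc with h | h
    · exact absurd (hj'.2.trans_le (hmono.monotone h)) (not_lt.2 hx.1)
    · exact absurd ((hmono'.monotone (Fin.castSucc_lt_iff_succ_le.1 h)).trans_lt hj'.1)
        (not_lt.2 hx.2)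
  have hRN : ∀ i : Fin k, φ ⁻¹' Icc (hi i.castSucc) (lo i.succ) ⊆ N := by
    intro i x hx
    obtain ⟨hlow, hhigh⟩ := mem_closure_lt_gt_of_not_isCritical hφ (hreg i x hx)
    rcases hx.2.lt_or_eq with h2 | h2
    · refine mem_closure_iff_frequently.2 (((mem_closure_iff_frequently.1 hhigh).and_eventually
        (hφ.continuous.continuousAt.eventually (gt_mem_nhds h2))).mono fun z hz => ?_)
      exact hout i z (hx.1.trans_lt hz.1) hz.2
    · have h1 : hi i.castSucc < φ x := h2 ▸ hgap i
      refine mem_closure_iff_frequently.2 (((mem_closure_iff_frequently.1 hlow).and_eventually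
        (hφ.continuous.continuousAt.eventually (lt_mem_nhds h1))).mono fun z hz => ?_)
      exact hout i z hz.2 (hz.1.trans_le hx.2)
  have key : ∀ i : Fin (k + 1), ∃ T : Set M, IsClosed T ∧ IsStack φ T (lo 0) (hi i) ∧ T ⊆ N ∧
      ∀ x ∈ (⋃ i, U i)ᶜ, φ x ≤ hi i → x ∈ T := by
    intro i
    induction i using Fin.induction with
    | zero =>
      refine ⟨∅ ∪ closure (φ ⁻¹' Icc (lo 0) (hi 0) \ U 0), isClosed_empty.union isClosed_closure,
        (isStack_empty φ (lo 0)).append_block hM hφ.continuous (hblock 0),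
        union_subset (empty_subset _) (hBN 0), fun x hx hx' => Or.inr (subset_closure ?_)⟩
      exact ⟨⟨hbot x, hx'⟩, fun h => hx (mem_iUnion.2 ⟨0, h⟩)⟩
    | succ i ih =>
      obtain ⟨T, hTc, hT, hTN, hTm⟩ := ih
      have hR := isBlock_preimage_Icc hφ (hgap i) (hreg i)
      refine ⟨T ∪ φ ⁻¹' Icc (hi i.castSucc) (lo i.succ) ∪
          closure (φ ⁻¹' Icc (lo i.succ) (hi i.succ) \ U i.succ),
        (hTc.union hR.isClosed).union isClosed_closure,
        (hT.append_block hM hφ.continuous hR).append_block hM hφ.continuous (hblock i.succ),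
        union_subset (union_subset hTN (hRN i)) (hBN _), fun x hx hx' => ?_⟩
      rcases le_or_gt (φ x) (hi i.castSucc) with h1 | h1
      · exact Or.inl (Or.inl (hTm x hx h1))
      rcases le_or_gt (φ x) (lo i.succ) with h2 | h2
      · exact Or.inl (Or.inr ⟨h1.le, h2⟩)
      · exact Or.inr (subset_closure ⟨⟨h2.le, hx'⟩, fun h => hx (mem_iUnion.2 ⟨_, h⟩)⟩)
  obtain ⟨T, hTc, hT, hTN, hTm⟩ := key (Fin.last k)
  have : N = T := Subset.antisymm (closure_minimal (fun x hx => hTm x hx (htop x)) hTc) hTN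
  rwa [this]

end Assembly

end

theorem mainTheorem4 {M : Type u} [TopologicalSpace M] [T2Space M] [CompactSpace M]
    [ChartedSpace E3 M] [IsManifold (𝓡 3) 2 M] (hM : IsOrientable (𝓡 3) M)
    (φ : M → ℝ) (k : ℕ) (p : Fin (k + 1) → M) (hφ : IsClimbing φ p)
    (δ : Fin (k + 1) → ℝ) (hδ : ∀ i, 0 < δ i)
    (hδφ : ∀ i : Fin k, φ (p i.castSucc) + δ i.castSucc < φ (p i.succ) - δ i.succ)
    (h : Fin (k + 1) → OpenPartialHomeomorph M E3) (U : Fin (k + 1) → Set M)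
    (hU : ∀ i, IsCanonicalChart φ (p i) (δ i) (h i) (U i)) :
    IsSubmanifold3 (closure (⋃ i, U i)ᶜ) ∧
      ∃ (r : ℕ) (S : Fin r → Set M), IsStratification (closure (⋃ i, U i)ᶜ) S := by
  have hM1 : IsManifold (𝓡 3) 1 M := IsManifold.of_le (n := 2) one_le_two
  have hne : Nonempty M := ⟨p 0⟩
  have hφ1 : ContMDiff (𝓡 3) 𝓘(ℝ) 1 φ := hφ.1.1.of_le one_le_two
  have he : ∀ i, h i ∈ IsManifold.maximalAtlas (𝓡 3) 1 M := fun i =>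
    IsManifold.maximalAtlas_subset_of_le one_le_two (hU i).isChart
  have hcl : ∀ i, IsClosed (U i) := fun i => (hU i).isCompact.isClosed
  choose g hg hgK using fun i => exists_isModel (morseIndex φ (p i))
  have hUK : ∀ i, h i '' U i = modelBall (stdForm (morseIndex φ (p i))) (g i) := fun i =>
    (hU i).image_eq.trans (hgK i)
  have hFK : ∀ i, ∀ y ∈ modelBall (stdForm (morseIndex φ (p i))) (g i),
      φ ((h i).symm y) = φ (p i) + δ i * stdForm (morseIndex φ (p i)) y := by
    intro i y hy
    have h1 := (hU i).normal_form y ((hUK i).symm ▸ hy)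
    rw [← h1, ← mul_assoc, mul_one_div_cancel (hδ i).ne', one_mul, add_sub_cancel]
  have hlt : ∀ i, φ (p i) - δ i < φ (p i) + δ i := fun i => by linarith [hδ i]
  -- `U i` lies in its slab, since `|ψ| ≤ 1` on the canonical domain
  have hUs : ∀ i, U i ⊆ φ ⁻¹' Icc (φ (p i) - δ i) (φ (p i) + δ i) := by
    intro i x hx
    have hy : h i x ∈ modelBall (stdForm (morseIndex φ (p i))) (g i) :=
      hUK i ▸ mem_image_of_mem _ hx
    have h1 := hFK i _ hy
    rw [(h i).left_inv ((hU i).subset_source hx)] at h1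
    obtain ⟨h2, h3⟩ := abs_le.1 hy.1
    rw [mem_preimage, h1]
    constructor <;> nlinarith [hδ i]
  have hcrit : ∀ x, IsCritical φ x →
      ∃ i, x ∈ U i ∧ φ x ∈ Ioo (φ (p i) - δ i) (φ (p i) + δ i) := by
    intro x hx
    obtain ⟨i, rfl⟩ : x ∈ range p := hφ.2.2 ▸ hx
    exact ⟨i, interior_subset (hU i).mem_interior, by linarith [hδ i], by linarith [hδ i]⟩
  have hsep := fun {i j} => lt_of_lt_of_gaps (k := k) (lo := fun i => φ (p i) - δ i)
    (hi := fun i => φ (p i) + δ i) hlt hδφ (i := i) (j := j)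
  have hne_slab : ∀ i j, i ≠ j → ∀ x, φ x ∈ Icc (φ (p i) - δ i) (φ (p i) + δ i) →
      φ x ∉ Icc (φ (p j) - δ j) (φ (p j) + δ j) := by
    intro i j hij x hxi hxj
    rcases lt_or_gt_of_ne hij with h | h
    · exact absurd (hsep h) (not_lt.2 (hxj.1.trans hxi.2))
    · exact absurd (hsep h) (not_lt.2 (hxi.1.trans hxj.2))
  -- in the chart, `U i` is the unit ball of the gauge
  have hmemU : ∀ i, ∀ x ∈ (h i).source,
      x ∈ U i ↔ modelGauge (stdForm (morseIndex φ (p i))) (g i) (h i x) ≤ 1 := by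
    intro i x hx
    rw [IsModel.gauge_le_one, ← hUK]
    exact ((h i).injOn.mem_image_iff (hU i).subset_source hx).symm
  refine ⟨isSubmanifold3_closure_compl_iUnion hcl
    (fun i j hij => disjoint_left.2 fun x hi hj => hne_slab i j hij x (hUs i hi) (hUs j hj))
    fun i => ⟨_, h i, (hg i).continuous_gauge, (hg i).gauge_smul, fun x => (hg i).gauge_pos,
      (hU i).subset_source, hmemU i⟩, ?_⟩
  refine (isStack_closure_compl_iUnion hM hφ1 hlt hδφ hUs hcrit fun i => ?_).exists_isStratification
  refine (hg i).isBlock hφ1 (hδ i) (he i) (hcl i) (hU i).subset_source (hUK i) (hFK i) ?_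
  intro x hx hxU hc
  obtain ⟨j, hxj, -⟩ := hcrit x hc
  rcases eq_or_ne i j with rfl | hij
  · exact hxU hxj
  · exact hne_slab i j hij x hx (hUs j hxj)
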